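/- **Notation.** Let $n\ge 1$, let $\mathbb F_n^+$ be the free semigroup on $n$ generators (words $\alpha$ of length $|\alpha|$, including the empty word), and let $f=(f_1,\dots,f_n)$ be an $n$-tuple of formal power series with complex coefficients in noncommuting indeterminates $Z_1,\dots,Z_n$. For an $n$-tuple $A$ write $A_\alpha=A_{i_1}\cdots A_{i_k}$ if $\alpha=i_1\cdots i_k$, and $A_\emptyset=1$. All Hilbert spaces are complex, and $\|X\|:=\|\sum_i X_iX_i^*\|^{1/2}$ for an $n$-tuple $X$ of bounded operators. *Evaluation.* For $a=\sum a_\alpha Z_\alpha$ and $X\in B(\mathcal H)^n$, $X$ is in the norm- (resp. SOT-) convergence set of $a$ if $a(X):=\sum_{k\ge0}\sum_{|\alpha|=k}a_\alpha X_\alpha$ converges in norm (resp. in the strong operator topology). $X$ is in the radial SOT- (resp. norm-) convergence set of $a$ if for some $\delta\in(0,1)$ the series $a(rX)$ converges in norm for all $r\in(\delta,1)$ and $a(X):=\lim_{r\to1}a(rX)$ exists in the strong operator topology (resp. in norm). Unless said otherwise, an evaluation $a(X)$ of a tuple of series is taken in the SOT sense or in the radial SOT sense; the values agree when both are defined. A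 series is free holomorphic on the open ball $\{\|X\|<\gamma\}$ if it converges in norm at every $X$ in the ball over an infinite dimensional Hilbert space. *The space $\mathbb H^2(f)$ and the model property.* $\mathbb H^2(f)$ is the Hilbert space with orthonormal basis $\{f_\alpha\}_{\alpha\in\mathbb F_n^+}$, with elements $\sum a_\alpha f_\alpha$, $\sum|a_\alpha|^2<\infty$. Let $M_{Z_i}$ and $M_{f_i}$ be the left multiplications by $Z_i$ and $f_i$ on it. The tuple $f$ has the *model property* ($f\in\mathcal M$) if one of the following holds: - (A) the $f_i$ are polynomials and there is an $n$-tuple $q$ of polynomials with $f\circ q=q\circ f=\mathrm{id}$; - (S) $f(0)=0$, each $f_i$ has nonzero radius of convergence, where the radius is $\bigl(\limsup_k(\sum_{|\alpha|=k}|a_\alpha|^2)^{1/2k}\bigr)^{-1}$, the Jacobian determinant of $f$ at $0$ is nonzero, $Z_1,\dots,Z_n\in\mathbb H^2(f)$, the $M_{Z_i}$ are bounded on $\mathbb H^2(f)$, and $M_{f_j}=f_j(M_{Z_1},\dots,M_{Z_n})$ for all $j$; - (F) for some $\gamma>0$, the $f_i$ are free holomorphic on the ball of radius $\gamma$, $f$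 maps this ball into the open unit ball, no nonzero free holomorphic $G$ on the open unit ball satisfies $G\circ f=0$, the coordinate functions are in $\mathbb H^2(f)=\{G\circ f: G=\sum a_\alpha Z_\alpha,\ \sum|a_\alpha|^2<\infty\}$, the $M_{Z_i}$ are bounded on $\mathbb H^2(f)$, and $M_{f_j}=f_j(M_{Z_1},\dots,M_{Z_n})$ for all $j$. Then $M_Z=(M_{Z_1},\dots,M_{Z_n})$ is the *universal model*, $C^*(M_Z)$ is the C*-algebra generated by $I,M_{Z_1},\dots,M_{Z_n}$, and $g=(g_1,\dots,g_n)$ denotes the inverse of $f$ with respect to composition, $g\circ f=\mathrm{id}$ (as polynomials, formal power series, or free holomorphic functions on the open unit ball, respectively). The noncommutative domain of $f$ is $$\mathbb B_f(\mathcal H)=\{X\in B(\mathcal H)^n: g(f(X))=X,\ \|f(X)\|\le1\},$$ where the evaluations $f(X)$ and $g(f(X))$ are required to exist. *Classes.* $f\in\mathcal M_{rad}$ if $f\in\mathcal M$ and there is $\delta\in(0,1)$ with $rf\in\mathcal M$ for all $r\in(\delta,1]$. $f\in\mathcal M^{\|}$ if $f\in\mathcal M$ and $M_Z$ is in the norm-convergence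 set or in the radial norm-convergence set of all $f_i$. $f\in\mathcal M^b$ if $f\in\mathcal M$ and either $M_Z$ is in the SOT-convergence set of all $f_i=\sum a^{(i)}_\alpha Z_\alpha$ and $\sup_m\|\sum_{|\alpha|\le m}a_\alpha^{(i)}M_{Z_\alpha}\|<\infty$ for all $i$, or $M_Z$ is in the radial SOT-convergence set of all $f_i$ and $\sup_{0<r<1}\|f_i(rM_Z)\|<\infty$ for all $i$. $f\in\mathcal M^b_{rad}$ if there is $\delta\in(0,1)$ with $rf\in\mathcal M^b$ for all $r\in(\delta,1]$. *Dilations.* A *minimal dilation* of $T\in\mathbb B_f(\mathcal H)$ is an $n$-tuple $V$ of bounded operators on a Hilbert space $\mathcal K\supseteq\mathcal H$ such that (i) $V\in\mathbb B_f(\mathcal K)$; (ii) there is a unital $*$-representation $\pi:C^*(M_Z)\to B(\mathcal K)$ with $\pi(M_{Z_i})=V_i$ for all $i$; (iii) $V_i^*|_{\mathcal H}=T_i^*$ for all $i$; (iv) $\mathcal K$ is the closed linear span of the subspaces $V_\alpha\mathcal H$, $\alpha\in\mathbb F_n^+$. A *minimal isometric dilation* of a row contraction $Y\in B(\mathcal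 H)^n$ is an $n$-tuple $W$ of bounded operators on a Hilbert space $\mathcal K\supseteq\mathcal H$ with $W_i^*W_j=\delta_{ij}I$, $W_i^*|_{\mathcal H}=Y_i^*$, and $\mathcal K$ the closed linear span of the subspaces $W_\alpha\mathcal H$. **Theorem 3.6.** Let $f\in\mathcal M^b_{rad}$ or $f\in\mathcal M_{rad}\cap\mathcal M^{\|}$, let $g$ be its inverse with respect to composition, and let $T\in\mathbb B_f(\mathcal H)$ for a Hilbert space $\mathcal H$. 1. $T$ has a minimal dilation. 2. It is unique up to an isomorphism: if $V$ on $\mathcal K$ and $V'$ on $\mathcal K'$ are minimal dilations of $T$, there is a unitary $U:\mathcal K\to\mathcal K'$ with $Uh=h$ for $h\in\mathcal H$ and $UV_i=V_i'U$ for all $i$. 3. The row contraction $f(T)$ has a minimal isometric dilation. If $W$ is any minimal isometric dilation of $f(T)$, on $\mathcal K\supseteq\mathcal H$, then the series $g_1(W),\dots,g_n(W)$ converge in norm and $(g_1(W),\dots,g_n(W))$ is a minimal dilation of $T$. Conversely, every minimal dilation $V$ of $T$, on $\mathcal K\supseteq\mathcal H$, is of the form $V=(g_1(W),\dots,g_n(W))$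 for some minimal isometric dilation $W$ of $f(T)$ on the same space $\mathcal K$. -/

import Mathlib

open Filter Topology
open scoped ENNReal

noncomputable section

namespace NCDomain

/-! ### Words and formal power series in noncommuting indeterminates -/

/-- Elements of the free semigroup (with identity, the empty word) on `n` generators. -/
abbrev Word (n : ℕ) : Type := List (Fin n)

/-- A formal power series `∑ a_α Z_α` in noncommuting `Z_1, …, Z_n`, given by its coefficients. -/
abbrev Series (n : ℕ) : Type := Word n → ℂ

/-- The series `1`. -/
def sOne (n : ℕ) : Series n := fun w => if w = [] then 1 else 0

/-- The indeterminate `Z_i`. -/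
def Z {n : ℕ} (i : Fin n) : Series n := fun w => if w = [i] then 1 else 0

/-- The (concatenation) product of formal power series. -/
def sMul {n : ℕ} (a b : Series n) : Series n :=
  fun w => ∑ k ∈ Finset.range (w.length + 1), a (w.take k) * b (w.drop k)

/-- `f_α = f_{i₁} ⋯ f_{iₖ}` for `α = i₁ ⋯ iₖ`, and `f_α = 1` for the empty word. -/
def sWord {n : ℕ} (f : Fin n → Series n) : Word n → Series n
  | [] => sOne n
  | i :: w => sMul (f i) (sWord f w)

/-- Noncommutative polynomials: finitely many nonzero coefficients. -/
def IsPoly {n : ℕ} (a : Series n) : Prop := (Function.support a).Finite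

/-- The composition `G ∘ f = ∑_α G_α f_α`, computed coefficientwise. It is only used when `G` is a
polynomial, or when `f(0) = 0` (then `f_α` has no terms of degree less than `|α|`); in both cases
the sum giving each coefficient has only finitely many nonzero terms. -/
def comp {n : ℕ} (G : Series n) (f : Fin n → Series n) : Series n :=
  fun w => ∑ᶠ α : Word n, G α * sWord f α w

/-- The Jacobian matrix at `0`: its `(i, j)` entry is the coefficient of `Z_j` in `f_i`. -/
def jacobian {n : ℕ} (f : Fin n → Series n) : Matrix (Fin n) (Fin n) ℂ :=
  Matrix.of fun i j => f i [j]

/-- The radius of convergence: its inverse is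
`limsup_k (∑_{|α| = k} |a_α|²)^{1/(2k)}`. -/
def radius {n : ℕ} (a : Series n) : ℝ≥0∞ :=
  (limsup (fun k : ℕ => ENNReal.ofReal
    ((∑ α : Fin k → Fin n, ‖a (List.ofFn α)‖ ^ 2) ^ (1 / (2 * (k : ℝ))))) atTop)⁻¹

/-- The tuple `r f = (r f_1, …, r f_n)`. -/
def scale {n : ℕ} (r : ℝ) (f : Fin n → Series n) : Fin n → Series n :=
  fun i => (r : ℂ) • f i

/-! ### Evaluation at tuples of operators -/

section Evaluation

variable {n : ℕ} {E : Type*} [NormedAddCommGroup E] [InnerProductSpace ℂ E]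

/-- `X_α = X_{i₁} ⋯ X_{iₖ}`, and `X_α = I` for the empty word. -/
def opWord (X : Fin n → E →L[ℂ] E) (α : Word n) : E →L[ℂ] E := (α.map X).prod

/-- The tuple `r X`. -/
def opScale (r : ℝ) (X : Fin n → E →L[ℂ] E) : Fin n → E →L[ℂ] E := fun i => (r : ℂ) • X i

/-- `∑_{k < m} ∑_{|α| = k} a_α X_α`. -/
def partialSum (a : Series n) (X : Fin n → E →L[ℂ] E) (m : ℕ) : E →L[ℂ] E :=
  ∑ k ∈ Finset.range m, ∑ α : Fin k → Fin n, a (List.ofFn α) • opWord X (List.ofFn α)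

/-- `∑_k ∑_{|α| = k} a_α X_α = Y` in the operator norm. -/
def NormSum (a : Series n) (X : Fin n → E →L[ℂ] E) (Y : E →L[ℂ] E) : Prop :=
  Tendsto (partialSum a X) atTop (𝓝 Y)

/-- `∑_k ∑_{|α| = k} a_α X_α = Y` in the strong operator topology. -/
def SOTSum (a : Series n) (X : Fin n → E →L[ℂ] E) (Y : E →L[ℂ] E) : Prop :=
  ∀ x : E, Tendsto (fun m => partialSum a X m x) atTop (𝓝 (Y x))

/-- For all `r < 1` close to `1` the series converges in norm at `r X`, and its values there tend
to `Y` in the strong operator topology as `r → 1`. -/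
def RadSOTSum (a : Series n) (X : Fin n → E →L[ℂ] E) (Y : E →L[ℂ] E) : Prop :=
  ∃ δ ∈ Set.Ioo (0 : ℝ) 1, ∃ F : ℝ → E →L[ℂ] E,
    (∀ r ∈ Set.Ioo δ 1, NormSum a (opScale r X) (F r)) ∧
    ∀ x : E, Tendsto (fun r => F r x) (𝓝[<] 1) (𝓝 (Y x))

/-- As `RadSOTSum`, with the limit `r → 1` taken in the operator norm. -/
def RadNormSum (a : Series n) (X : Fin n → E →L[ℂ] E) (Y : E →L[ℂ] E) : Prop :=
  ∃ δ ∈ Set.Ioo (0 : ℝ) 1, ∃ F : ℝ → E →L[ℂ] E,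
    (∀ r ∈ Set.Ioo δ 1, NormSum a (opScale r X) (F r)) ∧
    Tendsto F (𝓝[<] 1) (𝓝 Y)

/-- The tuple `f` can be evaluated at `X`, with value `Y`: either `X` is in the SOT-convergence set
of `f`, or it is in the radial convergence set of `f`. -/
def Eval (f : Fin n → Series n) (X Y : Fin n → E →L[ℂ] E) : Prop :=
  (∀ i, SOTSum (f i) X (Y i)) ∨ (∀ i, RadSOTSum (f i) X (Y i))

variable [CompleteSpace E]

/-- The norm of the row operator `[X_1, …, X_n]`, that is `‖X_1 X_1^* + ⋯ + X_n X_n^*‖^{1/2}`. -/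
def rowNorm (X : Fin n → E →L[ℂ] E) : ℝ :=
  Real.sqrt ‖∑ i, X i * ContinuousLinearMap.adjoint (X i)‖

/-- The noncommutative domain `𝔹_f(E)`, where `g` is the compositional inverse of `f`:
all `X` with `g(f(X)) = X` and `‖f(X)‖ ≤ 1`. -/
def domain (f g : Fin n → Series n) : Set (Fin n → E →L[ℂ] E) :=
  {X | ∃ Y : Fin n → E →L[ℂ] E, Eval f X Y ∧ Eval g Y X ∧ rowNorm Y ≤ 1}

end Evaluation

/-! ### The Hilbert space `ℍ²(f)` and the universal model

`ℍ²(f)` is the Hilbert space with orthonormal basis `{f_α}`. Its elements `∑ a_α f_α` are recorded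
by their square summable coefficients `(a_α)`. -/

/-- Square summable families indexed by the words. -/
abbrev H2 (n : ℕ) : Type := lp (fun _ : Word n => ℂ) 2

/-- `f` is a tuple of polynomials which is invertible under composition, and `M = (M_{Z_i})` are
the multiplications by the indeterminates on `ℍ²(f)` (the completion of the polynomials). -/
structure ModelA {n : ℕ} (f : Fin n → Series n) (M : Fin n → H2 n →L[ℂ] H2 n) : Prop where
  poly : ∀ i, IsPoly (f i)
  inv : ∃ q : Fin n → Series n, (∀ i, IsPoly (q i)) ∧
    (∀ i, comp (q i) f = Z i) ∧ (∀ i, comp (f i) q = Z i)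
  mul : ∀ i (ψ : H2 n), IsPoly (⇑ψ) →
    IsPoly (⇑(M i ψ)) ∧ comp (⇑(M i ψ)) f = sMul (Z i) (comp (⇑ψ) f)

/-- `f(0) = 0`, `f` has property `(𝒮)`, and `M = (M_{Z_i})` are the multiplications by the
indeterminates on `ℍ²(f)`. -/
structure ModelS {n : ℕ} (f : Fin n → Series n) (M : Fin n → H2 n →L[ℂ] H2 n) : Prop where
  zero : ∀ i, f i [] = 0
  radius_pos : ∀ i, 0 < radius (f i)
  jac : (jacobian f).det ≠ 0
  coord : ∀ i, ∃ c : H2 n, comp (⇑c) f = Z i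
  mul : ∀ i (ψ : H2 n), comp (⇑(M i ψ)) f = sMul (Z i) (comp (⇑ψ) f)
  /-- `L j` is the multiplication operator by `f_j`, and it equals `f_j(M_{Z_1}, …, M_{Z_n})`. -/
  eval : ∃ L : Fin n → H2 n →L[ℂ] H2 n,
    (∀ j (ψ : H2 n), comp (⇑(L j ψ)) f = sMul (f j) (comp (⇑ψ) f)) ∧ Eval f M L

/-- The series `a` is a free holomorphic function on the open operatorial ball of radius `γ`
(over the infinite dimensional separable Hilbert space `H2 n`). -/
def FreeHol {n : ℕ} (a : Series n) (γ : ℝ) : Prop :=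
  ∀ X : Fin n → H2 n →L[ℂ] H2 n, rowNorm X < γ → ∃ Y, NormSum a X Y

/-- `f` is a tuple of free holomorphic functions on the ball of radius `γ`, with range in the open
unit ball, and it is not a right zero divisor with respect to composition with free holomorphic
functions on the open unit ball. -/
structure FreeHolMap {n : ℕ} (γ : ℝ) (f : Fin n → Series n) : Prop where
  pos : 0 < γ
  hol : ∀ i, FreeHol (f i) γ
  range : ∀ X Y : Fin n → H2 n →L[ℂ] H2 n, rowNorm X < γ →
    (∀ i, NormSum (f i) X (Y i)) → rowNorm Y < 1
  not_zero_divisor : ∀ G : Series n, FreeHol G 1 →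
    (∀ X Y : Fin n → H2 n →L[ℂ] H2 n, rowNorm X < γ →
      (∀ i, NormSum (f i) X (Y i)) → NormSum G Y 0) → G = 0

/-- `f` is a tuple of free holomorphic functions on the ball of radius `γ` with property `(ℱ)`, and
`M = (M_{Z_i})` are the multiplications by the coordinate functions on
`ℍ²(f) = {G ∘ f : G square summable}`. Composites and products are those of functions on the
ball. -/
structure ModelF {n : ℕ} (γ : ℝ) (f : Fin n → Series n) (M : Fin n → H2 n →L[ℂ] H2 n) : Prop where
  map : FreeHolMap γ f
  coord : ∀ i, ∃ c : H2 n, ∀ X Y : Fin n → H2 n →L[ℂ] H2 n, rowNorm X < γ →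
    (∀ j, NormSum (f j) X (Y j)) → NormSum (⇑c) Y (X i)
  mul : ∀ i (ψ : H2 n) (X Y : Fin n → H2 n →L[ℂ] H2 n) (P : H2 n →L[ℂ] H2 n), rowNorm X < γ →
    (∀ j, NormSum (f j) X (Y j)) → NormSum (⇑ψ) Y P → NormSum (⇑(M i ψ)) Y (X i * P)
  /-- `L j` is the multiplication operator by `f_j`, and it equals `f_j(M_{Z_1}, …, M_{Z_n})`. -/
  eval : ∃ L : Fin n → H2 n →L[ℂ] H2 n,
    (∀ i (ψ : H2 n) (X Y : Fin n → H2 n →L[ℂ] H2 n) (P : H2 n →L[ℂ] H2 n), rowNorm X < γ →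
      (∀ j, NormSum (f j) X (Y j)) → NormSum (⇑ψ) Y P → NormSum (⇑(L i ψ)) Y (Y i * P)) ∧
    Eval f M L

/-- `f` has the model property and `M = (M_{Z_1}, …, M_{Z_n})` is its universal model. -/
def IsUniversalModel {n : ℕ} (f : Fin n → Series n) (M : Fin n → H2 n →L[ℂ] H2 n) : Prop :=
  ModelA f M ∨ ModelS f M ∨ ∃ γ : ℝ, ModelF γ f M

/-- The class `ℳ` of tuples with the model property. -/
def HasModel {n : ℕ} (f : Fin n → Series n) : Prop :=
  ∃ M : Fin n → H2 n →L[ℂ] H2 n, IsUniversalModel f M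

/-- `g` is the inverse of `f` with respect to composition, `g ∘ f = id`: as polynomials, as formal
power series, or as free holomorphic functions. -/
def IsInverse {n : ℕ} (f g : Fin n → Series n) : Prop :=
  ((∀ i, IsPoly (f i)) ∧ (∀ i, IsPoly (g i)) ∧
    (∀ i, comp (g i) f = Z i) ∧ (∀ i, comp (f i) g = Z i)) ∨
  ((∀ i, f i [] = 0) ∧ (jacobian f).det ≠ 0 ∧ ∀ i, comp (g i) f = Z i) ∨
  (∃ γ : ℝ, FreeHolMap γ f ∧ (∀ i, FreeHol (g i) 1) ∧
    ∀ X Y : Fin n → H2 n →L[ℂ] H2 n, rowNorm X < γ →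
      (∀ j, NormSum (f j) X (Y j)) → ∀ i, NormSum (g i) Y (X i))

/-- The class `ℳ_rad`: the radial approximation property. -/
def MemMrad {n : ℕ} (f : Fin n → Series n) : Prop :=
  HasModel f ∧ ∃ δ ∈ Set.Ioo (0 : ℝ) 1, ∀ r ∈ Set.Ioc δ 1, HasModel (scale r f)

/-- The class `ℳ^∥`: the universal model is in the set of norm convergence, or of radial norm
convergence, of `f`. -/
def MemMnorm {n : ℕ} (f : Fin n → Series n) : Prop :=
  ∃ M : Fin n → H2 n →L[ℂ] H2 n, IsUniversalModel f M ∧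
    ((∀ i, ∃ Y, NormSum (f i) M Y) ∨ (∀ i, ∃ Y, RadNormSum (f i) M Y))

/-- The class `ℳ^b`: the universal model is in the SOT-convergence set of `f` and the partial sums
are bounded, or it is in the radial convergence set of `f` and the values at `r M_Z`, `0 < r < 1`,
are bounded. -/
def MemMb {n : ℕ} (f : Fin n → Series n) : Prop :=
  ∃ M : Fin n → H2 n →L[ℂ] H2 n, IsUniversalModel f M ∧
    ((∀ i, (∃ Y, SOTSum (f i) M Y) ∧ ∃ C : ℝ, ∀ m, ‖partialSum (f i) M m‖ ≤ C) ∨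
     (∀ i, (∃ Y, RadSOTSum (f i) M Y) ∧ ∃ C : ℝ, ∀ r ∈ Set.Ioo (0 : ℝ) 1,
        ∃ Y, NormSum (f i) (opScale r M) Y ∧ ‖Y‖ ≤ C))

/-- The class `ℳ^b_rad`. -/
def MemMbrad {n : ℕ} (f : Fin n → Series n) : Prop :=
  ∃ δ ∈ Set.Ioo (0 : ℝ) 1, ∀ r ∈ Set.Ioc δ 1, MemMb (scale r f)

/-- The (unital) C*-algebra `C*(M_1, …, M_n)` generated by `M_1, …, M_n` and the identity. -/
abbrev cstar {n : ℕ} (M : Fin n → H2 n →L[ℂ] H2 n) : StarSubalgebra ℂ (H2 n →L[ℂ] H2 n) :=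
  (StarAlgebra.adjoin ℂ (Set.range M)).topologicalClosure

theorem mem_cstar {n : ℕ} (M : Fin n → H2 n →L[ℂ] H2 n) (i : Fin n) : M i ∈ cstar M :=
  StarSubalgebra.le_topologicalClosure _ (StarAlgebra.subset_adjoin ℂ _ (Set.mem_range_self i))

/-! ### Dilations -/

section Dilation

variable {n : ℕ} {H K : Type*} [NormedAddCommGroup H] [InnerProductSpace ℂ H] [CompleteSpace H]
  [NormedAddCommGroup K] [InnerProductSpace ℂ K] [CompleteSpace K]

/-- `V_i^*|_H = T_i^*` for all `i`, where `H` is a subspace of `K` through `ι`. -/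
def AdjointExtends (T : Fin n → H →L[ℂ] H) (ι : H →ₗᵢ[ℂ] K) (V : Fin n → K →L[ℂ] K) : Prop :=
  ∀ i h, ContinuousLinearMap.adjoint (V i) (ι h) = ι (ContinuousLinearMap.adjoint (T i) h)

/-- `K` is the closed linear span of the subspaces `V_α H`. -/
def Spans (ι : H →ₗᵢ[ℂ] K) (V : Fin n → K →L[ℂ] K) : Prop :=
  (Submodule.span ℂ {x : K | ∃ (α : Word n) (h : H), x = opWord V α (ι h)}).topologicalClosure = ⊤

/-- `V` is a minimal dilation of `T`, for the domain given by `f`, its inverse `g` and its universal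
model `M`. -/
structure IsMinimalDilation (f g : Fin n → Series n) (M : Fin n → H2 n →L[ℂ] H2 n)
    (T : Fin n → H →L[ℂ] H) (ι : H →ₗᵢ[ℂ] K) (V : Fin n → K →L[ℂ] K) : Prop where
  mem_domain : V ∈ domain f g
  rep : ∃ π : cstar M →⋆ₐ[ℂ] (K →L[ℂ] K), ∀ i, π ⟨M i, mem_cstar M i⟩ = V i
  adjoint_extends : AdjointExtends T ι V
  spans : Spans ι V

/-- `W` is a minimal isometric dilation of the row contraction `Y`: a row isometry
(`W_i^* W_j = δ_{ij} I`) with `W_i^*|_H = Y_i^*`, and `K` is the closed span of the `W_α H`. -/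
structure IsMinimalIsometricDilation (Y : Fin n → H →L[ℂ] H) (ι : H →ₗᵢ[ℂ] K)
    (W : Fin n → K →L[ℂ] K) : Prop where
  row_isometry : ∀ i j, ContinuousLinearMap.adjoint (W i) * W j = if i = j then 1 else 0
  adjoint_extends : AdjointExtends Y ι W
  spans : Spans ι W

end Dilation

end NCDomain

end

open NCDomain

universe u v w

noncomputable section

namespace NCDomain

variable {n : ℕ}

/-! In the basis `f_α` of `ℍ²(f)`, multiplication by `f_i` becomes the left creation operator `S_i`
(`shift i`), and the universal model becomes a tuple of left multiplications by square summable
series, the symbols `M_i 1` (`IsUniversalModel.mul_apply`, `IsUniversalModel.eval`). The symbol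
`φ_i` belonging to `r f` satisfies `φ_i ∘ (r f) = Z_i`, hence `g_i(Z) = φ_i(r Z)`
(`IsInverse.eq_dil`). One admissible `r < 1` therefore makes the `ℓ²` norms of the homogeneous parts
of `g_i` decay like `r^k`, and `g(W)` converges absolutely in norm for every row contraction `W`.

The main device is the bounded map `ψ ↦ ψ(r W)` from square summable series to operators (`h2Eval`).
It respects those products that stay square summable, and sends `φ_i` to `V_i = g_i(W)`. The model
identity for `r f`, applied to the vector `1`, is a norm limit of vectors; its image is the operator
norm limit `f_i(V) = W_i`, ordinary or radial (`normEval_h2Eval`). So `f(g(W)) = W` holds in norm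
even if `f(M)` was only known to converge strongly. For `W = S` this gives `M = g(S)` and `S =
f(M)`, so `M` and `S` generate the same C*-algebra.

If `W` is a row isometry, Poisson kernels of `r W` give a von Neumann inequality, so that `S_i ↦
W_i` extends to a representation, and it sends `M_i` to `g_i(W)` (`exists_representation`).
Conversely, a representation with `M_i ↦ V_i` sends `S = f(M)` to `f(V)`, which is thus a row
isometry. Evaluation of series commutes with compression to `H` (`Eval.intertwine`, where Abel's
theorem reconciles ordinary and radial sums). As `V` and `W` lie in each other's closed algebras,
minimality passes between them. Hence `V = g(W)`, `W = f(V)` matches minimal dilations of `T` with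
minimal isometric dilations of `f(T)`. Existence and uniqueness are then classical: a Schäffer type
construction (`exists_isometric_dilation`) and a comparison of Gram matrices
(`IsMinimalIsometricDilation.gram`). -/

/-! ### Words of a given length -/

/-- The finite set of words of length `k`. -/
def words (n k : ℕ) : Finset (Word n) :=
  (Finset.univ : Finset (Fin k → Fin n)).image List.ofFn

@[simp] theorem mem_words {k : ℕ} {w : Word n} : w ∈ words n k ↔ w.length = k := by
  constructor
  · intro h
    obtain ⟨α, -, rfl⟩ := Finset.mem_image.1 h
    simp
  · rintro rfl
    exact Finset.mem_image.2 ⟨w.get, Finset.mem_univ _, List.ofFn_get w⟩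

theorem sum_ofFn {A : Type*} [AddCommMonoid A] (k : ℕ) (F : Word n → A) :
    ∑ α : Fin k → Fin n, F (List.ofFn α) = ∑ w ∈ words n k, F w := by
  rw [words, Finset.sum_image]
  intro a _ b _ h
  exact List.ofFn_injective h

theorem words_zero : words n 0 = {[]} := by
  ext w; simp

theorem sum_words_succ {A : Type*} [AddCommMonoid A] (k : ℕ) (F : Word n → A) :
    ∑ w ∈ words n (k + 1), F w = ∑ i : Fin n, ∑ w ∈ words n k, F (i :: w) := by
  rw [← Finset.sum_product']
  symm
  refine Finset.sum_bij' (fun p _ => p.1 :: p.2)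
    (fun w hw => (w.head (by rintro rfl; simp at hw), w.tail)) ?_ ?_ ?_ ?_ ?_
  · rintro ⟨i, w⟩ h; simpa using h
  · intro w hw
    rw [mem_words] at hw
    cases w <;> simp_all
  · rintro ⟨i, w⟩ h; simp
  · intro w hw
    rw [mem_words] at hw
    cases w <;> simp_all
  · rintro ⟨i, w⟩ h; simp

/-- Cutting a word at position `k` is a bijection. It serves both the product formula `hom_sMul` and
the telescoping sum in `hasSum_defect`. -/
theorem sum_words_add {A : Type*} [AddCommMonoid A] (k l : ℕ) (F : Word n → Word n → A) :
    ∑ w ∈ words n (k + l), F (w.take k) (w.drop k) =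
      ∑ u ∈ words n k, ∑ v ∈ words n l, F u v := by
  rw [← Finset.sum_product']
  refine Finset.sum_bij' (fun w _ => (w.take k, w.drop k)) (fun p _ => p.1 ++ p.2) ?_ ?_ ?_ ?_ ?_
  · intro w hw
    simp only [mem_words] at hw
    simp [hw]
  · rintro ⟨u, v⟩ h
    simp_all
  · intro w _; simp
  · rintro ⟨u, v⟩ h
    simp only [Finset.mem_product, mem_words] at h
    ext1 <;> simp [← h.1]
  · intro w _; rfl

/-- The finite set of words of length at most `m`. -/
def wordsLE (n m : ℕ) : Finset (Word n) := (Finset.range (m + 1)).biUnion (words n)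

@[simp] theorem mem_wordsLE {m : ℕ} {w : Word n} : w ∈ wordsLE n m ↔ w.length ≤ m := by
  simp [wordsLE]

/-! ### The product of formal power series -/

theorem sMul_nil (a b : Series n) : sMul a b [] = a [] * b [] := by simp [sMul]

/-- Either the left factor takes the empty prefix, or it takes the first letter. This recursion
reduces associativity and the right unit law to induction on the word. -/
theorem sMul_cons (a b : Series n) (i : Fin n) (w : Word n) :
    sMul a b (i :: w) = a [] * b (i :: w) + sMul (fun v => a (i :: v)) b w := by
  simp only [sMul, List.length_cons]
  rw [Finset.sum_range_succ']
  simp [add_comm]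

theorem sMul_add_left (a a' b : Series n) : sMul (a + a') b = sMul a b + sMul a' b := by
  ext w; simp [sMul, add_mul, Finset.sum_add_distrib]

theorem sMul_add_right (a b b' : Series n) : sMul a (b + b') = sMul a b + sMul a b' := by
  ext w; simp [sMul, mul_add, Finset.sum_add_distrib]

theorem sMul_smul_left (c : ℂ) (a b : Series n) : sMul (c • a) b = c • sMul a b := by
  ext w; simp [sMul, mul_assoc, Finset.mul_sum]

theorem sMul_smul_right (c : ℂ) (a b : Series n) : sMul a (c • b) = c • sMul a b := by
  ext w; simp [sMul, mul_left_comm, Finset.mul_sum]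

/-- The product of formal power series as a bilinear map. -/
def sMulₗ : Series n →ₗ[ℂ] Series n →ₗ[ℂ] Series n :=
  LinearMap.mk₂ ℂ sMul sMul_add_left sMul_smul_left sMul_add_right sMul_smul_right

@[simp] theorem sMulₗ_apply (a b : Series n) : sMulₗ a b = sMul a b := rfl

theorem sMul_assoc (a b c : Series n) : sMul (sMul a b) c = sMul a (sMul b c) := by
  ext w
  induction w generalizing a with
  | nil => simp [sMul_nil, mul_assoc]
  | cons i w ih =>
    have h : (fun v => sMul a b (i :: v)) =
        a [] • (fun v => b (i :: v)) + sMul (fun v => a (i :: v)) b := by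
      ext v; simp [sMul_cons]
    rw [sMul_cons, sMul_cons, sMul_cons, h, sMul_add_left, sMul_smul_left, sMul_nil, Pi.add_apply,
      Pi.smul_apply, ih, smul_eq_mul]
    ring

@[simp] theorem sOne_nil : sOne n [] = 1 := rfl

@[simp] theorem sOne_cons (i : Fin n) (w : Word n) : sOne n (i :: w) = 0 := rfl

@[simp] theorem Z_nil (i : Fin n) : (Z i : Series n) [] = 0 := rfl

theorem Z_cons (i j : Fin n) (w : Word n) :
    (Z i : Series n) (j :: w) = if i = j then sOne n w else 0 := by
  by_cases h : i = j
  · subst h; simp [Z, sOne]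
  · simp [Z, h, Ne.symm h]

theorem sMul_zero_left (b : Series n) : sMul 0 b = 0 := by ext w; simp [sMul]

@[simp] theorem one_sMul (a : Series n) : sMul (sOne n) a = a := by
  ext w
  cases w with
  | nil => simp [sMul_nil]
  | cons i w =>
    have : (fun v => sOne n (i :: v)) = 0 := by ext; simp
    rw [sMul_cons, this, sMul_zero_left]
    simp

@[simp] theorem sMul_one (a : Series n) : sMul a (sOne n) = a := by
  ext w
  induction w generalizing a with
  | nil => simp [sMul_nil]
  | cons i w ih => simp [sMul_cons, ih]

@[simp] theorem Z_sMul_nil (i : Fin n) (b : Series n) : sMul (Z i) b [] = 0 := by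
  simp [sMul_nil]

theorem Z_sMul_cons (i j : Fin n) (b : Series n) (w : Word n) :
    sMul (Z i) b (j :: w) = if i = j then b w else 0 := by
  rw [sMul_cons]
  by_cases h : i = j
  · subst h
    have : (fun v => (Z i : Series n) (i :: v)) = sOne n := by ext; simp [Z_cons]
    simp [this]
  · have : (fun v => (Z i : Series n) (j :: v)) = 0 := by ext; simp [Z_cons, h]
    simp [this, sMul_zero_left, h]

theorem sMul_of_vanish {a b : Series n} {w : Word n}
    (hb : ∀ v : Word n, v.length < w.length → b v = 0) : sMul a b w = a [] * b w := by
  rw [sMul, Finset.sum_range_succ', Finset.sum_eq_zero]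
  · simp
  · intro k hk
    rw [hb, mul_zero]
    simp only [Finset.mem_range] at hk
    simp; omega

/-! ### Monomials, substitution -/

/-- The monomial `Z_w`. -/
def mono (w : Word n) : Series n := Pi.single w 1

theorem mono_apply (w v : Word n) : mono w v = if v = w then 1 else 0 := by
  simp [mono, Pi.single_apply]

theorem mono_nil : (mono [] : Series n) = sOne n := by
  ext w; simp [mono_apply, sOne]

theorem mono_singleton (i : Fin n) : mono [i] = Z i := by
  ext w; simp [mono_apply, Z]

theorem Z_sMul_mono (i : Fin n) (w : Word n) : sMul (Z i) (mono w) = mono (i :: w) := by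
  ext v
  cases v with
  | nil => simp [mono_apply]
  | cons j v =>
    by_cases h : i = j
    · subst h; simp [Z_sMul_cons, mono_apply]
    · simp [Z_sMul_cons, mono_apply, h, Ne.symm h]

theorem sWord_Z (w : Word n) : sWord Z w = mono w := by
  induction w with
  | nil => rw [sWord, mono_nil]
  | cons i w ih => rw [sWord, ih, Z_sMul_mono]

theorem sWord_append (f : Fin n → Series n) (u v : Word n) :
    sWord f (u ++ v) = sMul (sWord f u) (sWord f v) := by
  induction u with
  | nil => simp [sWord]
  | cons i u ih => simp [sWord, ih, sMul_assoc]

theorem mono_sMul_mono (u v : Word n) : sMul (mono u) (mono v) = mono (u ++ v) := by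
  rw [← sWord_Z, ← sWord_Z, ← sWord_append, sWord_Z]

@[simp] theorem sWord_singleton (f : Fin n → Series n) (i : Fin n) : sWord f [i] = f i := by
  simp [sWord]

theorem eq_sum_mono {a : Series n} {s : Finset (Word n)} (h : Function.support a ⊆ s) :
    a = ∑ w ∈ s, a w • mono w := by
  ext v
  simp only [Finset.sum_apply, Pi.smul_apply, mono_apply, smul_eq_mul, mul_ite, mul_one, mul_zero,
    Finset.sum_ite_eq]
  split_ifs with hv
  · rfl
  · by_contra h0
    exact hv (h h0)

/-- The support of a polynomial. -/
def IsPoly.supp {a : Series n} (h : IsPoly a) : Finset (Word n) := Set.Finite.toFinset h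

theorem IsPoly.subset_supp {a : Series n} (h : IsPoly a) : Function.support a ⊆ h.supp :=
  fun _ hw => (Set.Finite.mem_toFinset _).2 hw

theorem IsPoly.eq_sum {a : Series n} (h : IsPoly a) : a = ∑ w ∈ h.supp, a w • mono w :=
  eq_sum_mono h.subset_supp

theorem isPoly_mono (w : Word n) : IsPoly (mono w) :=
  (Set.finite_singleton w).subset (by intro v hv; by_contra h; simp_all [mono_apply])

theorem isPoly_zero : IsPoly (0 : Series n) := by simp [IsPoly]

theorem IsPoly.add {a b : Series n} (ha : IsPoly a) (hb : IsPoly b) : IsPoly (a + b) :=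
  (Set.Finite.union ha hb).subset (Function.support_add a b)

theorem IsPoly.smul {a : Series n} (c : ℂ) (ha : IsPoly a) : IsPoly (c • a) :=
  Set.Finite.subset ha (Function.support_const_smul_subset c a)

theorem isPoly_sum {ι : Type*} (s : Finset ι) (F : ι → Series n) (h : ∀ i ∈ s, IsPoly (F i)) :
    IsPoly (∑ i ∈ s, F i) := by
  classical
  induction s using Finset.induction_on with
  | empty => simpa using isPoly_zero
  | insert i s hi ih =>
    rw [Finset.sum_insert hi]
    exact (h _ (by simp)).add (ih fun j hj => h j (by simp [hj]))

theorem isPoly_Z (i : Fin n) : IsPoly (Z i : Series n) := mono_singleton i ▸ isPoly_mono _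

theorem isPoly_one : IsPoly (sOne n) := mono_nil (n := n) ▸ isPoly_mono _

theorem IsPoly.sMul {a b : Series n} (ha : IsPoly a) (hb : IsPoly b) : IsPoly (sMul a b) := by
  rw [ha.eq_sum, hb.eq_sum, ← sMulₗ_apply]
  simp only [map_sum, LinearMap.sum_apply, map_smul, LinearMap.smul_apply, sMulₗ_apply,
    mono_sMul_mono]
  exact isPoly_sum _ _ fun _ _ => (isPoly_sum _ _ fun _ _ => (isPoly_mono _).smul _).smul _ 

theorem isPoly_sWord {f : Fin n → Series n} (hf : ∀ i, IsPoly (f i)) (w : Word n) :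
    IsPoly (sWord f w) := by
  induction w with
  | nil => exact isPoly_one
  | cons i w ih => exact (hf i).sMul ih

theorem comp_eq_sum {a : Series n} {s : Finset (Word n)} (h : Function.support a ⊆ s)
    (f : Fin n → Series n) : comp a f = ∑ w ∈ s, a w • sWord f w := by
  ext v
  rw [comp, finsum_eq_sum_of_support_subset (s := s)]
  · simp
  · intro w hw
    exact h (left_ne_zero_of_mul hw)

theorem sWord_vanish {f : Fin n → Series n} (h0 : ∀ i, f i [] = 0) (u w : Word n)
    (h : w.length < u.length) : sWord f u w = 0 := by
  induction u generalizing w with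
  | nil => simp at h
  | cons i u ih =>
    simp only [sWord, NCDomain.sMul]
    refine Finset.sum_eq_zero fun k _ => ?_
    rcases Nat.eq_zero_or_pos k with rfl | hk
    · simp [h0]
    · by_cases hw : w = []
      · subst hw; simp [h0]
      · rw [ih, mul_zero]
        have := List.length_pos_iff.2 hw
        simp at h ⊢; omega

/-- As `f(0) = 0`, the series `f_u` starts in degree `|u|`, so longer words cannot contribute at
`w`. The set `s` is left free so that several composites can be expanded over a common index set. -/
theorem comp_apply_eq_sum {f : Fin n → Series n} (h0 : ∀ i, f i [] = 0) (a : Series n)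
    {w : Word n} {s : Finset (Word n)} (hs : ∀ u : Word n, u.length ≤ w.length → u ∈ s) :
    comp a f w = ∑ u ∈ s, a u * sWord f u w := by
  rw [comp, finsum_eq_sum_of_support_subset]
  intro u hu
  refine Finset.mem_coe.2 (hs u (not_lt.1 fun hlt => right_ne_zero_of_mul hu ?_))
  exact sWord_vanish h0 u w hlt

theorem comp_sOne (f : Fin n → Series n) : comp (sOne n) f = sOne n := by
  have h : Function.support (sOne n) ⊆ ({[]} : Finset (Word n)) := by
    intro w hw
    by_contra h
    simp_all [sOne]
  rw [comp_eq_sum h]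
  simp [sWord]

theorem comp_mono (w : Word n) (f : Fin n → Series n) : comp (mono w) f = sWord f w := by
  have h : Function.support (mono w) ⊆ ({w} : Finset (Word n)) := by
    intro v hv
    by_contra h
    simp_all [mono_apply]
  rw [comp_eq_sum h]
  simp [mono_apply]

theorem comp_Z (i : Fin n) (f : Fin n → Series n) : comp (Z i) f = f i := by
  rw [← mono_singleton, comp_mono, sWord_singleton]

theorem comp_sum_poly {ι : Type*} (t : Finset ι) (c : ι → ℂ) (F : ι → Series n)
    (hF : ∀ i ∈ t, IsPoly (F i)) (f : Fin n → Series n) :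
    comp (∑ i ∈ t, c i • F i) f = ∑ i ∈ t, c i • comp (F i) f := by
  classical
  let s : Finset (Word n) := t.attach.biUnion fun i => (hF i i.2).supp
  have hs : ∀ i ∈ t, Function.support (F i) ⊆ s := by
    intro i hi w hw
    simp only [s, Finset.coe_biUnion, Set.mem_iUnion]
    exact ⟨⟨i, hi⟩, by simp, (hF i hi).subset_supp hw⟩
  have e : ∀ i ∈ t, c i • comp (F i) f = c i • ∑ w ∈ s, F i w • sWord f w :=
    fun i hi => by rw [comp_eq_sum (hs i hi)]
  rw [comp_eq_sum (s := s), Finset.sum_congr rfl e]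
  · simp only [Finset.sum_apply, Pi.smul_apply, Finset.sum_smul, Finset.smul_sum, smul_smul,
      smul_eq_mul]
    rw [Finset.sum_comm]
  · intro w hw
    by_contra h
    refine hw ?_
    simp only [Finset.sum_apply, Pi.smul_apply]
    refine Finset.sum_eq_zero fun i hi => ?_
    have : F i w = 0 := by
      by_contra h'
      exact h (hs i hi h')
    simp [this]

theorem comp_sMul_poly {a b : Series n} (ha : IsPoly a) (hb : IsPoly b) (f : Fin n → Series n) :
    comp (sMul a b) f = sMul (comp a f) (comp b f) := by
  have e : sMul a b = ∑ u ∈ ha.supp, a u • ∑ v ∈ hb.supp, b v • mono (u ++ v) := by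
    conv_lhs => rw [ha.eq_sum, hb.eq_sum, ← sMulₗ_apply]
    simp only [map_sum, LinearMap.sum_apply, map_smul, LinearMap.smul_apply, sMulₗ_apply,
      mono_sMul_mono]
    simp only [Finset.smul_sum, smul_smul, mul_comm]
    rw [Finset.sum_comm]
  rw [e, comp_sum_poly _ _ _ fun u _ => isPoly_sum _ _ fun v _ => (isPoly_mono _).smul _,
    comp_eq_sum ha.subset_supp, comp_eq_sum hb.subset_supp,
    ← sMulₗ_apply]
  simp only [map_sum, LinearMap.sum_apply, map_smul, LinearMap.smul_apply, sMulₗ_apply]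
  simp only [comp_sum_poly _ _ _ fun v _ => isPoly_mono _, comp_mono, sWord_append, Finset.smul_sum]
  rw [Finset.sum_comm]
  refine Finset.sum_congr rfl fun v _ => Finset.sum_congr rfl fun u _ => ?_
  rw [smul_comm]

theorem comp_sWord_poly {f : Fin n → Series n} (hf : ∀ i, IsPoly (f i)) (q : Fin n → Series n)
    (w : Word n) : comp (sWord f w) q = sWord (fun i => comp (f i) q) w := by
  induction w with
  | nil => simp [sWord, comp_sOne]
  | cons i w ih => rw [sWord, sWord, comp_sMul_poly (hf i) (isPoly_sWord hf w), ih]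

/-- Composition with `q` on the right turns `f_u` into `Z_u`, and so recovers a polynomial `a` from
`a ∘ f`. -/
theorem comp_injective_poly {f q : Fin n → Series n} (hf : ∀ i, IsPoly (f i))
    (hq : ∀ i, comp (f i) q = Z i) {a b : Series n} (ha : IsPoly a) (hb : IsPoly b)
    (h : comp a f = comp b f) : a = b := by
  have key : ∀ a : Series n, IsPoly a → comp (comp a f) q = a := by
    intro a ha
    rw [comp_eq_sum ha.subset_supp f,
      comp_sum_poly _ _ _ fun u _ => isPoly_sWord hf u]
    conv_rhs => rw [ha.eq_sum]
    have : (fun i => comp (f i) q) = Z := funext hq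
    simp [comp_sWord_poly hf, this, sWord_Z]
  rw [← key a ha, h, key b hb]

theorem comp_sub {f : Fin n → Series n} (h0 : ∀ i, f i [] = 0) (a b : Series n) :
    comp (a - b) f = comp a f - comp b f := by
  ext w
  simp only [Pi.sub_apply]
  rw [comp_apply_eq_sum h0 (s := wordsLE n w.length), comp_apply_eq_sum h0 (s := wordsLE n w.length),
    comp_apply_eq_sum h0 (s := wordsLE n w.length), ← Finset.sum_sub_distrib]
  · simp [sub_mul]
  all_goals simp

/-- The part of degree at most `m`. -/
def trunc (m : ℕ) (a : Series n) : Series n := fun w => if w.length ≤ m then a w else 0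

theorem isPoly_trunc (m : ℕ) (a : Series n) : IsPoly (trunc m a) := by
  refine (wordsLE n m).finite_toSet.subset fun w hw => ?_
  by_contra h
  simp_all [trunc]

theorem comp_congr {f : Fin n → Series n} (h0 : ∀ i, f i [] = 0) {a b : Series n} {w : Word n}
    (h : ∀ u : Word n, u.length ≤ w.length → a u = b u) : comp a f w = comp b f w := by
  rw [comp_apply_eq_sum h0 (s := wordsLE n w.length) _ (by simp),
    comp_apply_eq_sum h0 (s := wordsLE n w.length) _ (by simp)]
  exact Finset.sum_congr rfl fun u hu => by rw [h u (by simpa using hu)]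

theorem sMul_congr {a b a' b' : Series n} {w : Word n}
    (ha : ∀ u : Word n, u.length ≤ w.length → a u = a' u)
    (hb : ∀ u : Word n, u.length ≤ w.length → b u = b' u) : sMul a b w = sMul a' b' w := by
  refine Finset.sum_congr rfl fun k _ => ?_
  rw [ha _ (by simp), hb _ (by simp)]

/-- The coefficient at `w` depends only on the parts of `a` and `b` of degree at most `|w|`, so
truncation reduces the identity to polynomials. -/
theorem comp_sMul {f : Fin n → Series n} (h0 : ∀ i, f i [] = 0) (a b : Series n) :
    comp (sMul a b) f = sMul (comp a f) (comp b f) := by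
  ext w
  have ht : ∀ (c : Series n) (u : Word n), u.length ≤ w.length → c u = trunc w.length c u := by
    intro c u hu; simp [trunc, hu]
  rw [comp_congr h0 (b := sMul (trunc w.length a) (trunc w.length b)),
    comp_sMul_poly (isPoly_trunc _ _) (isPoly_trunc _ _)]
  · refine sMul_congr ?_ ?_ <;> intro u hu <;> refine comp_congr h0 fun v hv => (ht _ v ?_).symm <;>
      omega
  · intro u hu
    exact sMul_congr (fun v hv => ht _ v (by omega)) (fun v hv => ht _ v (by omega))

theorem sWord_leading {f : Fin n → Series n} (h0 : ∀ i, f i [] = 0) (i j : Fin n) (u w : Word n)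
    (h : w.length ≤ u.length) : sWord f (i :: u) (j :: w) = f i [j] * sWord f u w := by
  rw [sWord, sMul_cons, h0, zero_mul, zero_add, sMul_of_vanish]
  exact fun v hv => sWord_vanish h0 u v (by omega)

/-- On words of length `k`, the coefficients of the `f_u` form the `k`-th tensor power of the
Jacobian matrix. Its invertibility is proved by peeling off one letter at a time. -/
theorem eq_zero_of_leading {f : Fin n → Series n} (h0 : ∀ i, f i [] = 0)
    (hJ : (jacobian f).det ≠ 0) (k : ℕ) (a : Series n)
    (h : ∀ w ∈ words n k, ∑ u ∈ words n k, a u * sWord f u w = 0) :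
    ∀ u ∈ words n k, a u = 0 := by
  induction k generalizing a with
  | zero => simpa [words_zero, sWord] using h
  | succ k ih =>
    have key : ∀ i, ∀ w ∈ words n k, ∑ u ∈ words n k, a (i :: u) * sWord f u w = 0 := by
      intro i w hw
      -- For fixed `w`, the equations at the words `j :: w` say that `x` is a row vector annihilated
      -- by the Jacobian matrix.
      let x : Fin n → ℂ := fun i => ∑ u ∈ words n k, a (i :: u) * sWord f u w
      have hx : Matrix.vecMul x (jacobian f) = 0 := by
        ext j
        have := h (j :: w) (by simpa using hw)
        rw [sum_words_succ] at this
        rw [Matrix.vecMul, dotProduct, Pi.zero_apply, ← this]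
        refine Finset.sum_congr rfl fun i _ => ?_
        rw [Finset.sum_mul]
        refine Finset.sum_congr rfl fun u hu => ?_
        rw [sWord_leading h0 _ _ _ _ (by simp_all)]
        simp only [jacobian, Matrix.of_apply]
        ring
      exact congrFun (Matrix.eq_zero_of_vecMul_eq_zero hJ hx) i
    intro u hu
    cases u with
    | nil => simp at hu
    | cons i u => exact ih (fun u => a (i :: u)) (key i) u (by simpa using hu)

/-- Once the difference vanishes below degree `k`, only the leading parts of the `f_u` with `|u| =
k` enter the degree `k` coefficients of its composite, so the degree `k` part vanishes as well. -/
theorem comp_injective {f : Fin n → Series n} (h0 : ∀ i, f i [] = 0) (hJ : (jacobian f).det ≠ 0)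
    {a b : Series n} (h : comp a f = comp b f) : a = b := by
  rw [← sub_eq_zero]
  have hc : comp (a - b) f = 0 := by rw [comp_sub h0, h, sub_self]
  generalize a - b = c at hc
  have key : ∀ k, ∀ u ∈ words n k, c u = 0 := by
    intro k
    induction k using Nat.strong_induction_on with
    | _ k ih =>
      refine eq_zero_of_leading h0 hJ k c fun w hw => ?_
      have := congrFun hc w
      rw [comp_apply_eq_sum h0 (s := wordsLE n k) _ (by simp_all)] at this
      rw [← Pi.zero_apply (M := fun _ => ℂ) w, ← this]
      refine Finset.sum_subset (fun u hu => by simp_all) fun u hu hu' => ?_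
      rw [ih u.length _ u (by simp), zero_mul]
      simp only [mem_wordsLE, mem_words] at hu hu'
      omega
  ext u
  exact key u.length u (by simp)

/-! ### Homogeneous parts and convergence -/

section Hom

variable {E F : Type*} [NormedAddCommGroup E] [InnerProductSpace ℂ E]
  [NormedAddCommGroup F] [InnerProductSpace ℂ F]

/-- The value at `X` of the homogeneous part of degree `k`. -/
def hom (a : Series n) (k : ℕ) (X : Fin n → E →L[ℂ] E) : E →L[ℂ] E :=
  ∑ w ∈ words n k, a w • opWord X w

theorem partialSum_eq (a : Series n) (X : Fin n → E →L[ℂ] E) (m : ℕ) :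
    partialSum a X m = ∑ k ∈ Finset.range m, hom a k X := by
  refine Finset.sum_congr rfl fun k _ => ?_
  exact sum_ofFn k fun w => a w • opWord X w

@[simp] theorem opWord_nil (X : Fin n → E →L[ℂ] E) : opWord X [] = 1 := rfl

theorem opWord_cons (X : Fin n → E →L[ℂ] E) (i : Fin n) (w : Word n) :
    opWord X (i :: w) = X i * opWord X w := by simp [opWord]

theorem opWord_append (X : Fin n → E →L[ℂ] E) (u v : Word n) :
    opWord X (u ++ v) = opWord X u * opWord X v := by simp [opWord]

theorem opWord_smul (z : ℂ) (X : Fin n → E →L[ℂ] E) (w : Word n) :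
    opWord (fun i => z • X i) w = z ^ w.length • opWord X w := by
  induction w with
  | nil => simp
  | cons i w ih =>
    rw [opWord_cons, ih, opWord_cons, smul_mul_smul_comm, List.length_cons, pow_succ']

theorem hom_smul (z : ℂ) (a : Series n) (k : ℕ) (X : Fin n → E →L[ℂ] E) :
    hom a k (fun i => z • X i) = z ^ k • hom a k X := by
  rw [hom, hom, Finset.smul_sum]
  refine Finset.sum_congr rfl fun w hw => ?_
  rw [opWord_smul, mem_words.1 hw, smul_comm]

theorem hom_opScale (r : ℝ) (a : Series n) (k : ℕ) (X : Fin n → E →L[ℂ] E) :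
    hom a k (opScale r X) = (r : ℂ) ^ k • hom a k X := hom_smul _ _ _ _

theorem hom_congr_smul {a b : Series n} {z : ℂ} {k : ℕ} (h : ∀ w, w.length = k → b w = z * a w)
    (X : Fin n → E →L[ℂ] E) : hom b k X = z • hom a k X := by
  rw [hom, hom, Finset.smul_sum]
  refine Finset.sum_congr rfl fun w hw => ?_
  rw [h w (mem_words.1 hw), mul_smul]

theorem hom_sMul (a b : Series n) (m : ℕ) (X : Fin n → E →L[ℂ] E) :
    hom (sMul a b) m X = ∑ k ∈ Finset.range (m + 1), hom a k X * hom b (m - k) X := by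
  have h1 : hom (sMul a b) m X = ∑ w ∈ words n m, ∑ k ∈ Finset.range (m + 1),
      (a (w.take k) • opWord X (w.take k)) * (b (w.drop k) • opWord X (w.drop k)) := by
    refine Finset.sum_congr rfl fun w hw => ?_
    rw [sMul, Finset.sum_smul, mem_words.1 hw]
    refine Finset.sum_congr rfl fun k _ => ?_
    rw [smul_mul_smul_comm, ← opWord_append, List.take_append_drop]
  rw [h1, Finset.sum_comm]
  refine Finset.sum_congr rfl fun k hk => ?_
  obtain ⟨l, rfl⟩ := Nat.exists_eq_add_of_le (Nat.lt_succ_iff.1 (Finset.mem_range.1 hk))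
  rw [sum_words_add k l fun u v => (a u • opWord X u) * (b v • opWord X v), Nat.add_sub_cancel_left,
    hom, hom, Finset.sum_mul_sum]

theorem NormSum.sub {a b : Series n} {X : Fin n → E →L[ℂ] E} {A B : E →L[ℂ] E}
    (ha : NormSum a X A) (hb : NormSum b X B) : NormSum (a - b) X (A - B) := by
  refine (Tendsto.sub ha hb).congr fun m => ?_
  simp [partialSum, sub_smul, Finset.sum_sub_distrib]

theorem NormSum.smul {a : Series n} {X : Fin n → E →L[ℂ] E} {A : E →L[ℂ] E} (z : ℂ)
    (ha : NormSum a X A) : NormSum (z • a) X (z • A) := by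
  refine (Tendsto.const_smul ha z).congr fun m => ?_
  simp [partialSum, Finset.smul_sum, smul_smul]

theorem NormSum.unique {a : Series n} {X : Fin n → E →L[ℂ] E} {A B : E →L[ℂ] E}
    (hA : NormSum a X A) (hB : NormSum a X B) : A = B := tendsto_nhds_unique hA hB

theorem NormSum.sotSum {a : Series n} {X : Fin n → E →L[ℂ] E} {A : E →L[ℂ] E}
    (h : NormSum a X A) : SOTSum a X A := fun x =>
  ((ContinuousLinearMap.apply ℂ E x).continuous.tendsto A).comp h

theorem RadNormSum.radSOTSum {a : Series n} {X : Fin n → E →L[ℂ] E} {A : E →L[ℂ] E}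
    (h : RadNormSum a X A) : RadSOTSum a X A := by
  obtain ⟨δ, hδ, F, hF, hl⟩ := h
  exact ⟨δ, hδ, F, hF, fun x => ((ContinuousLinearMap.apply ℂ E x).continuous.tendsto A).comp hl⟩

theorem normSum_of_summable [CompleteSpace E] {a : Series n} {X : Fin n → E →L[ℂ] E}
    (h : Summable fun k => ‖hom a k X‖) : NormSum a X (∑' k, hom a k X) := by
  rw [NormSum]
  simp only [funext (partialSum_eq a X)]
  exact h.of_norm.hasSum.tendsto_sum_nat

theorem NormSum.mul [CompleteSpace E] {a b : Series n} {X : Fin n → E →L[ℂ] E} {A B : E →L[ℂ] E}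
    (ha : Summable fun k => ‖hom a k X‖) (hb : Summable fun k => ‖hom b k X‖)
    (hA : NormSum a X A) (hB : NormSum b X B) : NormSum (sMul a b) X (A * B) := by
  rw [hA.unique (normSum_of_summable ha), hB.unique (normSum_of_summable hb), NormSum]
  simp only [funext (partialSum_eq (sMul a b) X), hom_sMul]
  exact (hasSum_sum_range_mul_of_summable_norm ha hb).tendsto_sum_nat

/-- The value at `X` of a polynomial. -/
theorem normSum_of_support {a : Series n} {s : Finset (Word n)} (h : Function.support a ⊆ s)
    (X : Fin n → E →L[ℂ] E) : NormSum a X (∑ w ∈ s, a w • opWord X w) := by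
  refine tendsto_atTop_of_eventually_const (i₀ := s.sup List.length + 1) fun m hm => ?_
  rw [partialSum_eq]
  simp only [hom]
  rw [← Finset.sum_biUnion]
  · refine (Finset.sum_subset (fun w hw => ?_) fun w _ hw => ?_).symm
    · have := Finset.le_sup (f := List.length) hw
      exact Finset.mem_biUnion.2 ⟨w.length, Finset.mem_range.2 (by omega), mem_words.2 rfl⟩
    · have : a w = 0 := by
        by_contra h'
        exact hw (h h')
      simp [this]
  · intro k _ l _ hkl
    refine Finset.disjoint_left.2 fun w hw hw' => hkl ?_
    rw [← mem_words.1 hw, ← mem_words.1 hw']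

theorem summable_of_support {a : Series n} {s : Finset (Word n)} (h : Function.support a ⊆ s)
    (X : Fin n → E →L[ℂ] E) : Summable fun k => ‖hom a k X‖ := by
  refine summable_of_hasFiniteSupport ((Finset.range (s.sup List.length + 1)).finite_toSet.subset ?_)
  intro k hk
  by_contra hk'
  refine hk ?_
  simp only [norm_eq_zero]
  refine Finset.sum_eq_zero fun w hw => ?_
  have : a w = 0 := by
    by_contra h'
    have := Finset.le_sup (f := List.length) (h h')
    rw [mem_words] at hw
    simp at hk'
    omega
  simp [this]

theorem normSum_sWord [CompleteSpace E] {f : Fin n → Series n} (hf : ∀ i, IsPoly (f i))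
    {X Y : Fin n → E →L[ℂ] E} (hY : ∀ i, NormSum (f i) X (Y i)) (w : Word n) :
    NormSum (sWord f w) X (opWord Y w) := by
  induction w with
  | nil =>
    have h : Function.support (sOne n) ⊆ ({[]} : Finset (Word n)) := by
      intro w hw
      by_contra h
      simp_all [sOne]
    simpa [sWord] using normSum_of_support h X
  | cons i w ih =>
    rw [sWord, opWord_cons]
    exact NormSum.mul (summable_of_support (hf i).subset_supp X)
      (summable_of_support (isPoly_sWord hf w).subset_supp X) (hY i) ih

/-- Evaluation of a composition of polynomials. -/
theorem normSum_comp [CompleteSpace E] {a : Series n} {f : Fin n → Series n} (ha : IsPoly a)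
    (hf : ∀ i, IsPoly (f i)) {X Y : Fin n → E →L[ℂ] E} {A : E →L[ℂ] E}
    (hY : ∀ i, NormSum (f i) X (Y i)) (hA : NormSum (comp a f) X A) : NormSum a Y A := by
  have h1 := normSum_of_support ha.subset_supp Y
  have h2 : NormSum (comp a f) X (∑ w ∈ ha.supp, a w • opWord Y w) := by
    rw [comp_eq_sum ha.subset_supp]
    refine (tendsto_finsetSum ha.supp fun w _ =>
      (normSum_sWord hf hY w).smul (a w)).congr fun m => ?_
    simp only [partialSum, Finset.sum_apply, Finset.sum_smul]
    rw [Finset.sum_comm]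
    refine Finset.sum_congr rfl fun k _ => ?_
    rw [Finset.sum_comm]
  rwa [hA.unique h2]

theorem normSum_Z (i : Fin n) (X : Fin n → E →L[ℂ] E) : NormSum (Z i) X (X i) := by
  have h : Function.support (Z i : Series n) ⊆ ({[i]} : Finset (Word n)) := by
    intro w hw
    by_contra h
    simp_all [Z]
  simpa [Z, opWord] using normSum_of_support h X

theorem summable_Z (i : Fin n) (X : Fin n → E →L[ℂ] E) :
    Summable fun k => ‖hom (Z i) k X‖ := summable_of_support (isPoly_Z i).subset_supp X

theorem normSum_one (X : Fin n → E →L[ℂ] E) : NormSum (sOne n) X 1 := by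
  have h : Function.support (sOne n) ⊆ ({[]} : Finset (Word n)) := by
    intro w hw
    by_contra h
    simp_all [sOne]
  simpa using normSum_of_support h X

/-! ### Ordinary and radial sums -/

/-- The series `∑ s_k` has the sum `l`, in the ordinary or in the radial (Abel) sense. -/
def VSum (s : ℕ → E) (l : E) : Prop :=
  Tendsto (fun m => ∑ k ∈ Finset.range m, s k) atTop (𝓝 l) ∨
  ∃ δ ∈ Set.Ioo (0 : ℝ) 1, ∃ φ : ℝ → E,
    (∀ r ∈ Set.Ioo δ 1,
      Tendsto (fun m => ∑ k ∈ Finset.range m, (r : ℂ) ^ k • s k) atTop (𝓝 (φ r))) ∧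
    Tendsto φ (𝓝[<] 1) (𝓝 l)

theorem VSum.map {s : ℕ → E} {l : E} (h : VSum s l) (R : E →L[ℂ] F) :
    VSum (fun k => R (s k)) (R l) := by
  rcases h with h | ⟨δ, hδ, φ, h1, h2⟩
  · left
    simpa [Function.comp_def] using (R.continuous.tendsto _).comp h
  · right
    refine ⟨δ, hδ, fun r => R (φ r), fun r hr => ?_, (R.continuous.tendsto _).comp h2⟩
    simpa [Function.comp_def] using (R.continuous.tendsto _).comp (h1 r hr)

theorem Ioo_mem_nhdsLT_one {δ : ℝ} (hδ : δ ∈ Set.Ioo (0 : ℝ) 1) : Set.Ioo δ 1 ∈ 𝓝[<] (1 : ℝ) :=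
  Ioo_mem_nhdsLT hδ.2

/-- This is Abel's limit theorem. The terms of a convergent series are bounded, so the power series
converges absolutely for `r < 1`, and the unconditional sum in Abel's theorem agrees with `φ r`. -/
theorem abel_unique {s : ℕ → ℂ} {l l' : ℂ}
    (h : Tendsto (fun m => ∑ k ∈ Finset.range m, s k) atTop (𝓝 l)) {δ : ℝ}
    (hδ : δ ∈ Set.Ioo (0 : ℝ) 1) {φ : ℝ → ℂ}
    (h1 : ∀ r ∈ Set.Ioo δ 1,
      Tendsto (fun m => ∑ k ∈ Finset.range m, (r : ℂ) ^ k * s k) atTop (𝓝 (φ r)))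
    (h2 : Tendsto φ (𝓝[<] 1) (𝓝 l')) : l = l' := by
  have habel := Complex.tendsto_tsum_powerSeries_nhdsWithin_lt h
  rw [tendsto_map'_iff] at habel
  refine tendsto_nhds_unique (habel.congr' ?_) h2
  filter_upwards [Ioo_mem_nhdsLT_one hδ] with r hr
  have hb : ∃ C, ∀ k, ‖s k‖ ≤ C := by
    have h0 : Tendsto s atTop (𝓝 (l - l)) := by
      have := ((tendsto_add_atTop_iff_nat 1).2 h).sub h
      simpa [Finset.sum_range_succ] using this
    obtain ⟨C, hC⟩ := h0.norm.bddAbove_range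
    exact ⟨C, fun k => hC (Set.mem_range_self k)⟩
  obtain ⟨C, hC⟩ := hb
  have hr0 : 0 < r := hδ.1.trans hr.1
  have hs : Summable fun k => s k * (r : ℂ) ^ k := by
    refine Summable.of_norm_bounded (g := fun k => C * r ^ k)
      ((summable_geometric_of_lt_one hr0.le hr.2).mul_left C) fun k => ?_
    rw [norm_mul, norm_pow, Complex.norm_real, Real.norm_of_nonneg hr0.le]
    exact mul_le_mul_of_nonneg_right (hC k) (by positivity)
  refine tendsto_nhds_unique hs.hasSum.tendsto_sum_nat ?_
  simpa [mul_comm] using h1 r hr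

/-- Pairing with a vector reduces the mixed case to scalar series and Abel's theorem. Two radial
sums agree because their values coincide for all `r` close to `1`. -/
theorem VSum.unique {s : ℕ → E} {l l' : E} (h : VSum s l) (h' : VSum s l') : l = l' := by
  have key : ∀ {l l' : E}, Tendsto (fun m => ∑ k ∈ Finset.range m, s k) atTop (𝓝 l) →
      (∃ δ ∈ Set.Ioo (0 : ℝ) 1, ∃ φ : ℝ → E,
        (∀ r ∈ Set.Ioo δ 1,
          Tendsto (fun m => ∑ k ∈ Finset.range m, (r : ℂ) ^ k • s k) atTop (𝓝 (φ r))) ∧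
        Tendsto φ (𝓝[<] 1) (𝓝 l')) → l = l' := by
    rintro l l' h ⟨δ, hδ, φ, h1, h2⟩
    refine ext_inner_left ℂ fun v => ?_
    have hv : ∀ {ι : Type} {p : Filter ι} {u : ι → E} {x : E}, Tendsto u p (𝓝 x) →
        Tendsto (fun i => inner ℂ v (u i)) p (𝓝 (inner ℂ v x)) := fun hu =>
      ((innerSL ℂ v).continuous.tendsto _).comp hu
    refine abel_unique (s := fun k => inner ℂ v (s k)) ?_ hδ (φ := fun r => inner ℂ v (φ r)) ?_
      (hv h2)
    · simpa [inner_sum] using hv h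
    · intro r hr
      simpa [inner_sum, inner_smul_right] using hv (h1 r hr)
  rcases h with h | h <;> rcases h' with h' | h'
  · exact tendsto_nhds_unique h h'
  · exact key h h'
  · exact (key h' h).symm
  · obtain ⟨δ, hδ, φ, h1, h2⟩ := h
    obtain ⟨δ', hδ', φ', h1', h2'⟩ := h'
    refine tendsto_nhds_unique (h2.congr' ?_) h2'
    filter_upwards [Ioo_mem_nhdsLT_one hδ, Ioo_mem_nhdsLT_one hδ'] with r hr hr'
    exact tendsto_nhds_unique (h1 r hr) (h1' r hr')

theorem Eval.vSum {f : Fin n → Series n} {X Y : Fin n → E →L[ℂ] E} (h : Eval f X Y) (i : Fin n)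
    (x : E) : VSum (fun k => hom (f i) k X x) (Y i x) := by
  rcases h with h | h
  · left
    simpa [partialSum_eq] using h i x
  · right
    obtain ⟨δ, hδ, F, h1, h2⟩ := h i
    refine ⟨δ, hδ, fun r => F r x, fun r hr => ?_, h2 x⟩
    simpa [partialSum_eq, hom_opScale] using (h1 r hr).sotSum x

theorem opWord_intertwine {A : Fin n → E →L[ℂ] E} {B : Fin n → F →L[ℂ] F} {R : E →L[ℂ] F}
    (h : ∀ i x, R (A i x) = B i (R x)) (w : Word n) (x : E) :
    R (opWord A w x) = opWord B w (R x) := by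
  induction w with
  | nil => rfl
  | cons i w ih => simp [opWord_cons, h, ih]

theorem hom_intertwine {A : Fin n → E →L[ℂ] E} {B : Fin n → F →L[ℂ] F} {R : E →L[ℂ] F}
    (h : ∀ i x, R (A i x) = B i (R x)) (a : Series n) (k : ℕ) (x : E) :
    R (hom a k A x) = hom a k B (R x) := by
  simp [hom, opWord_intertwine h]

/-- `R` intertwines each homogeneous part, so both vectors are sums of one series in `F`; the two
evaluations may be of different kinds. It is applied with `R` an identity, the adjoint of an
inclusion, and a unitary. -/
theorem Eval.intertwine {f : Fin n → Series n} {A A' : Fin n → E →L[ℂ] E}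
    {B B' : Fin n → F →L[ℂ] F} {R : E →L[ℂ] F} (h : ∀ i x, R (A i x) = B i (R x))
    (hA : Eval f A A') (hB : Eval f B B') (i : Fin n) (x : E) : R (A' i x) = B' i (R x) := by
  refine VSum.unique ((hA.vSum i x).map R) ?_
  simp only [hom_intertwine h]
  exact hB.vSum i (R x)

theorem Eval.unique {f : Fin n → Series n} {A B B' : Fin n → E →L[ℂ] E} (hB : Eval f A B)
    (hB' : Eval f A B') : B = B' := by
  ext i x
  have h := Eval.intertwine (A := A) (B := A) (R := ContinuousLinearMap.id ℂ E) (by simp) hB hB' i x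
  simpa using h

/-- The tuple `f` converges at `X`, in norm or radially in norm, to `Y`. -/
def NormEval (f : Fin n → Series n) (X Y : Fin n → E →L[ℂ] E) : Prop :=
  (∀ i, NormSum (f i) X (Y i)) ∨ (∀ i, RadNormSum (f i) X (Y i))

theorem NormEval.eval {f : Fin n → Series n} {X Y : Fin n → E →L[ℂ] E} (h : NormEval f X Y) :
    Eval f X Y := h.imp (fun h i => (h i).sotSum) (fun h i => (h i).radSOTSum)

theorem opWord_mem {𝒞 : Subalgebra ℂ (E →L[ℂ] E)} {X : Fin n → E →L[ℂ] E} (h : ∀ i, X i ∈ 𝒞)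
    (w : Word n) : opWord X w ∈ 𝒞 := by
  induction w with
  | nil => exact one_mem 𝒞
  | cons i w ih => rw [opWord_cons]; exact mul_mem (h i) ih

theorem partialSum_mem {𝒞 : Subalgebra ℂ (E →L[ℂ] E)} {X : Fin n → E →L[ℂ] E} (h : ∀ i, X i ∈ 𝒞)
    (a : Series n) (m : ℕ) : partialSum a X m ∈ 𝒞 :=
  sum_mem fun _ _ => sum_mem fun _ _ => 𝒞.smul_mem (opWord_mem h _) _

theorem NormSum.mem {𝒞 : Subalgebra ℂ (E →L[ℂ] E)} (hc : IsClosed (𝒞 : Set (E →L[ℂ] E)))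
    {X : Fin n → E →L[ℂ] E} (h : ∀ i, X i ∈ 𝒞) {a : Series n} {A : E →L[ℂ] E}
    (hA : NormSum a X A) : A ∈ 𝒞 :=
  hc.mem_of_tendsto hA (.of_forall (partialSum_mem h a))

theorem NormEval.mem {𝒞 : Subalgebra ℂ (E →L[ℂ] E)} (hc : IsClosed (𝒞 : Set (E →L[ℂ] E)))
    {X : Fin n → E →L[ℂ] E} (h : ∀ i, X i ∈ 𝒞) {f : Fin n → Series n} {Y : Fin n → E →L[ℂ] E}
    (hY : NormEval f X Y) (i : Fin n) : Y i ∈ 𝒞 := by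
  rcases hY with hY | hY
  · exact (hY i).mem hc h
  · obtain ⟨δ, hδ, F, h1, h2⟩ := hY i
    refine hc.mem_of_tendsto h2 ?_
    filter_upwards [Ioo_mem_nhdsLT_one hδ] with r hr
    exact (h1 r hr).mem hc fun i => 𝒞.smul_mem (h i) _

end Hom

/-! ### Estimates for row contractions -/

section Row

variable {E : Type*} [NormedAddCommGroup E] [InnerProductSpace ℂ E] [CompleteSpace E]

theorem rowNorm_nonneg (X : Fin n → E →L[ℂ] E) : 0 ≤ rowNorm X := Real.sqrt_nonneg _

theorem sum_norm_adjoint_sq (X : Fin n → E →L[ℂ] E) (y : E) :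
    ((∑ i, ‖ContinuousLinearMap.adjoint (X i) y‖ ^ 2 : ℝ) : ℂ) =
      inner ℂ ((∑ i, X i * ContinuousLinearMap.adjoint (X i)) y) y := by
  simp only [sum_apply, sum_inner, mul_apply_eq_comp]
  push_cast
  refine Finset.sum_congr rfl fun i _ => ?_
  rw [← ContinuousLinearMap.adjoint_inner_right, inner_self_eq_norm_sq_to_K]
  rfl

theorem sum_norm_adjoint_sq_le (X : Fin n → E →L[ℂ] E) (y : E) :
    ∑ i, ‖ContinuousLinearMap.adjoint (X i) y‖ ^ 2 ≤ rowNorm X ^ 2 * ‖y‖ ^ 2 := by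
  have h := congrArg (‖·‖) (sum_norm_adjoint_sq X y)
  simp only [Complex.norm_real] at h
  rw [Real.norm_of_nonneg (by positivity)] at h
  rw [h, rowNorm, Real.sq_sqrt (norm_nonneg _)]
  refine (norm_inner_le_norm _ _).trans ?_
  rw [pow_two, ← mul_assoc]
  exact mul_le_mul_of_nonneg_right (ContinuousLinearMap.le_opNorm _ _) (norm_nonneg _)

theorem sum_norm_adjoint_opWord_sq_le (X : Fin n → E →L[ℂ] E) (k : ℕ) (y : E) :
    ∑ w ∈ words n k, ‖ContinuousLinearMap.adjoint (opWord X w) y‖ ^ 2 ≤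
      (rowNorm X ^ k) ^ 2 * ‖y‖ ^ 2 := by
  induction k generalizing y with
  | zero => simp [words_zero, ← ContinuousLinearMap.star_eq_adjoint]
  | succ k ih =>
    rw [sum_words_succ]
    calc ∑ i, ∑ w ∈ words n k, ‖ContinuousLinearMap.adjoint (opWord X (i :: w)) y‖ ^ 2
        ≤ ∑ i, (rowNorm X ^ k) ^ 2 * ‖ContinuousLinearMap.adjoint (X i) y‖ ^ 2 := by
          refine Finset.sum_le_sum fun i _ => ?_
          refine le_trans (le_of_eq ?_) (ih _)
          simp [opWord_cons, ← ContinuousLinearMap.star_eq_adjoint]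
      _ ≤ (rowNorm X ^ k) ^ 2 * (rowNorm X ^ 2 * ‖y‖ ^ 2) := by
          rw [← Finset.mul_sum]
          exact mul_le_mul_of_nonneg_left (sum_norm_adjoint_sq_le X y) (by positivity)
      _ = _ := by ring

/-- The `ℓ²` norm of the coefficients of degree `k`. -/
def slice (a : Series n) (k : ℕ) : ℝ := Real.sqrt (∑ w ∈ words n k, ‖a w‖ ^ 2)

theorem slice_nonneg (a : Series n) (k : ℕ) : 0 ≤ slice a k := Real.sqrt_nonneg _

/-- Moving the words to the other side as `X_w^*` and applying Cauchy–Schwarz over `w` uses the row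
norm of the tuple of words of length `k`, which is at most `rowNorm X ^ k`. No factor counting the
words appears, so the estimate is effective up to the unit ball. -/
theorem norm_hom_le (a : Series n) (k : ℕ) (X : Fin n → E →L[ℂ] E) :
    ‖hom a k X‖ ≤ slice a k * rowNorm X ^ k := by
  have hC : 0 ≤ slice a k * rowNorm X ^ k :=
    mul_nonneg (slice_nonneg a k) (pow_nonneg (rowNorm_nonneg X) k)
  refine ContinuousLinearMap.opNorm_le_bound _ hC fun x => ?_
  set y := hom a k X x with hy
  have h1 : ‖y‖ ^ 2 ≤ slice a k * rowNorm X ^ k * ‖x‖ * ‖y‖ := by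
    calc ‖y‖ ^ 2 = ‖inner ℂ y y‖ := by rw [inner_self_eq_norm_sq_to_K]; simp
      _ = ‖∑ w ∈ words n k, a w *
            inner ℂ (ContinuousLinearMap.adjoint (opWord X w) y) x‖ := by
          have e : ∀ v, inner ℂ v y = ∑ w ∈ words n k, a w *
              inner ℂ (ContinuousLinearMap.adjoint (opWord X w) v) x := fun v => by
            simp only [hy, hom, sum_apply, inner_sum, smul_apply, inner_smul_right,
              ContinuousLinearMap.adjoint_inner_left]
          rw [e y]
      _ ≤ ∑ w ∈ words n k, ‖a w‖ * ‖ContinuousLinearMap.adjoint (opWord X w) y‖ * ‖x‖ := by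
          refine (norm_sum_le _ _).trans (Finset.sum_le_sum fun w _ => ?_)
          rw [norm_mul, mul_assoc]
          exact mul_le_mul_of_nonneg_left (norm_inner_le_norm _ _) (norm_nonneg _)
      _ ≤ slice a k * (rowNorm X ^ k * ‖y‖) * ‖x‖ := by
          rw [← Finset.sum_mul]
          refine mul_le_mul_of_nonneg_right ?_ (norm_nonneg _)
          refine (Real.sum_mul_le_sqrt_mul_sqrt _ _ _).trans ?_
          refine mul_le_mul_of_nonneg_left ?_ (slice_nonneg a k)
          refine (Real.sqrt_le_sqrt (sum_norm_adjoint_opWord_sq_le X k y)).trans ?_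
          rw [← mul_pow, Real.sqrt_sq]
          exact mul_nonneg (pow_nonneg (rowNorm_nonneg X) k) (norm_nonneg _)
      _ = _ := by ring
  by_cases h0 : ‖y‖ = 0
  · rw [h0]; positivity
  · have : 0 < ‖y‖ := lt_of_le_of_ne (norm_nonneg _) (Ne.symm h0)
    nlinarith

theorem summable_hom {a : Series n} {ρ : ℝ} (h : Summable fun k => slice a k * ρ ^ k)
    {X : Fin n → E →L[ℂ] E} (hX : rowNorm X ≤ ρ) : Summable fun k => ‖hom a k X‖ := by
  refine Summable.of_nonneg_of_le (fun k => norm_nonneg _) (fun k => ?_) h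
  refine (norm_hom_le a k X).trans (mul_le_mul_of_nonneg_left ?_ (slice_nonneg a k))
  exact pow_le_pow_left₀ (rowNorm_nonneg X) hX k

theorem rowNorm_smul (z : ℂ) (X : Fin n → E →L[ℂ] E) :
    rowNorm (fun i => z • X i) = ‖z‖ * rowNorm X := by
  have : ∑ i, (z • X i) * ContinuousLinearMap.adjoint (z • X i) =
      ((‖z‖ ^ 2 : ℝ) : ℂ) • ∑ i, X i * ContinuousLinearMap.adjoint (X i) := by
    rw [Finset.smul_sum]
    refine Finset.sum_congr rfl fun i _ => ?_
    rw [← ContinuousLinearMap.star_eq_adjoint, star_smul, smul_mul_smul_comm]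
    congr 1
    rw [← starRingEnd_apply, Complex.mul_conj, Complex.normSq_eq_norm_sq]
  rw [rowNorm, this, norm_smul, Complex.norm_real, Real.norm_of_nonneg (by positivity),
    Real.sqrt_mul (by positivity), Real.sqrt_sq (norm_nonneg _), rowNorm]

theorem rowNorm_opScale {r : ℝ} (hr : 0 ≤ r) (X : Fin n → E →L[ℂ] E) :
    rowNorm (opScale r X) = r * rowNorm X := by
  have := rowNorm_smul (r : ℂ) X
  rwa [Complex.norm_real, Real.norm_of_nonneg hr] at this

/-- The operator `∑ W_i W_i^*` is a self-adjoint idempotent, so its norm equals its own square. -/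
theorem rowNorm_le_one_of_isometry {W : Fin n → E →L[ℂ] E}
    (h : ∀ i j, ContinuousLinearMap.adjoint (W i) * W j = if i = j then 1 else 0) :
    rowNorm W ≤ 1 := by
  set P := ∑ i, W i * ContinuousLinearMap.adjoint (W i) with hP
  have hsa : star P = P := by
    simp [hP, ← ContinuousLinearMap.star_eq_adjoint, star_sum]
  have hid : P * P = P := by
    rw [hP, Finset.sum_mul_sum]
    refine Finset.sum_congr rfl fun i _ => ?_
    have : ∀ j, W i * ContinuousLinearMap.adjoint (W i) *
        (W j * ContinuousLinearMap.adjoint (W j)) =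
        if i = j then W i * ContinuousLinearMap.adjoint (W j) else 0 := by
      intro j
      rw [mul_assoc, ← mul_assoc _ (W j), h i j]
      split_ifs <;> simp
    simp [this]
  have hn : ‖P‖ = ‖P‖ * ‖P‖ := by
    conv_lhs => rw [← hid]
    conv_lhs => rw [← hsa]
    rw [hsa]
    nth_rewrite 1 [← hsa]
    exact CStarRing.norm_star_mul_self
  have : ‖P‖ ≤ 1 := by
    by_contra hlt
    push Not at hlt
    nlinarith
  exact Real.sqrt_le_one.2 this

end Row

/-! ### The left creation operators on square summable series -/

theorem memℓp_two_iff {ι : Type*} {G : ι → Type*} [∀ i, NormedAddCommGroup (G i)] {v : ∀ i, G i} :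
    Memℓp v 2 ↔ Summable fun i => ‖v i‖ ^ 2 := by
  rw [memℓp_gen_iff (by norm_num)]
  simp

theorem lp_norm_sq {ι : Type*} {G : ι → Type*} [∀ i, NormedAddCommGroup (G i)] (v : lp G 2) :
    ‖v‖ ^ 2 = ∑' i, ‖v i‖ ^ 2 := by
  have := lp.norm_rpow_eq_tsum (p := 2) (by norm_num) v
  simpa using this

theorem hasSum_lp_norm_sq {ι : Type*} {G : ι → Type*} [∀ i, NormedAddCommGroup (G i)]
    (v : lp G 2) : HasSum (fun i => ‖v i‖ ^ 2) (‖v‖ ^ 2) := by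
  rw [lp_norm_sq]
  exact (memℓp_two_iff.1 v.2).hasSum

section Creation

variable {G : Type*} [NormedAddCommGroup G]

theorem cons_injective (i : Fin n) : Function.Injective (fun w : Word n => i :: w) :=
  fun _ _ h => (List.cons.inj h).2

/-- Prefixing every index by the letter `i`. -/
def consFun (i : Fin n) (ξ : Word n → G) : Word n → G
  | [] => 0
  | j :: w => if i = j then ξ w else 0

theorem hasSum_consFun (i : Fin n) {ξ : Word n → G} {s : ℝ}
    (h : HasSum (fun w => ‖ξ w‖ ^ 2) s) : HasSum (fun w => ‖consFun i ξ w‖ ^ 2) s := by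
  refine ((cons_injective i).hasSum_iff fun w hw => ?_).1 (by
    simpa [Function.comp_def, consFun] using h)
  cases w with
  | nil => simp [consFun]
  | cons j w =>
    have : i ≠ j := by
      rintro rfl
      exact hw ⟨w, rfl⟩
    simp [consFun, this]

variable [InnerProductSpace ℂ G]

/-- The left creation operator on the square summable families of vectors of `G`. -/
def creation (G : Type*) [NormedAddCommGroup G] [InnerProductSpace ℂ G] (i : Fin n) :
    lp (fun _ : Word n => G) 2 →ₗᵢ[ℂ] lp (fun _ : Word n => G) 2 where
  toFun ξ := ⟨consFun i ξ, memℓp_two_iff.2 (hasSum_consFun i (hasSum_lp_norm_sq ξ)).summable⟩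
  map_add' ξ η := by
    ext w
    cases w with
    | nil => exact (add_zero (0 : G)).symm
    | cons j w =>
      change (if i = j then ξ w + η w else 0) = (if i = j then ξ w else 0) + if i = j then η w else 0
      split_ifs <;> simp
  map_smul' c ξ := by
    ext w
    cases w <;> simp [consFun]
  norm_map' ξ := by
    refine (sq_eq_sq₀ (norm_nonneg _) (norm_nonneg _)).1 ?_
    exact (hasSum_lp_norm_sq _).unique (hasSum_consFun i (hasSum_lp_norm_sq ξ))

@[simp] theorem creation_nil (i : Fin n) (ξ : lp (fun _ : Word n => G) 2) :
    creation G i ξ [] = 0 := rfl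

theorem creation_cons (i j : Fin n) (ξ : lp (fun _ : Word n => G) 2) (w : Word n) :
    creation G i ξ (j :: w) = if i = j then ξ w else 0 := rfl

theorem inner_creation (i j : Fin n) (ξ η : lp (fun _ : Word n => G) 2) :
    inner ℂ (creation G i ξ) (creation G j η) = if i = j then inner ℂ ξ η else 0 := by
  split_ifs with h
  · subst h; exact (creation G i).inner_map_map ξ η
  · rw [lp.inner_eq_tsum]
    convert tsum_zero with w
    cases w with
    | nil => simp
    | cons k w =>
      rw [creation_cons, creation_cons]
      split_ifs with h1 h2
      · exact absurd (h1.trans h2.symm) h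
      all_goals simp

variable [CompleteSpace G]

theorem adjoint_creation_apply (i : Fin n) (ξ : lp (fun _ : Word n => G) 2) (w : Word n) :
    ContinuousLinearMap.adjoint (creation G i).toContinuousLinearMap ξ w = ξ (i :: w) := by
  refine ext_inner_left ℂ fun v => ?_
  have e : ∀ (u : Word n) (ζ : lp (fun _ : Word n => G) 2),
      inner ℂ (lp.single 2 u v) ζ = inner ℂ v (ζ u) :=
    fun u ζ => lp.inner_single_left (𝕜 := ℂ) (G := fun _ : Word n => G) u v ζ
  refine ((e w _).symm.trans ?_).trans (e (i :: w) ξ)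
  rw [ContinuousLinearMap.adjoint_inner_right]
  congr 1
  ext u
  cases u with
  | nil => simp
  | cons j u =>
    simp only [LinearIsometry.coe_toContinuousLinearMap, creation_cons, lp.single_apply,
      Pi.single_apply, List.cons.injEq]
    by_cases h : i = j
    · simp [h]
    · simp [h, Ne.symm h]

end Creation

/-- The left creation operators on `H2 n`; these are the multiplications by the indeterminates. -/
def shift (i : Fin n) : H2 n →L[ℂ] H2 n := (creation ℂ i).toContinuousLinearMap

theorem coe_shift (i : Fin n) (ψ : H2 n) : ⇑(shift i ψ) = sMul (Z i) ψ := by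
  ext w
  cases w with
  | nil => rw [Z_sMul_nil]; rfl
  | cons j w => rw [Z_sMul_cons]; rfl

theorem shift_isometry (i j : Fin n) :
    ContinuousLinearMap.adjoint (shift i) * shift j = if i = j then (1 : H2 n →L[ℂ] H2 n) else 0 := by
  ext1 ξ
  refine ext_inner_left ℂ fun η => ?_
  rw [mul_apply_eq_comp, ContinuousLinearMap.adjoint_inner_right]
  refine (inner_creation i j η ξ).trans ?_
  split_ifs <;> simp

theorem rowNorm_shift_le : rowNorm (shift : Fin n → H2 n →L[ℂ] H2 n) ≤ 1 :=
  rowNorm_le_one_of_isometry shift_isometry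

/-- The basis vectors of `H2 n`. -/
def basisVec (w : Word n) : H2 n := lp.single 2 w 1

@[simp] theorem coe_basisVec (w : Word n) : ⇑(basisVec w) = mono w := rfl

theorem isPoly_basisVec (w : Word n) : IsPoly (⇑(basisVec w)) := isPoly_mono w

theorem hasSum_basisVec (ψ : H2 n) : HasSum (fun w => ψ w • basisVec w) ψ := by
  have := lp.hasSum_single (by norm_num : (2 : ℝ≥0∞) ≠ ⊤) ψ
  refine this.congr_fun ?_ |> fun h => h
  intro w
  rw [basisVec, ← lp.single_smul, smul_eq_mul, mul_one]

/-- Square summable polynomials are dense. -/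
theorem eq_of_eq_on_poly {F : Type*} [NormedAddCommGroup F] [NormedSpace ℂ F]
    {A B : H2 n →L[ℂ] F} (h : ∀ ψ : H2 n, IsPoly (⇑ψ) → A ψ = B ψ) : A = B := by
  ext ψ
  have hA := A.hasSum (hasSum_basisVec ψ)
  have hB := B.hasSum (hasSum_basisVec ψ)
  simp only [map_smul, h _ (isPoly_basisVec _)] at hA hB
  exact hA.unique hB

/-! ### Dilated variables, multiplication by series, and free holomorphic functions -/

/-- Dilating the variables by `t`. -/
def dil (t : ℂ) (a : Series n) : Series n := fun w => t ^ w.length * a w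

theorem dil_dil (s t : ℂ) (a : Series n) : dil s (dil t a) = dil (s * t) a := by
  ext w; simp [dil, mul_pow, mul_assoc]

theorem dil_one (a : Series n) : dil 1 a = a := by ext w; simp [dil]

theorem dil_sMul (t : ℂ) (a b : Series n) : dil t (sMul a b) = sMul (dil t a) (dil t b) := by
  ext w
  simp only [dil, sMul, Finset.mul_sum]
  refine Finset.sum_congr rfl fun k hk => ?_
  have : w.length = (w.take k).length + (w.drop k).length := by
    rw [← List.length_append, List.take_append_drop]
  rw [this, pow_add]
  ring

theorem hom_dil {E : Type*} [NormedAddCommGroup E] [InnerProductSpace ℂ E] (t : ℂ) (a : Series n)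
    (k : ℕ) (X : Fin n → E →L[ℂ] E) : hom (dil t a) k X = t ^ k • hom a k X :=
  hom_congr_smul (fun w hw => by rw [dil, hw]) X

theorem hom_dil' {E : Type*} [NormedAddCommGroup E] [InnerProductSpace ℂ E] (t : ℂ) (a : Series n)
    (k : ℕ) (X : Fin n → E →L[ℂ] E) : hom (dil t a) k X = hom a k (fun i => t • X i) := by
  rw [hom_dil, hom_smul]

theorem partialSum_dil {E : Type*} [NormedAddCommGroup E] [InnerProductSpace ℂ E] (t : ℂ)
    (a : Series n) (X : Fin n → E →L[ℂ] E) (m : ℕ) :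
    partialSum (dil t a) X m = partialSum a (fun i => t • X i) m := by
  simp only [partialSum_eq, hom_dil']

theorem normSum_dil {E : Type*} [NormedAddCommGroup E] [InnerProductSpace ℂ E] {t : ℂ}
    {a : Series n} {X : Fin n → E →L[ℂ] E} {A : E →L[ℂ] E} :
    NormSum (dil t a) X A ↔ NormSum a (fun i => t • X i) A := by
  rw [NormSum, NormSum, funext (partialSum_dil t a X)]

theorem opWord_shift (u : Word n) (ψ : H2 n) : ⇑(opWord shift u ψ) = sMul (mono u) ψ := by
  induction u with
  | nil => simp [mono_nil]
  | cons i u ih => rw [opWord_cons, mul_apply_eq_comp, coe_shift, ih, ← sMul_assoc, Z_sMul_mono]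

/-- The omitted terms have degree at least `m` and do not affect coefficients at shorter words,
which are already final. -/
theorem partialSum_shift_apply (a : Series n) (ψ : H2 n) {m : ℕ} {w : Word n} (h : w.length < m) :
    partialSum a shift m ψ w = sMul a ψ w := by
  have h1 : ⇑(partialSum a shift m ψ) =
      sMul (∑ k ∈ Finset.range m, ∑ u ∈ words n k, a u • mono u) ψ := by
    rw [partialSum_eq, ← sMulₗ_apply]
    simp only [hom, sum_apply, smul_apply, map_sum, LinearMap.sum_apply, lp.coeFn_sum, map_smul,
      LinearMap.smul_apply, lp.coeFn_smul, opWord_shift, sMulₗ_apply]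
  rw [h1]
  refine sMul_congr (fun u hu => ?_) (fun _ _ => rfl)
  simp only [Finset.sum_apply, Pi.smul_apply, mono_apply, smul_eq_mul, mul_ite, mul_one, mul_zero,
    Finset.sum_ite_eq, mem_words, Finset.mem_range]
  rw [if_pos (by omega)]

theorem lp_tendsto_apply {ι : Type*} {p : Filter ι} {F : ι → H2 n} {ξ : H2 n}
    (h : Tendsto F p (𝓝 ξ)) (w : Word n) : Tendsto (fun i => F i w) p (𝓝 (ξ w)) := by
  have e : ∀ η : H2 n, η w = inner ℂ (basisVec w) η := by
    intro η
    rw [basisVec, lp.inner_single_left]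
    simp
  simp only [e]
  exact ((innerSL ℂ (basisVec w)).continuous.tendsto _).comp h

/-- A convergent series of creation operators acts as a multiplication. -/
theorem SOTSum.coe_apply {a : Series n} {A : H2 n →L[ℂ] H2 n} (h : SOTSum a shift A) (ψ : H2 n) :
    ⇑(A ψ) = sMul a ψ := by
  ext w
  refine tendsto_nhds_unique (lp_tendsto_apply (h ψ) w) ?_
  refine tendsto_const_nhds.congr' ?_
  filter_upwards [eventually_gt_atTop w.length] with m hm
  rw [partialSum_shift_apply a ψ hm]

theorem slice_dil {t : ℝ} (ht : 0 ≤ t) (a : Series n) (k : ℕ) :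
    slice (dil t a) k = slice a k * t ^ k := by
  have : ∑ w ∈ words n k, ‖dil t a w‖ ^ 2 = (∑ w ∈ words n k, ‖a w‖ ^ 2) * (t ^ k) ^ 2 := by
    rw [Finset.sum_mul]
    refine Finset.sum_congr rfl fun w hw => ?_
    rw [dil, norm_mul, norm_pow, Complex.norm_real, Real.norm_of_nonneg ht, mem_words.1 hw]
    ring
  rw [slice, this, Real.sqrt_mul (by positivity), Real.sqrt_sq (by positivity), slice]

theorem slice_le_norm (ψ : H2 n) (k : ℕ) : slice ψ k ≤ ‖ψ‖ := by
  refine Real.sqrt_le_iff.2 ⟨norm_nonneg _, ?_⟩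
  exact sum_le_hasSum _ (fun _ _ => by positivity) (hasSum_lp_norm_sq ψ)

theorem summable_slice (ψ : H2 n) {ρ : ℝ} (h0 : 0 ≤ ρ) (h1 : ρ < 1) :
    Summable fun k => slice ψ k * ρ ^ k :=
  Summable.of_nonneg_of_le (fun k => mul_nonneg (slice_nonneg _ _) (by positivity))
    (fun k => mul_le_mul_of_nonneg_right (slice_le_norm ψ k) (by positivity))
    ((summable_geometric_of_lt_one h0 h1).mul_left ‖ψ‖)

theorem summable_slice_dil {a : Series n} {ψ : H2 n} {t ρ : ℝ} (ht : 0 < t) (h : ⇑ψ = dil t a)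
    (h0 : 0 ≤ ρ) (h1 : ρ < t) : Summable fun k => slice a k * ρ ^ k := by
  have := summable_slice ψ (ρ := ρ / t) (by positivity) ((div_lt_one ht).2 h1)
  refine this.congr fun k => ?_
  rw [h, slice_dil ht.le, div_pow]
  field_simp

/-- The tuple `t S` lies in the open ball of radius `γ`, and `a(t S)` applied to the vector `1` has
the coefficients `t^|w| a_w`. Convergence at this single point thus controls the growth of all
coefficients. -/
theorem FreeHol.exists_H2 {a : Series n} {γ : ℝ} (h : FreeHol a γ) {t : ℝ} (h0 : 0 < t)
    (ht : t < γ) : ∃ ψ : H2 n, ⇑ψ = dil t a := by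
  obtain ⟨A, hA⟩ := h (opScale t shift) (by
    rw [rowNorm_opScale h0.le]
    exact (mul_le_of_le_one_right h0.le rowNorm_shift_le).trans_lt ht)
  refine ⟨A (basisVec []), ?_⟩
  have := SOTSum.coe_apply (normSum_dil.2 hA).sotSum (basisVec [])
  rwa [coe_basisVec, mono_nil, sMul_one] at this

theorem FreeHol.summable {a : Series n} {γ : ℝ} (h : FreeHol a γ) {ρ : ℝ} (h0 : 0 ≤ ρ)
    (hρ : ρ < γ) : Summable fun k => slice a k * ρ ^ k := by
  obtain ⟨t, h1, h2⟩ := exists_between hρ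
  obtain ⟨ψ, hψ⟩ := h.exists_H2 (h0.trans_lt h1) h2
  exact summable_slice_dil (h0.trans_lt h1) hψ h0 h1

theorem FreeHol.summable_hom {a : Series n} {γ : ℝ} (h : FreeHol a γ) {E : Type*}
    [NormedAddCommGroup E] [InnerProductSpace ℂ E] [CompleteSpace E] {X : Fin n → E →L[ℂ] E}
    (hX : rowNorm X < γ) : Summable fun k => ‖hom a k X‖ :=
  NCDomain.summable_hom (h.summable (rowNorm_nonneg X) hX) le_rfl

theorem freeHol_H2 (ψ : H2 n) : FreeHol ψ 1 := fun X hX =>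
  ⟨_, normSum_of_summable (summable_hom (summable_slice ψ (rowNorm_nonneg X) hX) le_rfl)⟩

theorem freeHol_poly {a : Series n} (h : IsPoly a) (γ : ℝ) : FreeHol a γ := fun X _ =>
  ⟨_, normSum_of_support h.subset_supp X⟩

theorem FreeHol.sub {a b : Series n} {γ : ℝ} (ha : FreeHol a γ) (hb : FreeHol b γ) :
    FreeHol (a - b) γ := fun X hX => by
  obtain ⟨A, hA⟩ := ha X hX
  obtain ⟨B, hB⟩ := hb X hX
  exact ⟨_, hA.sub hB⟩

theorem FreeHol.sMul {a b : Series n} {γ : ℝ} (ha : FreeHol a γ) (hb : FreeHol b γ) :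
    FreeHol (sMul a b) γ := fun X hX => by
  obtain ⟨A, hA⟩ := ha X hX
  obtain ⟨B, hB⟩ := hb X hX
  exact ⟨_, NormSum.mul (ha.summable_hom hX) (hb.summable_hom hX) hA hB⟩

/-- If `f(0) = 0`, an identity `a(f(X)) = X_i` near `0` holds for the formal power series. -/
theorem comp_eq_Z_of_functional {f : Fin n → Series n} (h0 : ∀ i, f i [] = 0) {γ : ℝ} (hγ : 0 < γ)
    (hf : ∀ i, FreeHol (f i) γ) {a : Series n} {i : Fin n}
    (h : ∀ X Y : Fin n → H2 n →L[ℂ] H2 n, rowNorm X < γ → (∀ j, NormSum (f j) X (Y j)) →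
      NormSum a Y (X i)) : comp a f = Z i := by
  -- The test point is `ε S`: there `f_u` applied to the vector `1` is the dilated series of `f_u`,
  -- so the operator identity can be read off coefficientwise.
  obtain ⟨ε, hε, hεγ⟩ := exists_between hγ
  have hX : rowNorm (opScale ε (shift : Fin n → H2 n →L[ℂ] H2 n)) < γ := by
    rw [rowNorm_opScale hε.le]
    exact (mul_le_of_le_one_right hε.le rowNorm_shift_le).trans_lt hεγ
  choose Y hY using fun j => hf j _ hX
  have hYa : ∀ j ψ, ⇑(Y j ψ) = sMul (dil ε (f j)) ψ := fun j =>
    SOTSum.coe_apply (normSum_dil.2 (hY j)).sotSum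
  have hYw : ∀ u : Word n, ⇑(opWord Y u (basisVec [])) = dil ε (sWord f u) := by
    intro u
    induction u with
    | nil =>
      ext w
      cases w <;> simp [sWord, dil, mono_nil]
    | cons j u ih => rw [opWord_cons, mul_apply_eq_comp, hYa, ih, sWord, dil_sMul]
  have hlim := (h _ _ hX hY).sotSum (basisVec [])
  ext w
  have h1 := lp_tendsto_apply hlim w
  have h2 : ∀ m > w.length,
      partialSum a Y m (basisVec []) w = (ε : ℂ) ^ w.length * comp a f w := by
    intro m hm
    rw [comp_apply_eq_sum h0 (s := (Finset.range m).biUnion (words n)), Finset.sum_biUnion,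
      partialSum_eq]
    · simp only [hom, sum_apply, smul_apply, lp.coeFn_sum, lp.coeFn_smul, Finset.sum_apply,
        Pi.smul_apply, hYw, dil, Finset.mul_sum, smul_eq_mul]
      refine Finset.sum_congr rfl fun k _ => Finset.sum_congr rfl fun u _ => by ring
    · intro k _ l _ hkl
      refine Finset.disjoint_left.2 fun w hw hw' => hkl ?_
      rw [← mem_words.1 hw, ← mem_words.1 hw']
    · intro u hu
      exact Finset.mem_biUnion.2 ⟨u.length, Finset.mem_range.2 (by omega), mem_words.2 rfl⟩
  have h3 : (ε : ℂ) ^ w.length * comp a f w = (ε : ℂ) * Z i w := by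
    have e : (opScale ε shift i (basisVec []) : H2 n) w = (ε : ℂ) * Z i w := by
      simp only [opScale, smul_apply, lp.coeFn_smul, Pi.smul_apply, coe_shift, coe_basisVec,
        mono_nil, sMul_one, smul_eq_mul]
    rw [← e]
    refine tendsto_nhds_unique (tendsto_const_nhds.congr' ?_) h1
    filter_upwards [eventually_gt_atTop w.length] with m hm
    exact (h2 m hm).symm
  have hε' : (ε : ℂ) ≠ 0 := by exact_mod_cast hε.ne'
  by_cases hw : w = [i]
  · subst hw
    simpa [hε'] using h3
  · have hz : (Z i : Series n) w = 0 := by simp [Z, hw]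
    rw [hz] at h3 ⊢
    simpa [hε'] using h3

/-! ### Free holomorphic maps on smaller balls -/

theorem FreeHolMap.eq_of {γ : ℝ} {f : Fin n → Series n} (m : FreeHolMap γ f) {a b : Series n}
    (ha : FreeHol a 1) (hb : FreeHol b 1)
    (h : ∀ X Y : Fin n → H2 n →L[ℂ] H2 n, rowNorm X < γ → rowNorm Y < 1 →
      (∀ j, NormSum (f j) X (Y j)) → ∃ A, NormSum a Y A ∧ NormSum b Y A) : a = b := by
  rw [← sub_eq_zero]
  refine m.not_zero_divisor _ (ha.sub hb) fun X Y hX hY => ?_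
  obtain ⟨A, h1, h2⟩ := h X Y hX (m.range X Y hX hY) hY
  simpa using h1.sub h2

theorem continuous_rowNorm {E : Type*} [NormedAddCommGroup E] [InnerProductSpace ℂ E]
    [CompleteSpace E] : Continuous (rowNorm : (Fin n → E →L[ℂ] E) → ℝ) := by
  refine Real.continuous_sqrt.comp (continuous_norm.comp (continuous_finsetSum _ fun i _ => ?_))
  exact (continuous_apply i).mul
    (ContinuousLinearMap.adjoint.continuous.comp (continuous_apply i))

theorem exists_one_lt_mul_lt {x γ : ℝ} (hx : 0 ≤ x) (h : x < γ) : ∃ ρ > 1, ρ * x < γ := by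
  refine ⟨1 + (γ - x) / (x + 1), ?_, ?_⟩
  · have : 0 < (γ - x) / (x + 1) := div_pos (by linarith) (by linarith)
    linarith
  · have h1 : (γ - x) / (x + 1) * x = (γ - x) * (x / (x + 1)) := by ring
    have h2 : x / (x + 1) < 1 := (div_lt_one (by linarith)).2 (by linarith)
    have h3 : (γ - x) * (x / (x + 1)) < (γ - x) * 1 := mul_lt_mul_of_pos_left h2 (by linarith)
    linarith

theorem differentiableOn_opWord {E : Type*} [NormedAddCommGroup E] [InnerProductSpace ℂ E]
    {Y : ℂ → Fin n → E →L[ℂ] E} {U : Set ℂ} (h : ∀ j, DifferentiableOn ℂ (fun z => Y z j) U)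
    (w : Word n) : DifferentiableOn ℂ (fun z => opWord (Y z) w) U := by
  induction w with
  | nil => simp
  | cons j w ih =>
    simp only [opWord_cons]
    exact (h j).mul ih

/-- Identity theorem: the vanishing of `G ∘ f` propagates from a small ball. -/
theorem FreeHolMap.normSum_zero_of_small {γ γ₀ : ℝ} {f : Fin n → Series n} (m : FreeHolMap γ f)
    (hγ₀ : 0 < γ₀) {G : Series n} (hG : FreeHol G 1)
    (h : ∀ X Y : Fin n → H2 n →L[ℂ] H2 n, rowNorm X < γ₀ → (∀ j, NormSum (f j) X (Y j)) →
      NormSum G Y 0) (X Y : Fin n → H2 n →L[ℂ] H2 n) (hX : rowNorm X < γ)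
    (hY : ∀ j, NormSum (f j) X (Y j)) : NormSum G Y 0 := by
  -- With `ρ > 1` the disc of radius `ρ` contains `0` and `1`, while `z X` stays in the ball. The
  -- function `z ↦ G(f(z X))` is holomorphic there, vanishes near `0`, and its value at `1` is the
  -- one sought.
  obtain ⟨ρ, hρ1, hρ⟩ := exists_one_lt_mul_lt (rowNorm_nonneg X) hX
  have hρ0 : 0 < ρ := by linarith
  set U : Set ℂ := Metric.ball 0 ρ with hU
  have hUo : IsOpen U := Metric.isOpen_ball
  let y : ℂ → Fin n → H2 n →L[ℂ] H2 n := fun z j => ∑' k, hom (f j) k (fun i => z • X i)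
  have hzX : ∀ z ∈ U, rowNorm (fun i => z • X i) < γ := by
    intro z hz
    rw [rowNorm_smul]
    have : ‖z‖ < ρ := by simpa [hU] using hz
    exact (mul_le_mul_of_nonneg_right this.le (rowNorm_nonneg X)).trans_lt hρ
  have hy : ∀ z ∈ U, ∀ j, NormSum (f j) (fun i => z • X i) (y z j) := fun z hz j =>
    normSum_of_summable ((m.hol j).summable_hom (hzX z hz))
  have hy1 : ∀ z ∈ U, rowNorm (y z) < 1 := fun z hz => m.range _ _ (hzX z hz) (hy z hz)
  have hyd : ∀ j, DifferentiableOn ℂ (fun z => y z j) U := by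
    intro j
    refine Complex.differentiableOn_tsum_of_summable_norm
      ((m.hol j).summable (mul_nonneg hρ0.le (rowNorm_nonneg X)) hρ) (fun k => ?_) hUo
      fun k z hz => ?_
    · simp only [hom_smul]
      exact ((differentiable_id.pow k).smul_const _).differentiableOn
    · refine (norm_hom_le _ _ _).trans ?_
      refine mul_le_mul_of_nonneg_left (pow_le_pow_left₀ (rowNorm_nonneg _) ?_ _)
        (slice_nonneg _ _)
      rw [rowNorm_smul]
      have : ‖z‖ < ρ := by simpa [hU] using hz
      exact mul_le_mul_of_nonneg_right this.le (rowNorm_nonneg X)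
  have hyc : ContinuousOn (fun z => rowNorm (y z)) U :=
    continuous_rowNorm.comp_continuousOn
      (continuousOn_pi.2 fun j => (hyd j).continuousOn)
  let g : ℂ → H2 n →L[ℂ] H2 n := fun z => ∑' k, hom G k (y z)
  have hg : ∀ z ∈ U, NormSum G (y z) (g z) := fun z hz =>
    normSum_of_summable (hG.summable_hom (hy1 z hz))
  -- The norms `rowNorm (y z)` are below `1` but need not be uniformly so on the disc; continuity
  -- bounds them by some `θ < 1` near each point, which gives locally uniform convergence.
  have hgd : DifferentiableOn ℂ g U := by
    intro z hz
    obtain ⟨θ, hθ, hθ1⟩ := exists_between (hy1 z hz)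
    have hV : IsOpen (U ∩ (fun z => rowNorm (y z)) ⁻¹' Set.Iio θ) :=
      hyc.isOpen_inter_preimage hUo isOpen_Iio
    refine DifferentiableAt.differentiableWithinAt ?_
    refine DifferentiableOn.differentiableAt ?_ (hV.mem_nhds ⟨hz, hθ⟩)
    refine Complex.differentiableOn_tsum_of_summable_norm
      (hG.summable ((rowNorm_nonneg _).trans hθ.le) hθ1) (fun k => ?_) hV fun k z hz => ?_
    · simp only [hom]
      refine DifferentiableOn.fun_sum fun w _ => ?_
      exact (differentiableOn_opWord (fun j => (hyd j).mono Set.inter_subset_left) w).const_smul (G w)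
    · refine (norm_hom_le _ _ _).trans ?_
      exact mul_le_mul_of_nonneg_left (pow_le_pow_left₀ (rowNorm_nonneg _) (le_of_lt hz.2) _)
        (slice_nonneg _ _)
  have h0U : (0 : ℂ) ∈ U := by simpa [hU] using hρ0
  have h1U : (1 : ℂ) ∈ U := by simpa [hU] using hρ1
  have hev : g =ᶠ[𝓝 0] 0 := by
    have hc : Tendsto (fun z : ℂ => ‖z‖ * rowNorm X) (𝓝 0) (𝓝 0) := by
      have : Continuous fun z : ℂ => ‖z‖ * rowNorm X := by fun_prop
      simpa using this.tendsto 0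
    filter_upwards [hUo.mem_nhds h0U, hc.eventually (gt_mem_nhds hγ₀)] with z hz hz'
    refine (hg z hz).unique (h (fun i => z • X i) (y z) ?_ (hy z hz))
    rwa [rowNorm_smul]
  have hfin := (hgd.analyticOnNhd hUo).eqOn_zero_of_preconnected_of_eventuallyEq_zero
    (convex_ball (0 : ℂ) ρ).isPreconnected h0U hev h1U
  have hY1 : Y = y 1 := by
    ext1 j
    refine (hY j).unique ?_
    simpa using hy 1 h1U j
  rw [hY1]
  simpa [hfin] using hg 1 h1U

/-- This is needed because `f` and `r f` may be given as free holomorphic maps on balls of different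
radii; the comparison takes place on the smaller ball. -/
theorem FreeHolMap.eq_of_small {γ γ₀ : ℝ} {f : Fin n → Series n} (m : FreeHolMap γ f)
    (hγ₀ : 0 < γ₀) {a b : Series n} (ha : FreeHol a 1) (hb : FreeHol b 1)
    (h : ∀ X Y : Fin n → H2 n →L[ℂ] H2 n, rowNorm X < γ₀ →
      (∀ j, NormSum (f j) X (Y j)) → ∃ A, NormSum a Y A ∧ NormSum b Y A) : a = b := by
  rw [← sub_eq_zero]
  refine m.not_zero_divisor _ (ha.sub hb)
    (m.normSum_zero_of_small hγ₀ (ha.sub hb) fun X Y hX hY => ?_)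
  obtain ⟨A, h1, h2⟩ := h X Y hX hY
  simpa using h1.sub h2

/-! ### The universal model as a tuple of multiplication operators -/

theorem coe_basisVec_nil : ⇑(basisVec [] : H2 n) = sOne n := by rw [coe_basisVec, mono_nil]

theorem isPoly_basisVec_nil : IsPoly (⇑(basisVec [] : H2 n)) := isPoly_basisVec []

/-- A bounded operator which is a multiplication on polynomials is a multiplication. -/
theorem coe_eq_sMul_of_poly {A : H2 n →L[ℂ] H2 n} {c : Series n}
    (h : ∀ ψ : H2 n, IsPoly (⇑ψ) → ⇑(A ψ) = sMul c ψ) (ψ : H2 n) : ⇑(A ψ) = sMul c ψ := by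
  ext w
  have e : ∀ (η : H2 n) w, η w = innerSL ℂ (basisVec w) η := by
    intro η w
    rw [innerSL_apply_apply, basisVec, lp.inner_single_left]
    simp
  -- One coefficient of a product is a finite combination of coordinate functionals. Both sides are
  -- therefore bounded functionals, and density of the polynomials applies.
  have key : (innerSL ℂ (basisVec w)).comp A =
      ∑ k ∈ Finset.range (w.length + 1), c (w.take k) • innerSL ℂ (basisVec (w.drop k)) := by
    refine eq_of_eq_on_poly fun ψ hψ => ?_
    rw [ContinuousLinearMap.comp_apply, ← e, h ψ hψ, sum_apply]
    simp only [sMul, smul_apply, smul_eq_mul, e]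
  have := congrArg (fun B : H2 n →L[ℂ] ℂ => B ψ) key
  simp only [ContinuousLinearMap.comp_apply, ← e, sum_apply, smul_apply, smul_eq_mul] at this
  exact this

theorem H2_ext {ψ η : H2 n} (h : (⇑ψ : Series n) = ⇑η) : ψ = η := lp.ext h

/-- After composition with `f`, both sides become `Z_i · (ψ ∘ f)`, and composition is injective. The
other two kinds of model use the same argument with their own injectivity statements. -/
theorem ModelA.mul_apply {f : Fin n → Series n} {M : Fin n → H2 n →L[ℂ] H2 n} (h : ModelA f M)
    (i : Fin n) (ψ : H2 n) : ⇑(M i ψ) = sMul (M i (basisVec [])) ψ := by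
  obtain ⟨q, -, -, hq⟩ := h.inv
  refine coe_eq_sMul_of_poly (fun ψ hψ => ?_) ψ
  have h1 := h.mul i (basisVec []) isPoly_basisVec_nil
  have h2 := h.mul i ψ hψ
  refine comp_injective_poly h.poly hq h2.1 (h1.1.sMul hψ) ?_
  rw [h2.2, comp_sMul_poly h1.1 hψ, h1.2, coe_basisVec_nil, comp_sOne, sMul_one]

theorem ModelA.opWord {f : Fin n → Series n} {M : Fin n → H2 n →L[ℂ] H2 n} (h : ModelA f M)
    (u : Word n) {ψ : H2 n} (hψ : IsPoly (⇑ψ)) :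
    IsPoly (⇑(opWord M u ψ)) ∧ comp (⇑(opWord M u ψ)) f = sMul (mono u) (comp (⇑ψ) f) := by
  induction u with
  | nil => simpa [mono_nil] using hψ
  | cons i u ih =>
    have := h.mul i _ ih.1
    rw [opWord_cons, mul_apply_eq_comp]
    refine ⟨this.1, ?_⟩
    rw [this.2, ih.2, ← sMul_assoc, Z_sMul_mono]

/-- For polynomials `f_j(M)` is a finite sum. On a polynomial `ψ`, composition with `f` turns its
value into `f_j · (ψ ∘ f) = (Z_j ψ) ∘ f`, which identifies `f_j(M)` with `S_j`. -/
theorem ModelA.eval {f : Fin n → Series n} {M : Fin n → H2 n →L[ℂ] H2 n} (h : ModelA f M) :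
    Eval f M shift := by
  obtain ⟨q, -, -, hq⟩ := h.inv
  left
  intro j
  have hs := normSum_of_support (h.poly j).subset_supp M
  refine NormSum.sotSum ?_
  convert hs using 1
  refine eq_of_eq_on_poly fun ψ hψ => H2_ext ?_
  have e : ⇑((∑ w ∈ (h.poly j).supp, f j w • NCDomain.opWord M w) ψ) =
      ∑ w ∈ (h.poly j).supp, f j w • ⇑(NCDomain.opWord M w ψ) := by
    simp only [sum_apply, smul_apply, lp.coeFn_sum, lp.coeFn_smul]
  rw [e, coe_shift]
  refine comp_injective_poly h.poly hq ((isPoly_Z j).sMul hψ)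
    (isPoly_sum _ _ fun w _ => ((h.opWord w hψ).1).smul _) ?_
  rw [comp_sum_poly _ _ _ fun w _ => (h.opWord w hψ).1, comp_sMul_poly (isPoly_Z j) hψ, comp_Z]
  conv_lhs => rw [(h.poly j).eq_sum, ← sMulₗ_apply]
  simp only [map_sum, LinearMap.sum_apply, map_smul, LinearMap.smul_apply, sMulₗ_apply,
    (h.opWord _ hψ).2]

theorem ModelS.mul_apply {f : Fin n → Series n} {M : Fin n → H2 n →L[ℂ] H2 n} (h : ModelS f M)
    (i : Fin n) (ψ : H2 n) : ⇑(M i ψ) = sMul (M i (basisVec [])) ψ := by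
  refine comp_injective h.zero h.jac ?_
  rw [h.mul, comp_sMul h.zero, h.mul, coe_basisVec_nil, comp_sOne, sMul_one]

theorem ModelS.eval_shift {f : Fin n → Series n} {M : Fin n → H2 n →L[ℂ] H2 n} (h : ModelS f M) :
    Eval f M shift := by
  obtain ⟨L, hL, he⟩ := h.eval
  convert he using 1
  ext1 j
  ext1 ψ
  refine H2_ext (comp_injective h.zero h.jac ?_)
  rw [hL, coe_shift, comp_sMul h.zero, comp_Z]

theorem ModelF.mul_apply {γ : ℝ} {f : Fin n → Series n} {M : Fin n → H2 n →L[ℂ] H2 n}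
    (h : ModelF γ f M) (i : Fin n) (ψ : H2 n) : ⇑(M i ψ) = sMul (M i (basisVec [])) ψ := by
  refine h.map.eq_of (freeHol_H2 _) ((freeHol_H2 _).sMul (freeHol_H2 _))
    fun X Y hX hY hf => ?_
  obtain ⟨P, hP⟩ := freeHol_H2 ψ Y hY
  refine ⟨_, h.mul i ψ X Y P hX hf hP, ?_⟩
  refine NormSum.mul ((freeHol_H2 _).summable_hom hY) ((freeHol_H2 _).summable_hom hY) ?_ hP
  have := h.mul i (basisVec []) X Y 1 hX hf (by rw [coe_basisVec_nil]; exact normSum_one Y)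
  rwa [mul_one] at this

theorem ModelF.eval_shift {γ : ℝ} {f : Fin n → Series n} {M : Fin n → H2 n →L[ℂ] H2 n}
    (h : ModelF γ f M) : Eval f M shift := by
  obtain ⟨L, hL, he⟩ := h.eval
  convert he using 1
  ext1 j
  ext1 ψ
  refine H2_ext (h.map.eq_of (freeHol_H2 _) (freeHol_H2 _) fun X Y hX hY hf => ?_)
  obtain ⟨P, hP⟩ := freeHol_H2 ψ Y hY
  refine ⟨_, ?_, hL j ψ X Y P hX hf hP⟩
  rw [coe_shift]
  exact NormSum.mul (summable_Z j Y) ((freeHol_H2 _).summable_hom hY) (normSum_Z j Y) hP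

theorem IsUniversalModel.mul_apply {f : Fin n → Series n} {M : Fin n → H2 n →L[ℂ] H2 n}
    (h : IsUniversalModel f M) (i : Fin n) (ψ : H2 n) :
    ⇑(M i ψ) = sMul (M i (basisVec [])) ψ := by
  rcases h with h | h | ⟨γ, h⟩
  exacts [h.mul_apply i ψ, h.mul_apply i ψ, h.mul_apply i ψ]

theorem IsUniversalModel.eval {f : Fin n → Series n} {M : Fin n → H2 n →L[ℂ] H2 n}
    (h : IsUniversalModel f M) : Eval f M shift := by
  rcases h with h | h | ⟨γ, h⟩
  exacts [h.eval, h.eval_shift, h.eval_shift]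

/-! ### The symbols of the universal models of `r f` -/

theorem sWord_scale (r : ℝ) (f : Fin n → Series n) (u : Word n) :
    sWord (scale r f) u = (r : ℂ) ^ u.length • sWord f u := by
  induction u with
  | nil => simp [sWord]
  | cons i u ih =>
    rw [sWord, sWord, ih, scale, sMul_smul_left, sMul_smul_right, smul_smul, List.length_cons,
      pow_succ']

theorem comp_scale (r : ℝ) (a : Series n) (f : Fin n → Series n) :
    comp a (scale r f) = comp (dil r a) f := by
  ext w
  refine finsum_congr fun u => ?_
  simp only [sWord_scale, dil, Pi.smul_apply, smul_eq_mul]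
  ring

theorem IsPoly.dil {a : Series n} (h : IsPoly a) (t : ℂ) : IsPoly (dil t a) :=
  Set.Finite.subset h fun _ hw => right_ne_zero_of_mul hw

theorem det_jacobian_scale {r : ℝ} {f : Fin n → Series n}
    (h : (jacobian (scale r f)).det ≠ 0) : (jacobian f).det ≠ 0 := by
  have : jacobian (scale r f) = (r : ℂ) • jacobian f := by
    ext i j
    simp [jacobian, scale]
  rw [this, Matrix.det_smul] at h
  exact right_ne_zero_of_mul h

theorem smul_inv_scale {r : ℝ} (hr : r ≠ 0) (f : Fin n → Series n) (i : Fin n) :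
    f i = (r : ℂ)⁻¹ • scale r f i := by
  have : (r : ℂ) ≠ 0 := by exact_mod_cast hr
  rw [scale, smul_smul, inv_mul_cancel₀ this, one_smul]

theorem isPoly_of_scale {r : ℝ} (hr : r ≠ 0) {f : Fin n → Series n} {i : Fin n}
    (h : IsPoly (scale r f i)) : IsPoly (f i) := by
  rw [smul_inv_scale hr f i]
  exact h.smul _

theorem freeHol_of_scale {r : ℝ} (hr : r ≠ 0) {f : Fin n → Series n} {i : Fin n} {γ : ℝ}
    (h : FreeHol (scale r f i) γ) : FreeHol (f i) γ := fun X hX => by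
  obtain ⟨Y, hY⟩ := h X hX
  rw [smul_inv_scale hr f i]
  exact ⟨_, hY.smul _⟩

theorem FreeHol.dil {a : Series n} (h : FreeHol a 1) {r : ℝ} (h0 : 0 ≤ r) (h1 : r ≤ 1) :
    FreeHol (dil r a) 1 := fun X hX => by
  obtain ⟨A, hA⟩ := h (opScale r X) (by
    rw [rowNorm_opScale h0]
    exact (mul_le_of_le_one_left (rowNorm_nonneg X) h1).trans_lt hX)
  exact ⟨A, normSum_dil.2 hA⟩

/-- The universal model of `r f` consists of the multiplications by `g_i(Z / r)`. -/
theorem IsInverse.eq_dil {f g : Fin n → Series n} (hg : IsInverse f g) {r : ℝ} (h0 : 0 < r)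
    (h1 : r ≤ 1) {M : Fin n → H2 n →L[ℂ] H2 n} (hM : IsUniversalModel (scale r f) M) (i : Fin n) :
    g i = dil r (M i (basisVec [])) := by
  have hr : (r : ℂ) ≠ 0 := by exact_mod_cast h0.ne'
  -- The kind of model of `r f` and the kind of inverse need not match. Each model says, in its own
  -- sense, that the dilated symbol composed with `f` is `Z_i`; the nine combinations are then
  -- settled by whichever injectivity is available.
  have hA : ModelA (scale r f) M → (∀ i, IsPoly (f i)) ∧ IsPoly (dil r (M i (basisVec []))) ∧
      comp (dil r (M i (basisVec []))) f = Z i := fun h => by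
    have := h.mul i (basisVec []) isPoly_basisVec_nil
    refine ⟨fun i => isPoly_of_scale h0.ne' (h.poly i), this.1.dil _, ?_⟩
    rw [← comp_scale, this.2, coe_basisVec_nil, comp_sOne, sMul_one]
  have hS : ModelS (scale r f) M → (∀ i, f i [] = 0) ∧ (jacobian f).det ≠ 0 ∧
      comp (dil r (M i (basisVec []))) f = Z i := fun h => by
    refine ⟨fun i => ?_, det_jacobian_scale h.jac, ?_⟩
    · simpa [scale, h0.ne'] using h.zero i
    · rw [← comp_scale, h.mul, coe_basisVec_nil, comp_sOne, sMul_one]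
  have hF : ∀ γ, ModelF γ (scale r f) M → ∀ X Y : Fin n → H2 n →L[ℂ] H2 n, rowNorm X < γ →
      (∀ j, NormSum (f j) X (Y j)) → NormSum (dil r (M i (basisVec []))) Y (X i) :=
    fun γ h X Y hX hY => by
      have := h.mul i (basisVec []) X (fun j => (r : ℂ) • Y j) 1 hX
        (fun j => (hY j).smul (r : ℂ)) (by rw [coe_basisVec_nil]; exact normSum_one _)
      rw [mul_one] at this
      exact normSum_dil.2 this
  have hFhol : FreeHol (dil r (M i (basisVec []))) 1 := (freeHol_H2 _).dil h0.le h1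
  rcases hg with ⟨hf, hgp, hgf, hfg⟩ | ⟨hf0, hJ, hgf⟩ | ⟨γ, m, hgh, hgf⟩
  · rcases hM with h | h | ⟨γ, h⟩
    · obtain ⟨-, hd, hc⟩ := hA h
      exact comp_injective_poly hf hfg (hgp i) hd ((hgf i).trans hc.symm)
    · obtain ⟨hf0, hJ, hc⟩ := hS h
      exact comp_injective hf0 hJ ((hgf i).trans hc.symm)
    -- Here the cancellation property belongs to `r f`, not to `f`, so `g_i(Z / r)` is compared with
    -- the symbol before rescaling.
    · have key : dil (r : ℂ)⁻¹ (g i) = M i (basisVec []) := by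
        refine h.map.eq_of (freeHol_poly ((hgp i).dil _) 1) (freeHol_H2 _)
          fun X Y hX hY hXY => ⟨X i, ?_, ?_⟩
        · refine normSum_dil.2 ?_
          refine normSum_comp (f := f) (X := X) (hgp i) hf (fun j => ?_) ?_
          · rw [smul_inv_scale h0.ne' f j]
            exact (hXY j).smul _
          · rw [hgf i]; exact normSum_Z i X
        · have := h.mul i (basisVec []) X Y 1 hX hXY (by rw [coe_basisVec_nil]; exact normSum_one _)
          rwa [mul_one] at this
      rw [← key, dil_dil, mul_inv_cancel₀ hr, dil_one]
  · refine comp_injective hf0 hJ ((hgf i).trans ?_)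
    rcases hM with h | h | ⟨γ, h⟩
    · exact (hA h).2.2.symm
    · exact (hS h).2.2.symm
    · exact (comp_eq_Z_of_functional hf0 h.map.pos
        (fun j => freeHol_of_scale h0.ne' (h.map.hol j)) (hF γ h)).symm
  · rcases hM with h | h | ⟨γ', h⟩
    · obtain ⟨hf, hd, hc⟩ := hA h
      refine m.eq_of (hgh i) hFhol fun X Y hX _ hXY => ⟨X i, hgf X Y hX hXY i, ?_⟩
      refine normSum_comp (X := X) hd hf hXY ?_
      rw [hc]; exact normSum_Z i X
    · obtain ⟨hf0, hJ, hc⟩ := hS h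
      refine comp_injective hf0 hJ (Eq.trans ?_ hc.symm)
      exact comp_eq_Z_of_functional hf0 m.pos m.hol fun X Y hX hXY => hgf X Y hX hXY i
    · refine m.eq_of_small (γ₀ := min γ γ') (lt_min m.pos h.map.pos) (hgh i) hFhol
        fun X Y hX hXY => ⟨X i, hgf X Y (hX.trans_le (min_le_left _ _)) hXY i, ?_⟩
      exact hF γ' h X Y (hX.trans_le (min_le_right _ _)) hXY

/-! ### Square summable series evaluated at strict row contractions -/

section Calculus

variable {E : Type*} [NormedAddCommGroup E] [InnerProductSpace ℂ E]

theorem hom_add (a b : Series n) (k : ℕ) (X : Fin n → E →L[ℂ] E) :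
    hom (a + b) k X = hom a k X + hom b k X := by
  simp [hom, add_smul, Finset.sum_add_distrib]

theorem hom_const_smul (z : ℂ) (a : Series n) (k : ℕ) (X : Fin n → E →L[ℂ] E) :
    hom (z • a) k X = z • hom a k X :=
  hom_congr_smul (fun _ _ => rfl) X

theorem partialSum_intertwine {F : Type*} [NormedAddCommGroup F] [InnerProductSpace ℂ F]
    {A : Fin n → E →L[ℂ] E} {B : Fin n → F →L[ℂ] F} {R : E →L[ℂ] F}
    (h : ∀ i x, R (A i x) = B i (R x)) (a : Series n) (m : ℕ) (x : E) :
    R (partialSum a A m x) = partialSum a B m (R x) := by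
  simp [partialSum_eq, hom_intertwine h]

variable [CompleteSpace E]

theorem rowNorm_opScale_le {W : Fin n → E →L[ℂ] E} (hW : rowNorm W ≤ 1) {r : ℝ} (h0 : 0 ≤ r) :
    rowNorm (opScale r W) ≤ r := by
  rw [rowNorm_opScale h0]
  exact mul_le_of_le_one_right h0 hW

theorem summable_hom_H2 {W : Fin n → E →L[ℂ] E} (hW : rowNorm W ≤ 1) {r : ℝ} (h0 : 0 ≤ r)
    (h1 : r < 1) (ψ : H2 n) : Summable fun k => ‖hom ψ k (opScale r W)‖ :=
  summable_hom (summable_slice ψ h0 h1) (rowNorm_opScale_le hW h0)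

/-- The map `ψ ↦ ψ(r W)` for a row contraction `W` and `r < 1`. -/
def h2Eval (W : Fin n → E →L[ℂ] E) (hW : rowNorm W ≤ 1) (r : ℝ) (h0 : 0 ≤ r) (h1 : r < 1) :
    H2 n →L[ℂ] (E →L[ℂ] E) :=
  LinearMap.mkContinuous
    { toFun := fun ψ => ∑' k, hom ψ k (opScale r W)
      map_add' := fun ψ η => by
        rw [← ((summable_hom_H2 hW h0 h1 ψ).of_norm).tsum_add (summable_hom_H2 hW h0 h1 η).of_norm]
        exact tsum_congr fun k => hom_add _ _ _ _
      map_smul' := fun z ψ => by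
        rw [RingHom.id_apply, ← ((summable_hom_H2 hW h0 h1 ψ).of_norm).tsum_const_smul z]
        exact tsum_congr fun k => hom_const_smul _ _ _ _ }
    (1 - r)⁻¹ fun ψ => by
      refine (norm_tsum_le_tsum_norm (summable_hom_H2 hW h0 h1 ψ)).trans ?_
      have hgeo := summable_geometric_of_lt_one h0 h1
      calc ∑' k, ‖hom ψ k (opScale r W)‖ ≤ ∑' k, ‖ψ‖ * r ^ k := by
            refine (summable_hom_H2 hW h0 h1 ψ).tsum_le_tsum (fun k => ?_) (hgeo.mul_left _)
            refine (norm_hom_le _ _ _).trans (mul_le_mul (slice_le_norm ψ k) ?_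
              (pow_nonneg (rowNorm_nonneg _) _) (norm_nonneg _))
            exact pow_le_pow_left₀ (rowNorm_nonneg _) (rowNorm_opScale_le hW h0) _
        _ = (1 - r)⁻¹ * ‖ψ‖ := by rw [tsum_mul_left, tsum_geometric_of_lt_one h0 h1, mul_comm]

variable {W : Fin n → E →L[ℂ] E} {hW : rowNorm W ≤ 1} {r : ℝ} {h0 : 0 ≤ r} {h1 : r < 1}

theorem normSum_h2Eval (ψ : H2 n) : NormSum ψ (opScale r W) (h2Eval W hW r h0 h1 ψ) :=
  normSum_of_summable (summable_hom_H2 hW h0 h1 ψ)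

theorem h2Eval_mul {ζ ψ η : H2 n} (h : ⇑ζ = sMul ψ η) :
    h2Eval W hW r h0 h1 ζ = h2Eval W hW r h0 h1 ψ * h2Eval W hW r h0 h1 η := by
  refine (normSum_h2Eval ζ).unique ?_
  rw [h]
  exact NormSum.mul (summable_hom_H2 hW h0 h1 ψ) (summable_hom_H2 hW h0 h1 η) (normSum_h2Eval ψ)
    (normSum_h2Eval η)

theorem h2Eval_one : h2Eval W hW r h0 h1 (basisVec []) = 1 := by
  refine (normSum_h2Eval _).unique ?_
  rw [coe_basisVec_nil]
  exact normSum_one _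

theorem h2Eval_shift_one (i : Fin n) :
    h2Eval W hW r h0 h1 (shift i (basisVec [])) = (r : ℂ) • W i := by
  refine (normSum_h2Eval _).unique ?_
  rw [coe_shift, coe_basisVec_nil, sMul_one]
  exact normSum_Z i _

/-- As `M_i` multiplies by its symbol, the map `ψ ↦ ψ(r W) x` intertwines `M_i` with the value of
that symbol at `r W`. Series in `M` applied to `1` thus become series in these values. -/
theorem h2Eval_partialSum {M : Fin n → H2 n →L[ℂ] H2 n}
    (hM : ∀ i (ψ : H2 n), ⇑(M i ψ) = sMul (M i (basisVec [])) ψ) (t : ℂ) (a : Series n) (m : ℕ) :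
    h2Eval W hW r h0 h1 (partialSum a (fun i => t • M i) m (basisVec [])) =
      partialSum a (fun i => t • h2Eval W hW r h0 h1 (M i (basisVec []))) m := by
  ext x
  have := partialSum_intertwine (A := fun i => t • M i)
    (B := fun i => t • h2Eval W hW r h0 h1 (M i (basisVec [])))
    (R := (ContinuousLinearMap.apply ℂ E x).comp (h2Eval W hW r h0 h1)) (fun i ψ => by
      simp [h2Eval_mul (hM i ψ)]) a m (basisVec [])
  simpa [h2Eval_one] using this

/-- If `r f` has the universal model `M` for some `r < 1` and `V = M 1 (r W)` for a row contraction
`W`, then `f(V)` converges to `W`. -/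
theorem normEval_h2Eval {f : Fin n → Series n} (hr : 0 < r) {M : Fin n → H2 n →L[ℂ] H2 n}
    (hM : IsUniversalModel (scale r f) M) :
    NormEval f (fun i => h2Eval W hW r h0 h1 (M i (basisVec []))) W := by
  have hr' : (r : ℂ) ≠ 0 := by exact_mod_cast hr.ne'
  have hmul := hM.mul_apply
  set V := fun i => h2Eval W hW r h0 h1 (M i (basisVec [])) with hV
  have hcont := (h2Eval W hW r h0 h1).continuous
  have hp : ∀ (t : ℂ) i m, (r : ℂ)⁻¹ • h2Eval W hW r h0 h1
      (partialSum (scale r f i) (fun i => t • M i) m (basisVec [])) =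
      partialSum (f i) (fun i => t • V i) m := by
    intro t i m
    rw [h2Eval_partialSum hmul, smul_inv_scale hr.ne' f i]
    simp only [partialSum, Finset.smul_sum, Pi.smul_apply, smul_smul, smul_eq_mul]
    rfl
  rcases hM.eval with he | he
  · left
    intro i
    -- Strong convergence at the one vector `1` is norm convergence in `H2 n`, which the bounded map
    -- `h2Eval` carries to operator norm convergence. The image of `S_i 1` is `r W_i`, and `r⁻¹`
    -- removes the scaling.
    have h := ((hcont.tendsto _).comp (he i (basisVec []))).const_smul (r : ℂ)⁻¹
    rw [h2Eval_shift_one, smul_smul, inv_mul_cancel₀ hr', one_smul] at h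
    refine h.congr fun m => ?_
    have := hp 1 i m
    simpa using this
  · right
    intro i
    obtain ⟨δ, hδ, F, hF, hl⟩ := he i
    refine ⟨δ, hδ, fun t => (r : ℂ)⁻¹ • h2Eval W hW r h0 h1 (F t (basisVec [])), fun t ht => ?_, ?_⟩
    · have h := ((hcont.tendsto _).comp ((hF t ht).sotSum (basisVec []))).const_smul (r : ℂ)⁻¹
      exact h.congr fun m => hp t i m
    · have h := ((hcont.tendsto _).comp (hl (basisVec []))).const_smul (r : ℂ)⁻¹
      rwa [h2Eval_shift_one, smul_smul, inv_mul_cancel₀ hr', one_smul] at h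

/-- For a row contraction `W`, the series `g(W)` converges in norm, and `f(g(W)) = W`. -/
theorem exists_normSum_normEval {f g : Fin n → Series n} (hg : IsInverse f g)
    (hf : ∃ r ∈ Set.Ioo (0 : ℝ) 1, HasModel (scale r f)) (hW : rowNorm W ≤ 1) :
    ∃ V : Fin n → E →L[ℂ] E, (∀ i, NormSum (g i) W (V i)) ∧ NormEval f V W := by
  obtain ⟨r, hr, M, hM⟩ := hf
  refine ⟨_, fun i => ?_, normEval_h2Eval (hW := hW) (h0 := hr.1.le) (h1 := hr.2) hr.1 hM⟩
  rw [hg.eq_dil hr.1 hr.2.le hM i]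
  exact normSum_dil.2 (normSum_h2Eval _)

end Calculus

theorem scale_one (f : Fin n → Series n) : scale 1 f = f := by
  ext i
  simp [scale]

/-- At `r = 1` the symbol of `M_i` is `g_i` itself, and the norm convergent value `g_i(S)` is
multiplication by the same series. -/
theorem IsUniversalModel.normSum {f g : Fin n → Series n} (hg : IsInverse f g)
    (hf : ∃ r ∈ Set.Ioo (0 : ℝ) 1, HasModel (scale r f)) {M : Fin n → H2 n →L[ℂ] H2 n}
    (hM : IsUniversalModel f M) (i : Fin n) : NormSum (g i) shift (M i) := by
  obtain ⟨V, hV, -⟩ := exists_normSum_normEval hg hf rowNorm_shift_le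
  have : M i = V i := by
    ext1 ψ
    refine H2_ext ?_
    have h1 := hg.eq_dil one_pos le_rfl (by rwa [scale_one]) i
    rw [Complex.ofReal_one, dil_one] at h1
    rw [hM.mul_apply, (hV i).sotSum.coe_apply, h1]
  rw [this]
  exact hV i

theorem exists_hasModel_scale {f : Fin n → Series n}
    (hf : MemMbrad f ∨ (MemMrad f ∧ MemMnorm f)) :
    ∃ r ∈ Set.Ioo (0 : ℝ) 1, HasModel (scale r f) := by
  rcases hf with ⟨δ, hδ, h⟩ | ⟨⟨-, δ, hδ, h⟩, -⟩
  all_goals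
    obtain ⟨r, h1, h2⟩ := exists_between hδ.2
    refine ⟨r, ⟨hδ.1.trans h1, h2⟩, ?_⟩
  · obtain ⟨M, hM, -⟩ := h r ⟨h1, h2.le⟩
    exact ⟨M, hM⟩
  · exact h r ⟨h1, h2.le⟩

/-! ### Square roots of positive operators -/

theorem exists_sqrt {E : Type*} [NormedAddCommGroup E] [InnerProductSpace ℂ E] [CompleteSpace E]
    {P : E →L[ℂ] E} (hP : P.IsPositive) :
    ∃ D : E →L[ℂ] E, ∀ x y, inner ℂ (D x) (D y) = inner ℂ x (P y) := by
  have h0 : 0 ≤ P := (ContinuousLinearMap.nonneg_iff_isPositive P).2 hP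
  refine ⟨CFC.sqrt P, fun x y => ?_⟩
  have hs : IsSelfAdjoint (CFC.sqrt P) := IsSelfAdjoint.of_nonneg (CFC.sqrt_nonneg P)
  have hm : CFC.sqrt P * CFC.sqrt P = P := CFC.sqrt_mul_sqrt_self P h0
  conv_rhs => rw [← hm, mul_apply_eq_comp]
  rw [← ContinuousLinearMap.adjoint_inner_right, ← ContinuousLinearMap.star_eq_adjoint, hs.star_eq]

/-- The words of length below `m` exhaust all words, and for nonnegative terms one exhaustion
determines the unconditional sum. -/
theorem hasSum_words {a : Word n → ℝ} (ha : ∀ w, 0 ≤ a w) {L : ℝ}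
    (h : Tendsto (fun m => ∑ k ∈ Finset.range m, ∑ w ∈ words n k, a w) atTop (𝓝 L)) :
    HasSum a L := by
  have hT : ∀ m, ∑ k ∈ Finset.range m, ∑ w ∈ words n k, a w =
      ∑ w ∈ (Finset.range m).biUnion (words n), a w := by
    intro m
    rw [Finset.sum_biUnion]
    intro k _ l _ hkl
    refine Finset.disjoint_left.2 fun w hw hw' => hkl ?_
    rw [← mem_words.1 hw, ← mem_words.1 hw']
  have hmono : Monotone fun m => (Finset.range m).biUnion (words n) := fun m m' hm =>
    Finset.biUnion_subset_biUnion_of_subset_left _ (Finset.range_mono hm)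
  have hex : Tendsto (fun m => (Finset.range m).biUnion (words n)) atTop atTop := by
    refine tendsto_atTop_finset_of_monotone hmono fun w => ⟨w.length + 1, ?_⟩
    exact Finset.mem_biUnion.2 ⟨w.length, by simp, by simp⟩
  simp only [hT] at h
  have hle : ∀ m, ∑ w ∈ (Finset.range m).biUnion (words n), a w ≤ L := fun m => by
    refine (monotone_nat_of_le_succ fun m => ?_).ge_of_tendsto h m
    exact Finset.sum_le_sum_of_subset_of_nonneg (hmono m.le_succ) fun _ _ _ => ha _
  have hs : Summable a := by
    refine summable_of_sum_le ha (c := L) fun s => ?_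
    obtain ⟨m, hm⟩ := (hex.eventually (eventually_ge_atTop s)).exists
    exact (Finset.sum_le_sum_of_subset_of_nonneg hm fun _ _ _ => ha _).trans (hle m)
  have := hs.hasSum.comp hex
  exact tendsto_nhds_unique this h ▸ hs.hasSum

/-! ### The Poisson kernel -/

section Poisson

variable {E : Type*} [NormedAddCommGroup E] [InnerProductSpace ℂ E] [CompleteSpace E]

theorem isPositive_one_sub {X : Fin n → E →L[ℂ] E} (hX : rowNorm X ≤ 1) :
    (1 - ∑ i, X i * ContinuousLinearMap.adjoint (X i)).IsPositive := by
  rw [ContinuousLinearMap.isPositive_def']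
  constructor
  · rw [IsSelfAdjoint, star_sub, star_one, star_sum]
    simp [← ContinuousLinearMap.star_eq_adjoint]
  · intro y
    have h := congrArg Complex.re (sum_norm_adjoint_sq X y)
    rw [Complex.ofReal_re] at h
    rw [ContinuousLinearMap.reApplyInnerSelf, sub_apply, inner_sub_left, map_sub]
    have h2 := sum_norm_adjoint_sq_le X y
    have h3 : rowNorm X ^ 2 ≤ 1 := pow_le_one₀ (rowNorm_nonneg X) hX
    have h4 : RCLike.re (inner ℂ ((1 : E →L[ℂ] E) y) y) = ‖y‖ ^ 2 := by
      simp [← Complex.ofReal_pow]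
    rw [h4]
    change 0 ≤ ‖y‖ ^ 2 - Complex.re _
    rw [← h]
    nlinarith [sq_nonneg ‖y‖]

theorem exists_defect {X : Fin n → E →L[ℂ] E} (hX : rowNorm X ≤ 1) :
    ∃ D : E →L[ℂ] E, ∀ x,
      ‖D x‖ ^ 2 = ‖x‖ ^ 2 - ∑ i, ‖ContinuousLinearMap.adjoint (X i) x‖ ^ 2 := by
  obtain ⟨D, hD⟩ := exists_sqrt (isPositive_one_sub hX)
  refine ⟨D, fun x => ?_⟩
  have h1 := hD x x
  rw [sub_apply, inner_sub_right, one_apply_eq_self, inner_self_eq_norm_sq_to_K,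
    inner_self_eq_norm_sq_to_K, ← inner_conj_symm x, ← sum_norm_adjoint_sq] at h1
  rw [Complex.conj_ofReal] at h1
  refine Complex.ofReal_injective ?_
  rw [Complex.ofReal_sub, Complex.ofReal_pow, Complex.ofReal_pow]
  exact h1

/-- The words of length `k` contribute `A k - A (k + 1)`, so the sum telescopes; `A k` tends to `0`
because the row contraction is strict. This makes the Poisson kernel isometric. -/
theorem hasSum_defect {X : Fin n → E →L[ℂ] E} (hX : rowNorm X < 1) {D : E →L[ℂ] E}
    (hD : ∀ x, ‖D x‖ ^ 2 = ‖x‖ ^ 2 - ∑ i, ‖ContinuousLinearMap.adjoint (X i) x‖ ^ 2) (x : E) :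
    HasSum (fun w => ‖D (ContinuousLinearMap.adjoint (opWord X w) x)‖ ^ 2) (‖x‖ ^ 2) := by
  set A : ℕ → ℝ := fun k => ∑ w ∈ words n k, ‖ContinuousLinearMap.adjoint (opWord X w) x‖ ^ 2
    with hA
  have hstep : ∀ k, ∑ w ∈ words n k, ‖D (ContinuousLinearMap.adjoint (opWord X w) x)‖ ^ 2 =
      A k - A (k + 1) := by
    intro k
    have e : A (k + 1) = ∑ u ∈ words n k, ∑ i,
        ‖ContinuousLinearMap.adjoint (X i) (ContinuousLinearMap.adjoint (opWord X u) x)‖ ^ 2 := by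
      have := sum_words_add k 1 fun u v : Word n =>
        ‖ContinuousLinearMap.adjoint (opWord X (u ++ v)) x‖ ^ 2
      simp only [List.take_append_drop] at this
      rw [hA]
      refine this.trans (Finset.sum_congr rfl fun u _ => ?_)
      rw [sum_words_succ]
      simp [words_zero, opWord_append, opWord_cons, ← ContinuousLinearMap.star_eq_adjoint]
    rw [e, hA, ← Finset.sum_sub_distrib]
    exact Finset.sum_congr rfl fun w _ => hD _
  refine hasSum_words (fun w => by positivity) ?_
  simp only [hstep, Finset.sum_range_sub']
  have hA0 : A 0 = ‖x‖ ^ 2 := by simp [hA, words_zero, ← ContinuousLinearMap.star_eq_adjoint]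
  have hAl : Tendsto A atTop (𝓝 0) := by
    have h2 : Tendsto (fun k => (rowNorm X ^ k) ^ 2 * ‖x‖ ^ 2) atTop (𝓝 0) := by
      have := ((tendsto_pow_atTop_nhds_zero_of_lt_one (rowNorm_nonneg X) hX).pow 2).mul_const
        (‖x‖ ^ 2)
      simpa using this
    refine squeeze_zero (fun k => ?_) (fun k => sum_norm_adjoint_opWord_sq_le X k x) h2
    exact Finset.sum_nonneg fun _ _ => by positivity
  simpa [hA0] using tendsto_const_nhds.sub hAl

/-- Diagonal ampliation. -/
def amp (ι : Type*) (A : H2 n →L[ℂ] H2 n) :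
    lp (fun _ : ι => H2 n) 2 →L[ℂ] lp (fun _ : ι => H2 n) 2 :=
  lp.mapCLM 2 (fun _ => A) (norm_nonneg A) fun _ => le_rfl

theorem amp_apply {ι : Type*} (A : H2 n →L[ℂ] H2 n) (ξ : lp (fun _ : ι => H2 n) 2) (s : ι) :
    amp ι A ξ s = A (ξ s) := rfl

theorem norm_amp_le {ι : Type*} (A : H2 n →L[ℂ] H2 n) : ‖amp ι A‖ ≤ ‖A‖ :=
  lp.norm_mapCLM_le _ _ _ _

theorem hasSum_swap {ι κ : Type*} {F : ι → κ → ℝ} (hF : ∀ a s, 0 ≤ F a s) {c : ι → ℝ} {L : ℝ}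
    (h1 : ∀ a, HasSum (F a) (c a)) (h2 : HasSum c L) :
    (∀ s, Summable fun a => F a s) ∧ HasSum (fun s => ∑' a, F a s) L := by
  have hs : Summable fun p : ι × κ => F p.1 p.2 := by
    refine (summable_prod_of_nonneg fun p => hF p.1 p.2).2 ⟨fun a => (h1 a).summable, ?_⟩
    refine h2.summable.congr fun a => (h1 a).tsum_eq.symm
  have hL : HasSum (fun p : ι × κ => F p.1 p.2) L := by
    have := hs.hasSum.prod_fiberwise fun a => h1 a
    rw [← this.unique h2]
    exact hs.hasSum
  have hsw : HasSum (fun p : κ × ι => F p.2 p.1) L :=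
    (Equiv.prodComm κ ι).hasSum_iff.2 hL
  have hf : ∀ s, Summable fun a => F a s := fun s => hsw.summable.prod_factor s
  exact ⟨hf, hsw.prod_fiberwise fun s => (hf s).hasSum⟩

/-- The Poisson kernel of a strict row contraction. -/
theorem exists_poisson {ι : Type*} (b : HilbertBasis ι ℂ E) {X : Fin n → E →L[ℂ] E}
    (hX : rowNorm X < 1) : ∃ J : E →ₗᵢ[ℂ] lp (fun _ : ι => H2 n) 2, ∀ u v x y,
      inner ℂ (J x) (amp ι (opWord shift u * ContinuousLinearMap.adjoint (opWord shift v)) (J y)) =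
        inner ℂ x ((opWord X u * ContinuousLinearMap.adjoint (opWord X v)) y) := by
  obtain ⟨D, hD⟩ := exists_defect hX.le
  have hparseval : ∀ v : E, HasSum (fun s => ‖inner ℂ (b s) v‖ ^ 2) (‖v‖ ^ 2) := by
    intro v
    have := hasSum_lp_norm_sq (b.repr v)
    simpa [b.repr_apply_apply] using this
  have hsum := fun x => hasSum_swap (F := fun (w : Word n) s =>
    ‖inner ℂ (b s) (D (ContinuousLinearMap.adjoint (opWord X w) x))‖ ^ 2)
    (fun _ _ => by positivity) (fun w => hparseval _) (hasSum_defect hX hD x)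
  -- The kernel is `x ↦ (D X_w^* x)_w`, with the vectors of `E` written in the basis `b`. Its target
  -- becomes a direct sum of copies of `H2 n`, on which creation operators act diagonally.
  let j : E → ι → H2 n := fun x s =>
    ⟨fun w => inner ℂ (b s) (D (ContinuousLinearMap.adjoint (opWord X w) x)),
      memℓp_two_iff.2 ((hsum x).1 s)⟩
  have hj : ∀ x s w, j x s w = inner ℂ (b s) (D (ContinuousLinearMap.adjoint (opWord X w) x)) :=
    fun _ _ _ => rfl
  have hjn : ∀ x, HasSum (fun s => ‖j x s‖ ^ 2) (‖x‖ ^ 2) := by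
    intro x
    refine (hsum x).2.congr_fun ?_ |> fun h => h
    intro s
    rw [lp_norm_sq]
  let J : E →ₗᵢ[ℂ] lp (fun _ : ι => H2 n) 2 :=
    { toFun := fun x => ⟨j x, memℓp_two_iff.2 (hjn x).summable⟩
      map_add' := fun x y => by
        refine lp.ext (funext fun s => H2_ext (funext fun w => ?_))
        change j (x + y) s w = j x s w + j y s w
        simp only [hj, map_add, inner_add_right]
      map_smul' := fun c x => by
        refine lp.ext (funext fun s => H2_ext (funext fun w => ?_))
        change j (c • x) s w = c * j x s w
        simp only [hj, map_smul, inner_smul_right]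
      norm_map' := fun x => by
        refine (sq_eq_sq₀ (norm_nonneg _) (norm_nonneg _)).1 ?_
        exact (hasSum_lp_norm_sq _).unique (hjn x) }
  have hJ : ∀ x s, J x s = j x s := fun _ _ => rfl
  -- The kernel intertwines `X_u^*` with the ampliation of `S_u^*`; together with its isometry this
  -- yields the compression formula.
  have hint : ∀ (u : Word n) x s, ContinuousLinearMap.adjoint (opWord shift u) (j x s) =
      j (ContinuousLinearMap.adjoint (opWord X u) x) s := by
    intro u
    induction u with
    | nil => simp [← ContinuousLinearMap.star_eq_adjoint]
    | cons i u ih =>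
      intro x s
      have e1 : ContinuousLinearMap.adjoint (shift i) (j x s) =
          j (ContinuousLinearMap.adjoint (X i) x) s := by
        refine H2_ext (funext fun w => (adjoint_creation_apply i _ w).trans ?_)
        rw [hj, hj, opWord_cons, ← ContinuousLinearMap.star_eq_adjoint, star_mul]
        rfl
      simp only [opWord_cons, ← ContinuousLinearMap.star_eq_adjoint, star_mul] at ih e1 ⊢
      rw [mul_apply_eq_comp, e1, ih, mul_apply_eq_comp]
  refine ⟨J, fun u v x y => ?_⟩
  have e : inner ℂ x ((opWord X u * ContinuousLinearMap.adjoint (opWord X v)) y) =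
      inner ℂ (J (ContinuousLinearMap.adjoint (opWord X u) x))
        (J (ContinuousLinearMap.adjoint (opWord X v) y)) := by
    rw [J.inner_map_map, ContinuousLinearMap.adjoint_inner_left, mul_apply_eq_comp]
  rw [e, lp.inner_eq_tsum, lp.inner_eq_tsum]
  refine tsum_congr fun s => ?_
  change inner ℂ (j x s)
    ((opWord shift u * ContinuousLinearMap.adjoint (opWord shift v)) (j y s)) =
    inner ℂ (j (ContinuousLinearMap.adjoint (opWord X u) x) s)
      (j (ContinuousLinearMap.adjoint (opWord X v) y) s)
  rw [mul_apply_eq_comp, ← ContinuousLinearMap.adjoint_inner_left, hint, hint]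

end Poisson

/-! ### The C*-algebra of a row isometry -/

section RowIsometryAlgebra

/-- The words in a row isometry span, together with their adjoints, a star algebra. -/
theorem adjoin_le_span {R : Type*} [Ring R] [StarRing R] [Algebra ℂ R] [StarModule ℂ R]
    {u : Fin n → R} (hu : ∀ i j, star (u i) * u j = if i = j then 1 else 0) {x : R}
    (hx : x ∈ StarAlgebra.adjoin ℂ (Set.range u)) :
    x ∈ Submodule.span ℂ
      (Set.range fun p : Word n × Word n => (p.1.map u).prod * star (p.2.map u).prod) := by
  set 𝒮 := Submodule.span ℂ
    (Set.range fun p : Word n × Word n => (p.1.map u).prod * star (p.2.map u).prod) with h𝒮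
  have hmem : ∀ p q : Word n, (p.map u).prod * star (q.map u).prod ∈ 𝒮 := fun p q =>
    Submodule.subset_span ⟨(p, q), rfl⟩
  have hstab : ∀ z : R, (∀ p q : Word n, z * ((p.map u).prod * star (q.map u).prod) ∈ 𝒮) →
      ∀ y ∈ 𝒮, z * y ∈ 𝒮 := by
    intro z hz y hy
    refine Submodule.span_induction (p := fun y _ => z * y ∈ 𝒮) ?_ ?_ ?_ ?_ hy
    · rintro _ ⟨p, rfl⟩
      exact hz p.1 p.2
    · simp
    · intro a b _ _ ha hb
      rw [mul_add]
      exact add_mem ha hb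
    · intro c a _ ha
      rw [mul_smul_comm]
      exact 𝒮.smul_mem _ ha
  have hx' : x ∈ Algebra.adjoin ℂ (Set.range u ∪ star (Set.range u)) := by
    rw [← StarAlgebra.adjoin_toSubalgebra]
    exact hx
  have key : ∀ y ∈ 𝒮, x * y ∈ 𝒮 := by
    refine Algebra.adjoin_induction (p := fun x _ => ∀ y ∈ 𝒮, x * y ∈ 𝒮) ?_ ?_ ?_ ?_ hx'
    · rintro z (⟨i, rfl⟩ | ⟨i, hi⟩)
      · refine hstab _ fun p q => ?_
        have := hmem (i :: p) q
        rwa [List.map_cons, List.prod_cons, mul_assoc] at this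
      · have hz : z = star (u i) := by rw [hi, star_star]
        subst hz
        refine hstab _ fun p q => ?_
        cases p with
        | nil =>
          have := hmem [] (q ++ [i])
          simpa using this
        | cons j p =>
          rw [List.map_cons, List.prod_cons, ← mul_assoc, ← mul_assoc, hu]
          split_ifs
          · simpa using hmem p q
          · simp
    · intro c y hy
      rw [← Algebra.smul_def]
      exact 𝒮.smul_mem c hy
    · intro a b _ _ ha hb y hy
      rw [add_mul]
      exact add_mem (ha y hy) (hb y hy)
    · intro a b _ _ ha hb y hy
      rw [mul_assoc]
      exact ha _ (hb y hy)
  have h1 : (1 : R) ∈ 𝒮 := by simpa using hmem [] []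
  simpa using key 1 h1

variable {E : Type*} [NormedAddCommGroup E] [InnerProductSpace ℂ E]

/-- The pairs `(S_i, W_i)`. -/
def shiftPair (W : Fin n → E →L[ℂ] E) (i : Fin n) : (H2 n →L[ℂ] H2 n) × (E →L[ℂ] E) :=
  (shift i, W i)

theorem shiftPair_prod (W : Fin n → E →L[ℂ] E) (w : Word n) :
    (w.map (shiftPair W)).prod = (opWord shift w, opWord W w) := by
  induction w with
  | nil => rfl
  | cons i w ih => rw [List.map_cons, List.prod_cons, ih, opWord_cons, opWord_cons]; rfl

variable [CompleteSpace E]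

/-- The closed star algebra generated by the pairs `(S_i, W_i)`. -/
def pairAlgebra (W : Fin n → E →L[ℂ] E) :
    StarSubalgebra ℂ ((H2 n →L[ℂ] H2 n) × (E →L[ℂ] E)) :=
  (StarAlgebra.adjoin ℂ (Set.range (shiftPair W))).topologicalClosure

variable {W : Fin n → E →L[ℂ] E}
  (hW : ∀ i j, ContinuousLinearMap.adjoint (W i) * W j = if i = j then 1 else 0)

-- A von Neumann inequality: the Poisson isometry of the strict row contraction `r W` compresses the
-- ampliation of `p.1` to an operator of norm at most `‖p.1‖`, and these compressions tend to `p.2`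
-- as `r → 1`.
include hW in
theorem norm_snd_le_of_span {p : (H2 n →L[ℂ] H2 n) × (E →L[ℂ] E)}
    (hp : p ∈ StarAlgebra.adjoin ℂ (Set.range (shiftPair W))) : ‖p.2‖ ≤ ‖p.1‖ := by
  have hu : ∀ i j, star (shiftPair W i) * shiftPair W j = if i = j then 1 else 0 := by
    intro i j
    refine Prod.ext ((shift_isometry i j).trans ?_) ((hW i j).trans ?_) <;> split_ifs <;> rfl
  have hsp := adjoin_le_span hu hp
  simp only [shiftPair_prod] at hsp
  obtain ⟨ι, b, -⟩ := exists_hilbertBasis ℂ E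
  have hr : ∀ r ∈ Set.Ioo (0 : ℝ) 1, rowNorm (opScale r W) < 1 := fun r hr =>
    (rowNorm_opScale_le (rowNorm_le_one_of_isometry hW) hr.1.le).trans_lt hr.2
  choose J hJ using fun r (h : r ∈ Set.Ioo (0 : ℝ) 1) => exists_poisson b (hr r h)
  -- Induction over the span of pairs follows both coordinates together, so no map from the first to
  -- the second has to be well defined beforehand.
  have key : ∃ φ : ℝ → E →L[ℂ] E, Tendsto φ (𝓝[<] 1) (𝓝 p.2) ∧
      ∀ r (hr : r ∈ Set.Ioo (0 : ℝ) 1) x y,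
        inner ℂ (J r hr x) (amp ι p.1 (J r hr y)) = inner ℂ x (φ r y) := by
    refine Submodule.span_induction
      (p := fun p _ => ∃ φ : ℝ → E →L[ℂ] E, Tendsto φ (𝓝[<] 1) (𝓝 p.2) ∧
        ∀ r (hr : r ∈ Set.Ioo (0 : ℝ) 1) x y,
          inner ℂ (J r hr x) (amp ι p.1 (J r hr y)) = inner ℂ x (φ r y)) ?_ ?_ ?_ ?_ hsp
    · rintro _ ⟨⟨u, v⟩, rfl⟩
      refine ⟨fun r => opWord (opScale r W) u *
        ContinuousLinearMap.adjoint (opWord (opScale r W) v), ?_, fun r hr x y => hJ r hr u v x y⟩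
      have e : ∀ r : ℝ, opWord (opScale r W) u *
          ContinuousLinearMap.adjoint (opWord (opScale r W) v) =
          ((r : ℂ) ^ (u.length + v.length)) •
            (opWord W u * ContinuousLinearMap.adjoint (opWord W v)) := by
        intro r
        have := fun w => opWord_smul (r : ℂ) W w
        change ∀ w, opWord (opScale r W) w = _ at this
        rw [this, this, ← ContinuousLinearMap.star_eq_adjoint, ← ContinuousLinearMap.star_eq_adjoint,
          star_smul, smul_mul_smul_comm, star_pow, ← starRingEnd_apply, Complex.conj_ofReal, pow_add]
      simp only [e]
      have hc : Continuous fun r : ℝ => ((r : ℂ) ^ (u.length + v.length)) •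
          (opWord W u * ContinuousLinearMap.adjoint (opWord W v)) := by fun_prop
      have := hc.tendsto 1
      simp only [Complex.ofReal_one, one_pow, one_smul] at this
      exact this.mono_left nhdsWithin_le_nhds
    · refine ⟨0, tendsto_const_nhds, fun r hr x y => ?_⟩
      have : amp ι (0 : H2 n →L[ℂ] H2 n) (J r hr y) = 0 := lp.ext (funext fun s => by
        rw [amp_apply]; rfl)
      simp [this]
    · rintro a b - - ⟨φ, h1, h2⟩ ⟨φ', h1', h2'⟩
      refine ⟨φ + φ', h1.add h1', fun r hr x y => ?_⟩
      have : amp ι (a.1 + b.1) (J r hr y) = amp ι a.1 (J r hr y) + amp ι b.1 (J r hr y) :=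
        lp.ext (funext fun s => rfl)
      rw [Prod.fst_add, this, inner_add_right, h2 r hr, h2' r hr, Pi.add_apply, add_apply,
        inner_add_right]
    · rintro c a - ⟨φ, h1, h2⟩
      refine ⟨c • φ, h1.const_smul c, fun r hr x y => ?_⟩
      have : amp ι (c • a.1) (J r hr y) = c • amp ι a.1 (J r hr y) := lp.ext (funext fun s => rfl)
      rw [Prod.smul_fst, this, inner_smul_right, h2 r hr, Pi.smul_apply, smul_apply,
        inner_smul_right]
  obtain ⟨φ, h1, h2⟩ := key
  refine le_of_tendsto h1.norm ?_
  filter_upwards [Ioo_mem_nhdsLT one_pos] with r hr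
  refine ContinuousLinearMap.opNorm_le_bound _ (norm_nonneg _) fun y => ?_
  have h3 : ‖φ r y‖ * ‖φ r y‖ ≤ ‖φ r y‖ * (‖p.1‖ * ‖y‖) := by
    calc ‖φ r y‖ * ‖φ r y‖ = ‖inner ℂ (φ r y) (φ r y)‖ := by
          rw [inner_self_eq_norm_sq_to_K]; simp [pow_two]
      _ = ‖inner ℂ (J r hr (φ r y)) (amp ι p.1 (J r hr y))‖ := by rw [h2 r hr]
      _ ≤ ‖J r hr (φ r y)‖ * ‖amp ι p.1 (J r hr y)‖ := norm_inner_le_norm _ _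
      _ ≤ ‖φ r y‖ * (‖p.1‖ * ‖y‖) := by
          rw [LinearIsometry.norm_map]
          refine mul_le_mul_of_nonneg_left ?_ (norm_nonneg _)
          refine ((amp ι p.1).le_of_opNorm_le (norm_amp_le _) _).trans ?_
          rw [LinearIsometry.norm_map]
  rcases (norm_nonneg (φ r y)).eq_or_lt with h0 | h0
  · rw [← h0]; positivity
  · exact le_of_mul_le_mul_left h3 h0

include hW in
theorem norm_snd_le {p : (H2 n →L[ℂ] H2 n) × (E →L[ℂ] E)} (hp : p ∈ pairAlgebra W) :
    ‖p.2‖ ≤ ‖p.1‖ := by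
  have hc : IsClosed {p : (H2 n →L[ℂ] H2 n) × (E →L[ℂ] E) | ‖p.2‖ ≤ ‖p.1‖} :=
    isClosed_le continuous_snd.norm continuous_fst.norm
  exact closure_minimal (fun p hp => norm_snd_le_of_span hW hp) hc hp

include hW in
theorem pairAlgebra_unique {A : H2 n →L[ℂ] H2 n} {B B' : E →L[ℂ] E}
    (h : (A, B) ∈ pairAlgebra W) (h' : (A, B') ∈ pairAlgebra W) : B = B' := by
  have := norm_snd_le hW (sub_mem h h')
  simpa [sub_eq_zero] using this

-- By the norm inequality, the first projection is isometric on the complete pair algebra, so its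
-- range is closed and will contain all of `C*(M)`.
include hW in
theorem isClosed_fst_pairAlgebra :
    IsClosed (((pairAlgebra W).map (StarAlgHom.fst ℂ _ _) :
      StarSubalgebra ℂ (H2 n →L[ℂ] H2 n)) : Set (H2 n →L[ℂ] H2 n)) := by
  have hcl : IsClosed (pairAlgebra W : Set ((H2 n →L[ℂ] H2 n) × (E →L[ℂ] E))) :=
    StarSubalgebra.isClosed_topologicalClosure _
  have : CompleteSpace (pairAlgebra W) := hcl.completeSpace_coe
  have hanti : AntilipschitzWith 1 (fun p : pairAlgebra W => p.1.1) := by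
    refine AntilipschitzWith.of_le_mul_dist fun p q => ?_
    rw [NNReal.coe_one, one_mul, Subtype.dist_eq, dist_eq_norm, dist_eq_norm]
    have h := norm_snd_le hW (sub_mem p.2 q.2)
    exact max_le le_rfl h
  have huc : UniformContinuous (fun p : pairAlgebra W => p.1.1) :=
    uniformContinuous_fst.comp uniformContinuous_subtype_val
  have e : (((pairAlgebra W).map (StarAlgHom.fst ℂ _ _) :
      StarSubalgebra ℂ (H2 n →L[ℂ] H2 n)) : Set (H2 n →L[ℂ] H2 n)) =
      Set.range (fun p : pairAlgebra W => p.1.1) := by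
    ext A
    constructor
    · rintro ⟨p, hp, rfl⟩
      exact ⟨⟨p, hp⟩, rfl⟩
    · rintro ⟨p, rfl⟩
      exact ⟨p.1, p.2, rfl⟩
  rw [e]
  exact hanti.isClosed_range huc

include hW in
/-- The series `g(W)` in a row isometry `W` define a representation of the C*-algebra generated by
the series `g(S)` in the creation operators. -/
theorem exists_representation {g : Fin n → Series n} {M : Fin n → H2 n →L[ℂ] H2 n}
    {V : Fin n → E →L[ℂ] E} (hM : ∀ i, NormSum (g i) shift (M i))
    (hV : ∀ i, NormSum (g i) W (V i)) :
    ∃ π : cstar M →⋆ₐ[ℂ] (E →L[ℂ] E), ∀ i, π ⟨M i, mem_cstar M i⟩ = V i := by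
  have hcl : IsClosed (pairAlgebra W : Set ((H2 n →L[ℂ] H2 n) × (E →L[ℂ] E))) :=
    StarSubalgebra.isClosed_topologicalClosure _
  have hgen : ∀ w, (opWord shift w, opWord W w) ∈ pairAlgebra W := by
    intro w
    rw [← shiftPair_prod]
    refine list_prod_mem fun x hx => ?_
    obtain ⟨i, -, rfl⟩ := List.mem_map.1 hx
    exact StarSubalgebra.le_topologicalClosure _
      (StarAlgebra.subset_adjoin ℂ _ (Set.mem_range_self i))
  have hps : ∀ a m, (partialSum a shift m, partialSum a W m) ∈ pairAlgebra W := by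
    intro a m
    have e : (partialSum a shift m, partialSum a W m) =
        ∑ k ∈ Finset.range m, ∑ w ∈ words n k, a w • (opWord shift w, opWord W w) := by
      refine Prod.ext ?_ ?_ <;>
        simp only [partialSum_eq, hom, Prod.fst_sum, Prod.snd_sum, Prod.smul_fst, Prod.smul_snd]
    rw [e]
    exact sum_mem fun k _ => sum_mem fun w _ => (pairAlgebra W).smul_mem (hgen w) _
  have hMV : ∀ i, (M i, V i) ∈ pairAlgebra W := fun i =>
    hcl.mem_of_tendsto ((hM i).prodMk_nhds (hV i)) (.of_forall (hps (g i)))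
  have hle : cstar M ≤ (pairAlgebra W).map (StarAlgHom.fst ℂ _ _) := by
    refine StarSubalgebra.topologicalClosure_minimal ?_ (isClosed_fst_pairAlgebra hW)
    refine StarAlgebra.adjoin_le ?_
    rintro _ ⟨i, rfl⟩
    exact ⟨_, hMV i, rfl⟩
  have hex : ∀ A : cstar M, ∃ B, (A.1, B) ∈ pairAlgebra W := by
    intro A
    obtain ⟨⟨A', B⟩, h, h'⟩ := hle A.2
    refine ⟨B, ?_⟩
    rw [← h']
    exact h
  choose π hπ using hex
  -- The pair algebra is the graph of the representation, and each algebraic law for `π` is read off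
  -- from its closure under the corresponding operation.
  have huniq : ∀ {A : cstar M} {B : E →L[ℂ] E}, (A.1, B) ∈ pairAlgebra W → π A = B := fun h =>
    pairAlgebra_unique hW (hπ _) h
  have h1 : π 1 = 1 := huniq (one_mem (pairAlgebra W))
  have h0 : π 0 = 0 := huniq (zero_mem (pairAlgebra W))
  have hmul : ∀ A B, π (A * B) = π A * π B := fun A B => by
    refine huniq ?_
    rw [MulMemClass.coe_mul, ← Prod.mk_mul_mk]
    exact mul_mem (hπ A) (hπ B)
  have hadd : ∀ A B, π (A + B) = π A + π B := fun A B => by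
    refine huniq ?_
    rw [AddMemClass.coe_add, ← Prod.mk_add_mk]
    exact add_mem (hπ A) (hπ B)
  have hc : ∀ c : ℂ, π (algebraMap ℂ (cstar M) c) = algebraMap ℂ (E →L[ℂ] E) c := fun c =>
    huniq ((pairAlgebra W).algebraMap_mem c)
  have hstar : ∀ A, π (star A) = star (π A) := fun A => by
    refine huniq ?_
    have := star_mem (hπ A)
    rwa [Prod.star_def] at this
  exact ⟨⟨⟨⟨⟨⟨π, h1⟩, hmul⟩, h0, hadd⟩, hc⟩, hstar⟩, fun i => huniq (hMV i)⟩

end RowIsometryAlgebra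

/-! ### Minimal isometric dilations of row contractions -/

section Existence

variable {H : Type u} [NormedAddCommGroup H] [InnerProductSpace ℂ H] [CompleteSpace H]

/-- A defect of the row operator `[Y_1, …, Y_n]`, split into its components. -/
theorem exists_row_defect {Y : Fin n → H →L[ℂ] H} (hY : rowNorm Y ≤ 1) :
    ∃ Δ : Fin n → H →L[ℂ] PiLp 2 (fun _ : Fin n => H), ∀ i j x y,
      inner ℂ (Δ i x) (Δ j y) + inner ℂ (Y i x) (Y j y) = if i = j then inner ℂ x y else 0 := by
  -- `C` is the column of the `Y_i^*`, so its adjoint is the row `[Y_1, …, Y_n]`. The maps `Δ_i` are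
  -- the components of the square root of `1 - C C^*`.
  let C : H →L[ℂ] PiLp 2 (fun _ : Fin n => H) :=
    (PiLp.continuousLinearEquiv 2 ℂ (fun _ : Fin n => H)).symm.toContinuousLinearMap.comp
      (ContinuousLinearMap.pi fun i => ContinuousLinearMap.adjoint (Y i))
  have hC : ∀ x i, C x i = ContinuousLinearMap.adjoint (Y i) x := fun _ _ => rfl
  have hCn : ∀ x, ‖C x‖ ≤ ‖x‖ := by
    intro x
    refine (sq_le_sq₀ (norm_nonneg _) (norm_nonneg _)).1 ?_
    rw [PiLp.norm_sq_eq_of_L2]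
    refine (sum_norm_adjoint_sq_le Y x).trans ?_
    exact mul_le_of_le_one_left (by positivity) (pow_le_one₀ (rowNorm_nonneg Y) hY)
  have hC1 : ‖ContinuousLinearMap.adjoint C‖ ≤ 1 := by
    rw [LinearIsometryEquiv.norm_map]
    exact C.opNorm_le_bound zero_le_one fun x => by simpa using hCn x
  have hpos : (1 - C ∘L ContinuousLinearMap.adjoint C).IsPositive := by
    rw [ContinuousLinearMap.isPositive_def']
    constructor
    · rw [IsSelfAdjoint, star_sub, star_one, ContinuousLinearMap.star_eq_adjoint,
        ContinuousLinearMap.adjoint_comp, ContinuousLinearMap.adjoint_adjoint]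
    · intro y
      rw [ContinuousLinearMap.reApplyInnerSelf, sub_apply, inner_sub_left, map_sub,
        one_apply_eq_self, ContinuousLinearMap.comp_apply,
        ← ContinuousLinearMap.adjoint_inner_right C, inner_self_eq_norm_sq,
        inner_self_eq_norm_sq, sub_nonneg]
      refine pow_le_pow_left₀ (norm_nonneg _) ?_ 2
      simpa using (ContinuousLinearMap.adjoint C).le_of_opNorm_le hC1 y
  obtain ⟨D, hD⟩ := exists_sqrt hpos
  let e : Fin n → H →L[ℂ] PiLp 2 (fun _ : Fin n => H) := fun i =>
    (PiLp.continuousLinearEquiv 2 ℂ (fun _ : Fin n => H)).symm.toContinuousLinearMap.comp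
      (ContinuousLinearMap.single ℂ (fun _ : Fin n => H) i)
  have he : ∀ i x j, e i x j = Pi.single (M := fun _ => H) i x j := fun _ _ _ => rfl
  have hin : ∀ i x (v : PiLp 2 (fun _ : Fin n => H)), inner ℂ (e i x) v = inner ℂ x (v i) := by
    intro i x v
    rw [PiLp.inner_apply, Finset.sum_eq_single i]
    · rw [he, Pi.single_eq_same]
    · intro j _ hj
      rw [he, Pi.single_eq_of_ne hj, inner_zero_left]
    · simp
  have hY' : ∀ i x, ContinuousLinearMap.adjoint C (e i x) = Y i x := by
    intro i x
    refine ext_inner_right ℂ fun y => ?_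
    rw [ContinuousLinearMap.adjoint_inner_left, hin, hC, ContinuousLinearMap.adjoint_inner_right]
  have hCC : ∀ v, (C ∘L ContinuousLinearMap.adjoint C) v = C (ContinuousLinearMap.adjoint C v) :=
    fun _ => rfl
  refine ⟨fun i => D.comp (e i), fun i j x y => ?_⟩
  change inner ℂ (D (e i x)) (D (e j y)) + _ = _
  rw [hD, sub_apply, one_apply_eq_self, inner_sub_right, hCC,
    ← ContinuousLinearMap.adjoint_inner_left C, hY', hY', sub_add_cancel, hin, he]
  split_ifs with h
  · subst h; rw [Pi.single_eq_same]
  · rw [Pi.single_eq_of_ne h, inner_zero_right]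

/-- Schäffer's construction: `W_i (h, ξ) = (Y_i h, S_i ξ + Δ_i h)`, with `Δ_i h` placed at the empty
word. That coordinate is orthogonal to the ranges of the creation operators, so the defect relation
makes `W` a row isometry. -/
theorem exists_isometric_dilation {Y : Fin n → H →L[ℂ] H} (hY : rowNorm Y ≤ 1) :
    ∃ (K : Type u) (_ : NormedAddCommGroup K) (_ : InnerProductSpace ℂ K) (_ : CompleteSpace K)
      (ι : H →ₗᵢ[ℂ] K) (W : Fin n → K →L[ℂ] K),
      (∀ i j x y, inner ℂ (W i x) (W j y) = if i = j then inner ℂ x y else 0) ∧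
      ∀ i h x, inner ℂ (ι h) (W i x) = inner ℂ (ι (ContinuousLinearMap.adjoint (Y i) h)) x := by
  obtain ⟨Δ, hΔ⟩ := exists_row_defect hY
  let D := PiLp 2 (fun _ : Fin n => H)
  let L := lp (fun _ : Word n => D) 2
  let K := WithLp 2 (H × L)
  have hsingle : ∀ (d : D) (ξ : L), inner ℂ (lp.single 2 [] d : L) ξ = inner ℂ d (ξ []) :=
    fun d ξ => lp.inner_single_left (𝕜 := ℂ) (G := fun _ : Word n => D) [] d ξ
  have hsingle' : ∀ (d : D) (ξ : L), inner ℂ ξ (lp.single 2 [] d : L) = inner ℂ (ξ []) d :=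
    fun d ξ => lp.inner_single_right (𝕜 := ℂ) (G := fun _ : Word n => D) [] d ξ
  let W₀ : Fin n → K →ₗ[ℂ] K := fun i =>
    { toFun := fun p => WithLp.toLp 2 (Y i p.fst, creation D i p.snd + lp.single 2 [] (Δ i p.fst))
      map_add' := fun p q => by
        refine (WithLp.ofLp_injective 2) (Prod.ext ?_ ?_)
        · change Y i (p.fst + q.fst) = Y i p.fst + Y i q.fst
          rw [map_add]
        · change creation D i (p.snd + q.snd) + lp.single 2 [] (Δ i (p.fst + q.fst)) =
            (creation D i p.snd + lp.single 2 [] (Δ i p.fst)) +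
              (creation D i q.snd + lp.single 2 [] (Δ i q.fst))
          rw [map_add, map_add, lp.single_add]
          abel
      map_smul' := fun c p => by
        refine (WithLp.ofLp_injective 2) (Prod.ext ?_ ?_)
        · change Y i (c • p.fst) = c • Y i p.fst
          rw [map_smul]
        · change creation D i (c • p.snd) + lp.single 2 [] (Δ i (c • p.fst)) =
            c • (creation D i p.snd + lp.single 2 [] (Δ i p.fst))
          rw [map_smul, map_smul, lp.single_smul, smul_add] }
  have hfst : ∀ i p, (W₀ i p).fst = Y i p.fst := fun _ _ => rfl
  have hsnd : ∀ i p, (W₀ i p).snd = creation D i p.snd + lp.single 2 [] (Δ i p.fst) :=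
    fun _ _ => rfl
  have hinner : ∀ p q : K, inner ℂ p q = inner ℂ p.fst q.fst + inner ℂ p.snd q.snd :=
    fun p q => WithLp.prod_inner_apply p q
  have hiso : ∀ i j x y, inner ℂ (W₀ i x) (W₀ j y) = if i = j then inner ℂ x y else 0 := by
    intro i j x y
    rw [hinner, hfst, hfst, hsnd, hsnd, inner_add_left, inner_add_right, inner_add_right,
      inner_creation, hsingle, hsingle', hsingle, creation_nil, creation_nil, inner_zero_left,
      inner_zero_right, lp.single_apply_self]
    have := hΔ i j x.fst y.fst
    split_ifs at this ⊢
    · rw [hinner, ← this]; ring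
    · rw [zero_add, zero_add, add_comm]; simpa using this
  let W : Fin n → K →ₗᵢ[ℂ] K := fun i => (W₀ i).isometryOfInner fun x y => by
    rw [hiso, if_pos rfl]
  let ι : H →ₗᵢ[ℂ] K :=
    LinearMap.isometryOfInner
      { toFun := fun h => WithLp.toLp 2 (h, 0)
        map_add' := fun x y => by
          refine (WithLp.ofLp_injective 2) (Prod.ext rfl (add_zero (0 : L)).symm)
        map_smul' := fun c x => by
          refine (WithLp.ofLp_injective 2) (Prod.ext rfl (smul_zero c).symm) } fun x y => by
      refine (hinner _ _).trans ?_
      change inner ℂ x y + inner ℂ (0 : L) (0 : L) = inner ℂ x y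
      rw [inner_zero_left, add_zero]
  refine ⟨K, inferInstance, inferInstance, inferInstance, ι,
    fun i => (W i).toContinuousLinearMap, hiso, fun i h x => ?_⟩
  refine (hinner _ _).trans (Eq.trans ?_ (hinner _ _).symm)
  change inner ℂ h (Y i x.fst) + inner ℂ (0 : L) _ =
    inner ℂ (ContinuousLinearMap.adjoint (Y i) h) x.fst + inner ℂ (0 : L) _
  rw [inner_zero_left, inner_zero_left, ContinuousLinearMap.adjoint_inner_left]

/-- The closed span of the `W_α H` contains `H` and is invariant under every `W_i`; restriction to
it preserves the inner product relations and gives minimality. -/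
theorem exists_minimal_isometric_dilation {Y : Fin n → H →L[ℂ] H} (hY : rowNorm Y ≤ 1) :
    ∃ (K : Type u) (_ : NormedAddCommGroup K) (_ : InnerProductSpace ℂ K) (_ : CompleteSpace K)
      (ι : H →ₗᵢ[ℂ] K) (W : Fin n → K →L[ℂ] K), IsMinimalIsometricDilation Y ι W := by
  obtain ⟨K, _, _, _, ι, W, hiso, hadj⟩ := exists_isometric_dilation hY
  set S : Set K := {x : K | ∃ (α : Word n) (h : H), x = opWord W α (ι h)} with hS
  set N : Submodule ℂ K := (Submodule.span ℂ S).topologicalClosure with hN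
  have hSN : ∀ x ∈ S, x ∈ N := fun x hx =>
    Submodule.le_topologicalClosure _ (Submodule.subset_span hx)
  have hWS : ∀ i, ∀ x ∈ N, W i x ∈ N := by
    intro i
    have h1 : Submodule.span ℂ S ≤ N.comap (W i).toLinearMap := by
      refine Submodule.span_le.2 ?_
      rintro _ ⟨α, h, rfl⟩
      refine hSN _ ⟨i :: α, h, ?_⟩
      rw [opWord_cons]; rfl
    have h2 : IsClosed ((N.comap (W i).toLinearMap : Submodule ℂ K) : Set K) :=
      (Submodule.isClosed_topologicalClosure _).preimage (W i).continuous
    exact fun x hx => Submodule.topologicalClosure_minimal _ h1 h2 hx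
  let W' : Fin n → N →L[ℂ] N := fun i => ((W i).comp N.subtypeL).codRestrict N
    fun x => hWS i x x.2
  have hW' : ∀ i x, (W' i x : K) = W i x := fun _ _ => rfl
  let ι' : H →ₗᵢ[ℂ] N :=
    { toLinearMap := ι.toLinearMap.codRestrict N fun h => hSN _ ⟨[], h, rfl⟩
      norm_map' := fun h => ι.norm_map h }
  have hι' : ∀ h, (ι' h : K) = ι h := fun _ => rfl
  have hword : ∀ (α : Word n) x, (opWord W' α x : K) = opWord W α x := fun α x =>
    opWord_intertwine (A := W') (B := W) (R := N.subtypeL) (fun _ _ => rfl) α x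
  refine ⟨N, inferInstance, inferInstance, inferInstance, ι', W', ?_, ?_, ?_⟩
  · intro i j
    ext1 x
    refine ext_inner_left ℂ fun y => ?_
    rw [mul_apply_eq_comp, ContinuousLinearMap.adjoint_inner_right]
    refine (hiso i j (y : K) (x : K)).trans ?_
    split_ifs
    · rfl
    · simp
  · intro i h
    refine ext_inner_right ℂ fun y => ?_
    rw [ContinuousLinearMap.adjoint_inner_left]
    exact hadj i h (y : K)
  · rw [Spans, Submodule.eq_top_iff']
    intro x
    have hx : (x : K) ∈ closure (Submodule.span ℂ S : Set K) := x.2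
    change x ∈ closure _
    rw [closure_subtype]
    refine closure_mono ?_ hx
    intro y hy
    refine Submodule.span_induction (p := fun y _ => y ∈ (fun z : N => (z : K)) ''
      (Submodule.span ℂ {x : N | ∃ (α : Word n) (h : H), x = opWord W' α (ι' h)} : Set N))
      ?_ ?_ ?_ ?_ hy
    · rintro _ ⟨α, h, rfl⟩
      exact ⟨opWord W' α (ι' h), Submodule.subset_span ⟨α, h, rfl⟩, hword α _⟩
    · exact ⟨0, zero_mem _, rfl⟩
    · rintro _ _ - - ⟨a, ha, rfl⟩ ⟨b, hb, rfl⟩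
      exact ⟨a + b, add_mem ha hb, rfl⟩
    · rintro c _ - ⟨a, ha, rfl⟩
      exact ⟨c • a, Submodule.smul_mem _ c ha, rfl⟩

end Existence

/-! ### Uniqueness -/

section Uniqueness

theorem denseRange_linearCombination {I L : Type*} [NormedAddCommGroup L] [InnerProductSpace ℂ L]
    {u : I → L} (hu : (Submodule.span ℂ (Set.range u)).topologicalClosure = ⊤) :
    DenseRange (Finsupp.linearCombination ℂ u) := by
  rw [DenseRange, ← LinearMap.coe_range, Finsupp.range_linearCombination]
  exact (Submodule.dense_iff_topologicalClosure_eq_top).2 hu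

theorem inner_linearCombination_self {I L : Type*} [NormedAddCommGroup L] [InnerProductSpace ℂ L]
    (u : I → L) (c : I →₀ ℂ) :
    inner ℂ (Finsupp.linearCombination ℂ u c) (Finsupp.linearCombination ℂ u c) =
      ∑ a ∈ c.support, ∑ b ∈ c.support, (starRingEnd ℂ) (c a) * (c b * inner ℂ (u a) (u b)) := by
  simp only [Finsupp.linearCombination_apply, Finsupp.sum, sum_inner, inner_sum, inner_smul_right,
    inner_smul_left]
  rw [Finset.sum_comm]
  refine Finset.sum_congr rfl fun a _ => ?_
  rw [Finset.mul_sum]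
  exact Finset.sum_congr rfl fun b _ => by ring

/-- Two families with the same Gram matrix and dense spans are unitarily equivalent. -/
theorem exists_unitary_of_gram {I K K' : Type*} [NormedAddCommGroup K] [InnerProductSpace ℂ K]
    [CompleteSpace K] [NormedAddCommGroup K'] [InnerProductSpace ℂ K'] [CompleteSpace K']
    {v : I → K} {v' : I → K'} (h : ∀ a b, inner ℂ (v a) (v b) = inner ℂ (v' a) (v' b))
    (hd : (Submodule.span ℂ (Set.range v)).topologicalClosure = ⊤)
    (hd' : (Submodule.span ℂ (Set.range v')).topologicalClosure = ⊤) :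
    ∃ U : K ≃ₗᵢ[ℂ] K', ∀ a, U (v a) = v' a := by
  have hn : ∀ c : I →₀ ℂ,
      ‖Finsupp.linearCombination ℂ v' c‖ = ‖Finsupp.linearCombination ℂ v c‖ := by
    intro c
    rw [@norm_eq_sqrt_re_inner ℂ, @norm_eq_sqrt_re_inner ℂ, inner_linearCombination_self,
      inner_linearCombination_self]
    simp only [h]
  refine ⟨LinearEquiv.extendOfIsometry (LinearEquiv.refl ℂ (I →₀ ℂ))
    (Finsupp.linearCombination ℂ v) (Finsupp.linearCombination ℂ v')
    (denseRange_linearCombination hd) (denseRange_linearCombination hd') hn, fun a => ?_⟩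
  have := LinearEquiv.extendOfIsometry_eq (LinearEquiv.refl ℂ (I →₀ ℂ))
    (Finsupp.linearCombination ℂ v) (Finsupp.linearCombination ℂ v') (denseRange_linearCombination hd)
    (denseRange_linearCombination hd') hn (Finsupp.single a 1)
  simpa using this

variable {H K K' : Type*} [NormedAddCommGroup H] [InnerProductSpace ℂ H] [CompleteSpace H]
  [NormedAddCommGroup K] [InnerProductSpace ℂ K] [CompleteSpace K]
  [NormedAddCommGroup K'] [InnerProductSpace ℂ K'] [CompleteSpace K']

theorem AdjointExtends.opWord {Y : Fin n → H →L[ℂ] H} {ι : H →ₗᵢ[ℂ] K} {W : Fin n → K →L[ℂ] K}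
    (h : AdjointExtends Y ι W) (w : Word n) (x : H) :
    ContinuousLinearMap.adjoint (opWord W w) (ι x) =
      ι (ContinuousLinearMap.adjoint (NCDomain.opWord Y w) x) := by
  induction w generalizing x with
  | nil => simp [← ContinuousLinearMap.star_eq_adjoint]
  | cons i w ih =>
    simp only [opWord_cons, ← ContinuousLinearMap.star_eq_adjoint, star_mul, mul_apply_eq_comp]
      at ih ⊢
    rw [ContinuousLinearMap.star_eq_adjoint (W i), h i x, ih,
      ContinuousLinearMap.star_eq_adjoint (Y i)]

theorem IsMinimalIsometricDilation.gram_nil {Y : Fin n → H →L[ℂ] H} {ι : H →ₗᵢ[ℂ] K}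
    {W : Fin n → K →L[ℂ] K} (h : IsMinimalIsometricDilation Y ι W) (w : Word n) (x y : H) :
    inner ℂ (ι x) (opWord W w (ι y)) =
      inner ℂ (ContinuousLinearMap.adjoint (NCDomain.opWord Y w) x) y := by
  rw [← ContinuousLinearMap.adjoint_inner_left, h.adjoint_extends.opWord, ι.inner_map_map]

/-- The relations `W_i^* W_j = δ_{ij}` cancel first letters until one word is empty; what remains is
determined by `Y` alone. -/
theorem IsMinimalIsometricDilation.gram {Y : Fin n → H →L[ℂ] H} {ι : H →ₗᵢ[ℂ] K}
    {ι' : H →ₗᵢ[ℂ] K'} {W : Fin n → K →L[ℂ] K} {W' : Fin n → K' →L[ℂ] K'}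
    (h : IsMinimalIsometricDilation Y ι W) (h' : IsMinimalIsometricDilation Y ι' W')
    (u v : Word n) (x y : H) :
    inner ℂ (opWord W u (ι x)) (opWord W v (ι y)) =
      inner ℂ (opWord W' u (ι' x)) (opWord W' v (ι' y)) := by
  induction u generalizing v with
  | nil => exact (h.gram_nil v x y).trans (h'.gram_nil v x y).symm
  | cons i u ih =>
    cases v with
    | nil =>
      rw [← inner_conj_symm, ← inner_conj_symm (opWord W' (i :: u) (ι' x))]
      exact congrArg _ ((h.gram_nil (i :: u) y x).trans (h'.gram_nil (i :: u) y x).symm)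
    | cons j v =>
      simp only [opWord_cons, mul_apply_eq_comp]
      rw [← ContinuousLinearMap.adjoint_inner_right (W i),
        ← ContinuousLinearMap.adjoint_inner_right (W' i), ← mul_apply_eq_comp (_ : K →L[ℂ] K),
        ← mul_apply_eq_comp (_ : K' →L[ℂ] K'), h.row_isometry, h'.row_isometry]
      split_ifs
      · exact ih v
      · simp

omit [CompleteSpace H] [CompleteSpace K] in
theorem range_opWord (ι : H →ₗᵢ[ℂ] K) (W : Fin n → K →L[ℂ] K) :
    Set.range (fun p : Word n × H => opWord W p.1 (ι p.2)) =
      {x : K | ∃ (α : Word n) (h : H), x = opWord W α (ι h)} := by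
  ext x
  constructor
  · rintro ⟨p, rfl⟩; exact ⟨p.1, p.2, rfl⟩
  · rintro ⟨α, y, rfl⟩; exact ⟨(α, y), rfl⟩

theorem IsMinimalIsometricDilation.exists_unitary {Y : Fin n → H →L[ℂ] H} {ι : H →ₗᵢ[ℂ] K}
    {ι' : H →ₗᵢ[ℂ] K'} {W : Fin n → K →L[ℂ] K} {W' : Fin n → K' →L[ℂ] K'}
    (h : IsMinimalIsometricDilation Y ι W) (h' : IsMinimalIsometricDilation Y ι' W') :
    ∃ U : K ≃ₗᵢ[ℂ] K', (∀ x, U (ι x) = ι' x) ∧ ∀ i x, U (W i x) = W' i (U x) := by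
  obtain ⟨U, hU⟩ := exists_unitary_of_gram
    (v := fun p : Word n × H => opWord W p.1 (ι p.2))
    (v' := fun p : Word n × H => opWord W' p.1 (ι' p.2))
    (fun a b => h.gram h' a.1 b.1 a.2 b.2) (by rw [range_opWord]; exact h.spans)
    (by rw [range_opWord]; exact h'.spans)
  refine ⟨U, fun x => hU ([], x), fun i x => ?_⟩
  have hcl : IsClosed ((LinearMap.eqLocus
      (U.toContinuousLinearEquiv.toContinuousLinearMap.comp (W i)).toLinearMap
      ((W' i).comp U.toContinuousLinearEquiv.toContinuousLinearMap).toLinearMap :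
      Submodule ℂ K) : Set K) :=
    isClosed_eq (ContinuousLinearMap.continuous _) (ContinuousLinearMap.continuous _)
  have hle : Submodule.span ℂ {x : K | ∃ (α : Word n) (h : H), x = opWord W α (ι h)} ≤
      LinearMap.eqLocus
      (U.toContinuousLinearEquiv.toContinuousLinearMap.comp (W i)).toLinearMap
      ((W' i).comp U.toContinuousLinearEquiv.toContinuousLinearMap).toLinearMap := by
    refine Submodule.span_le.2 ?_
    rintro _ ⟨α, y, rfl⟩
    change U (W i (opWord W α (ι y))) = W' i (U (opWord W α (ι y)))
    rw [hU (α, y)]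
    refine Eq.trans ?_ ((hU (i :: α, y)).trans ?_) <;> simp [opWord_cons]
  have := Submodule.topologicalClosure_minimal _ hle hcl
  rw [h.spans] at this
  exact this Submodule.mem_top

end Uniqueness

/-! ### Representations of `C*(M)` and evaluation -/

section Representation

variable {E F : Type*} [NormedAddCommGroup E] [InnerProductSpace ℂ E] [CompleteSpace E]
  [NormedAddCommGroup F] [InnerProductSpace ℂ F] [CompleteSpace F]

theorem norm_starAlgHom_le {S : StarSubalgebra ℂ (E →L[ℂ] E)} (hS : IsClosed (S : Set (E →L[ℂ] E)))
    (π : S →⋆ₐ[ℂ] (F →L[ℂ] F)) (a : S) : ‖π a‖ ≤ ‖(a : E →L[ℂ] E)‖ := by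
  let : CStarAlgebra (E →L[ℂ] E) := {}
  let : CStarAlgebra (F →L[ℂ] F) := {}
  have := hS
  exact NonUnitalStarAlgHom.norm_apply_le π a

theorem opWord_map {S : StarSubalgebra ℂ (E →L[ℂ] E)} (π : S →⋆ₐ[ℂ] (F →L[ℂ] F)) (A : Fin n → S)
    (w : Word n) : ∃ B : S, (B : E →L[ℂ] E) = opWord (fun i => (A i : E →L[ℂ] E)) w ∧
      π B = opWord (fun i => π (A i)) w := by
  induction w with
  | nil => exact ⟨1, rfl, map_one π⟩
  | cons i w ih =>
    obtain ⟨B, h1, h2⟩ := ih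
    refine ⟨A i * B, ?_, ?_⟩
    · rw [opWord_cons, ← h1]; rfl
    · rw [opWord_cons, ← h2, map_mul]

theorem partialSum_map {S : StarSubalgebra ℂ (E →L[ℂ] E)} (π : S →⋆ₐ[ℂ] (F →L[ℂ] F))
    (A : Fin n → S) (a : Series n) (m : ℕ) :
    ∃ B : S, (B : E →L[ℂ] E) = partialSum a (fun i => (A i : E →L[ℂ] E)) m ∧
      π B = partialSum a (fun i => π (A i)) m := by
  choose B h1 h2 using opWord_map π A
  refine ⟨∑ k ∈ Finset.range m, ∑ α : Fin k → Fin n, a (List.ofFn α) • B (List.ofFn α), ?_, ?_⟩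
  · simp [partialSum, h1]
  · simp [partialSum, h2]

theorem NormSum.map {S : StarSubalgebra ℂ (E →L[ℂ] E)} (hS : IsClosed (S : Set (E →L[ℂ] E)))
    (π : S →⋆ₐ[ℂ] (F →L[ℂ] F)) {A : Fin n → S} {a : Series n} {B : S}
    (h : NormSum a (fun i => (A i : E →L[ℂ] E)) B) : NormSum a (fun i => π (A i)) (π B) := by
  have h0 := tendsto_iff_norm_sub_tendsto_zero.1 h
  refine tendsto_iff_norm_sub_tendsto_zero.2 (squeeze_zero (fun _ => norm_nonneg _) (fun m => ?_) h0)
  obtain ⟨C, h1, h2⟩ := partialSum_map π A a m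
  rw [← h1, ← h2, ← map_sub]
  exact norm_starAlgHom_le hS π (C - B)

theorem RadNormSum.map {S : StarSubalgebra ℂ (E →L[ℂ] E)} (hS : IsClosed (S : Set (E →L[ℂ] E)))
    (π : S →⋆ₐ[ℂ] (F →L[ℂ] F)) {A : Fin n → S} {a : Series n} {B : S}
    (h : RadNormSum a (fun i => (A i : E →L[ℂ] E)) B) : RadNormSum a (fun i => π (A i)) (π B) := by
  obtain ⟨δ, hδ, G, h1, h2⟩ := h
  have hG : ∀ r ∈ Set.Ioo δ 1, G r ∈ S := fun r hr =>
    (h1 r hr).mem (𝒞 := S.toSubalgebra) hS fun i => S.smul_mem (A i).2 _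
  classical
  -- Membership in `S` is known only for `r` in the interval of convergence; the value `0` elsewhere
  -- has no effect on the limit at `1` from the left.
  let G' : ℝ → S := fun r => if hr : r ∈ Set.Ioo δ 1 then ⟨G r, hG r hr⟩ else 0
  have hG' : ∀ r ∈ Set.Ioo δ 1, (G' r : E →L[ℂ] E) = G r := fun r hr => by simp only [G', dif_pos hr]
  refine ⟨δ, hδ, fun r => π (G' r), fun r hr => ?_, ?_⟩
  · have h3 : NormSum a (fun i => (((r : ℂ) • A i : S) : E →L[ℂ] E)) (G' r) := by
      rw [hG' r hr]
      exact h1 r hr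
    have h4 := h3.map hS π
    simp only [map_smul] at h4
    exact h4
  · have h0 := tendsto_iff_norm_sub_tendsto_zero.1 h2
    refine tendsto_iff_norm_sub_tendsto_zero.2
      (squeeze_zero' (.of_forall fun _ => norm_nonneg _) ?_ h0)
    filter_upwards [Ioo_mem_nhdsLT_one hδ] with r hr
    rw [← hG' r hr, ← map_sub]
    exact norm_starAlgHom_le hS π (G' r - B)

theorem NormEval.map {S : StarSubalgebra ℂ (E →L[ℂ] E)} (hS : IsClosed (S : Set (E →L[ℂ] E)))
    (π : S →⋆ₐ[ℂ] (F →L[ℂ] F)) {A B : Fin n → S} {f : Fin n → Series n}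
    (h : NormEval f (fun i => (A i : E →L[ℂ] E)) fun i => B i) :
    NormEval f (fun i => π (A i)) fun i => π (B i) :=
  h.imp (fun h i => (h i).map hS π) (fun h i => (h i).map hS π)

end Representation

/-! ### Minimal dilations -/

section Dilations

variable {H K : Type*} [NormedAddCommGroup H] [InnerProductSpace ℂ H] [CompleteSpace H]
  [NormedAddCommGroup K] [InnerProductSpace ℂ K] [CompleteSpace K]

/-- Taking adjoints of `W_i^* ι = ι Y_i^*` gives an intertwining by the bounded operator `ι^*`, the
form to which `Eval.intertwine` applies. -/
theorem adjointExtends_iff {Y : Fin n → H →L[ℂ] H} {ι : H →ₗᵢ[ℂ] K} {W : Fin n → K →L[ℂ] K} :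
    AdjointExtends Y ι W ↔ ∀ i x,
      ContinuousLinearMap.adjoint ι.toContinuousLinearMap (W i x) =
        Y i (ContinuousLinearMap.adjoint ι.toContinuousLinearMap x) := by
  refine forall_congr' fun i => ⟨fun h x => ?_, fun h y => ?_⟩
  · refine ext_inner_left ℂ fun y => ?_
    rw [ContinuousLinearMap.adjoint_inner_right, ← ContinuousLinearMap.adjoint_inner_left (Y i),
      ContinuousLinearMap.adjoint_inner_right]
    change inner ℂ (ι y) (W i x) = inner ℂ (ι _) x
    rw [← h, ContinuousLinearMap.adjoint_inner_left]
  · refine ext_inner_right ℂ fun x => ?_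
    rw [ContinuousLinearMap.adjoint_inner_left]
    change inner ℂ (ι.toContinuousLinearMap y) (W i x) = inner ℂ (ι.toContinuousLinearMap _) x
    rw [← ContinuousLinearMap.adjoint_inner_right, h, ← ContinuousLinearMap.adjoint_inner_right,
      ContinuousLinearMap.adjoint_inner_left]

/-- The evaluation of series is compatible with the compression to the coinvariant subspace. -/
theorem AdjointExtends.eval {f : Fin n → Series n} {T T' : Fin n → H →L[ℂ] H} {ι : H →ₗᵢ[ℂ] K}
    {V V' : Fin n → K →L[ℂ] K} (h : AdjointExtends T ι V) (hT : Eval f T T') (hV : Eval f V V') :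
    AdjointExtends T' ι V' :=
  adjointExtends_iff.2 (Eval.intertwine (adjointExtends_iff.1 h) hV hT)

omit [CompleteSpace H] in
/-- Generators of the same closed algebra give the same cyclic subspace. -/
theorem Spans.of_mem {ι : H →ₗᵢ[ℂ] K} {V W : Fin n → K →L[ℂ] K} (h : Spans ι W)
    (hW : ∀ 𝒞 : Subalgebra ℂ (K →L[ℂ] K), IsClosed (𝒞 : Set (K →L[ℂ] K)) → (∀ i, V i ∈ 𝒞) →
      ∀ i, W i ∈ 𝒞) : Spans ι V := by
  set S : Set K := {x : K | ∃ (α : Word n) (h : H), x = opWord V α (ι h)} with hS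
  set 𝒞 : Subalgebra ℂ (K →L[ℂ] K) := (Algebra.adjoin ℂ (Set.range V)).topologicalClosure
  have hV𝒞 : ∀ i, V i ∈ 𝒞 := fun i =>
    Subalgebra.le_topologicalClosure _ (Algebra.subset_adjoin ⟨i, rfl⟩)
  have hstab : ∀ A ∈ Algebra.adjoin ℂ (Set.range V), ∀ x ∈ Submodule.span ℂ S,
      A x ∈ Submodule.span ℂ S := by
    intro A hA
    refine Algebra.adjoin_induction
      (p := fun A _ => ∀ x ∈ Submodule.span ℂ S, A x ∈ Submodule.span ℂ S) ?_ ?_ ?_ ?_ hA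
    · rintro _ ⟨i, rfl⟩ x hx
      have hle : Submodule.span ℂ S ≤ (Submodule.span ℂ S).comap (V i).toLinearMap := by
        refine Submodule.span_le.2 ?_
        rintro _ ⟨α, y, rfl⟩
        exact Submodule.subset_span ⟨i :: α, y, by rw [opWord_cons]; rfl⟩
      exact hle hx
    · intro c x hx
      rw [Algebra.algebraMap_eq_smul_one]
      exact Submodule.smul_mem _ c hx
    · intro A B _ _ hA hB x hx
      exact add_mem (hA x hx) (hB x hx)
    · intro A B _ _ hA hB x hx
      exact hA _ (hB x hx)
  have hmem : ∀ A ∈ 𝒞, ∀ x ∈ S, A x ∈ (Submodule.span ℂ S).topologicalClosure := by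
    intro A hA x hx
    have hcl : IsClosed {A : K →L[ℂ] K | A x ∈ (Submodule.span ℂ S).topologicalClosure} :=
      (Submodule.isClosed_topologicalClosure _).preimage (ContinuousLinearMap.apply ℂ K x).continuous
    have hle : ((Algebra.adjoin ℂ (Set.range V) : Subalgebra ℂ (K →L[ℂ] K)) : Set (K →L[ℂ] K)) ⊆
        {A : K →L[ℂ] K | A x ∈ (Submodule.span ℂ S).topologicalClosure} := fun A hA =>
      Submodule.le_topologicalClosure _ (hstab A hA x (Submodule.subset_span hx))
    exact closure_minimal hle hcl hA
  rw [Spans, ← top_le_iff, ← (show _ = ⊤ from h)]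
  refine Submodule.topologicalClosure_minimal _ (Submodule.span_le.2 ?_)
    (Submodule.isClosed_topologicalClosure _)
  rintro _ ⟨α, y, rfl⟩
  exact hmem _ (opWord_mem (hW 𝒞 (Subalgebra.isClosed_topologicalClosure _) hV𝒞) α) _
    ⟨[], y, rfl⟩

variable {f g : Fin n → Series n} {M : Fin n → H2 n →L[ℂ] H2 n} {T Y : Fin n → H →L[ℂ] H}
  {ι : H →ₗᵢ[ℂ] K}

/-- Evaluations have unique values, so a strong or radial value of `g` at a row contraction is its
norm value, and the norm convergence of `f` there comes for free. -/
theorem normSum_of_eval (hg : IsInverse f g) (hf : ∃ r ∈ Set.Ioo (0 : ℝ) 1, HasModel (scale r f))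
    (hY : rowNorm Y ≤ 1) (h : Eval g Y T) : (∀ i, NormSum (g i) Y (T i)) ∧ NormEval f T Y := by
  obtain ⟨T', h1, h2⟩ := exists_normSum_normEval hg hf hY
  obtain rfl : T = T' := Eval.unique h (Or.inl fun i => (h1 i).sotSum)
  exact ⟨h1, h2⟩

/-- `g` maps minimal isometric dilations of `f(T)` to minimal dilations of `T`. -/
theorem IsMinimalIsometricDilation.isMinimalDilation (hg : IsInverse f g)
    (hf : ∃ r ∈ Set.Ioo (0 : ℝ) 1, HasModel (scale r f)) (hM : IsUniversalModel f M)
    (hT : Eval g Y T) {W : Fin n → K →L[ℂ] K} (hW : IsMinimalIsometricDilation Y ι W) :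
    ∃ V : Fin n → K →L[ℂ] K, (∀ i, NormSum (g i) W (V i)) ∧ IsMinimalDilation f g M T ι V := by
  have hW1 := rowNorm_le_one_of_isometry hW.row_isometry
  obtain ⟨V, hV, hVW⟩ := exists_normSum_normEval hg hf hW1
  have hev : Eval g W V := Or.inl fun i => (hV i).sotSum
  exact ⟨V, hV, ⟨W, hVW.eval, hev, hW1⟩,
    exists_representation hW.row_isometry (hM.normSum hg hf) hV,
    hW.adjoint_extends.eval hT hev, hW.spans.of_mem fun _ hc h => hVW.mem hc h⟩

/-- Every minimal dilation of `T` is `g(W)` for a minimal isometric dilation `W` of `f(T)`. -/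
theorem IsMinimalDilation.exists_isometric (hg : IsInverse f g)
    (hf : ∃ r ∈ Set.Ioo (0 : ℝ) 1, HasModel (scale r f)) (hM : IsUniversalModel f M)
    (hT : Eval f T Y) {V : Fin n → K →L[ℂ] K} (hV : IsMinimalDilation f g M T ι V) :
    ∃ W : Fin n → K →L[ℂ] K, IsMinimalIsometricDilation Y ι W ∧ ∀ i, NormSum (g i) W (V i) := by
  obtain ⟨W, hVW, hWV, hW1⟩ := hV.mem_domain
  obtain ⟨hsum, -⟩ := normSum_of_eval hg hf hW1 hWV
  obtain ⟨π, hπ⟩ := hV.rep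
  have hcl : IsClosed (cstar M : Set (H2 n →L[ℂ] H2 n)) :=
    StarSubalgebra.isClosed_topologicalClosure _
  have hMS : NormEval f M shift :=
    (normSum_of_eval hg hf rowNorm_shift_le
      (Or.inl fun i => (hM.normSum hg hf i).sotSum)).2
  have hS : ∀ i, shift i ∈ cstar M :=
    hMS.mem (𝒞 := (cstar M).toSubalgebra) hcl (mem_cstar M)
  have hπS : NormEval f V fun i => π ⟨shift i, hS i⟩ := by
    have := NormEval.map hcl π (A := fun i => ⟨M i, mem_cstar M i⟩)
      (B := fun i => ⟨shift i, hS i⟩) hMS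
    simpa only [hπ] using this
  -- Both tuples are values of `f` at `V`: one from membership in the domain, the other by applying
  -- `π` to the norm limit `f(M) = S`. Hence `W` inherits the relations of the creation operators.
  have hWS : ∀ i, W i = π ⟨shift i, hS i⟩ := fun i => congrFun (hVW.unique hπS.eval) i
  refine ⟨W, ⟨fun i j => ?_, hV.adjoint_extends.eval hT hVW,
    hV.spans.of_mem fun _ hc h i => (hsum i).mem hc h⟩, hsum⟩
  rw [hWS, hWS, ← ContinuousLinearMap.star_eq_adjoint, ← map_star, ← map_mul]
  have e : star (⟨shift i, hS i⟩ : cstar M) * ⟨shift j, hS j⟩ = if i = j then 1 else 0 := by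
    refine Subtype.ext ((shift_isometry i j).trans ?_)
    split_ifs <;> rfl
  rw [e]
  split_ifs
  · exact map_one π
  · exact map_zero π

end Dilations

end NCDomain

end

theorem theorem3p6 {n : ℕ} (hn : 1 ≤ n) (f g : Fin n → Series n)
    (M : Fin n → H2 n →L[ℂ] H2 n)
    (hf : MemMbrad f ∨ (MemMrad f ∧ MemMnorm f))
    (hM : IsUniversalModel f M) (hg : IsInverse f g)
    {H : Type u} [NormedAddCommGroup H] [InnerProductSpace ℂ H] [CompleteSpace H]
    (T : Fin n → H →L[ℂ] H) (hT : T ∈ domain f g) :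
    -- existence of a minimal dilation
    (∃ (K : Type u) (_ : NormedAddCommGroup K) (_ : InnerProductSpace ℂ K) (_ : CompleteSpace K)
      (ι : H →ₗᵢ[ℂ] K) (V : Fin n → K →L[ℂ] K), IsMinimalDilation f g M T ι V) ∧
    -- uniqueness up to an isomorphism
    (∀ (K : Type v) [NormedAddCommGroup K] [InnerProductSpace ℂ K] [CompleteSpace K]
      (K' : Type w) [NormedAddCommGroup K'] [InnerProductSpace ℂ K'] [CompleteSpace K']
      (ι : H →ₗᵢ[ℂ] K) (ι' : H →ₗᵢ[ℂ] K') (V : Fin n → K →L[ℂ] K) (V' : Fin n → K' →L[ℂ] K'),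
      IsMinimalDilation f g M T ι V → IsMinimalDilation f g M T ι' V' →
      ∃ U : K ≃ₗᵢ[ℂ] K', (∀ h, U (ι h) = ι' h) ∧ ∀ i x, U (V i x) = V' i (U x)) ∧
    -- the minimal dilations are the `g(W)`, for the minimal isometric dilations `W` of `f(T)`
    (∀ Y : Fin n → H →L[ℂ] H, Eval f T Y →
      (∃ (K : Type u) (_ : NormedAddCommGroup K) (_ : InnerProductSpace ℂ K) (_ : CompleteSpace K)
        (ι : H →ₗᵢ[ℂ] K) (W : Fin n → K →L[ℂ] K), IsMinimalIsometricDilation Y ι W) ∧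
      ∀ (K : Type v) [NormedAddCommGroup K] [InnerProductSpace ℂ K] [CompleteSpace K]
        (ι : H →ₗᵢ[ℂ] K),
        (∀ W : Fin n → K →L[ℂ] K, IsMinimalIsometricDilation Y ι W →
          ∃ V : Fin n → K →L[ℂ] K, (∀ i, NormSum (g i) W (V i)) ∧
            IsMinimalDilation f g M T ι V) ∧
        (∀ V : Fin n → K →L[ℂ] K, IsMinimalDilation f g M T ι V →
          ∃ W : Fin n → K →L[ℂ] K, IsMinimalIsometricDilation Y ι W ∧
            ∀ i, NormSum (g i) W (V i))) := by
  have hr := exists_hasModel_scale hf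
  obtain ⟨Y₀, hfT, hgY, hY₀⟩ := hT
  refine ⟨?_, ?_, fun Y hY => ?_⟩
  · obtain ⟨K, _, _, _, ι, W, hW⟩ := exists_minimal_isometric_dilation hY₀
    obtain ⟨V, -, hV⟩ := hW.isMinimalDilation hg hr hM hgY
    exact ⟨K, _, _, ‹_›, ι, V, hV⟩
  · intro K _ _ _ K' _ _ _ ι ι' V V' hV hV'
    obtain ⟨W, hW, hgW⟩ := hV.exists_isometric hg hr hM hfT
    obtain ⟨W', hW', hgW'⟩ := hV'.exists_isometric hg hr hM hfT
    -- The unitary is found for the isometric dilations of `f(T)`; being bounded, it passes through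
    -- the series `g` and so intertwines `V` and `V'`.
    obtain ⟨U, hU, hUW⟩ := hW.exists_unitary hW'
    exact ⟨U, hU, Eval.intertwine (R := U.toContinuousLinearEquiv.toContinuousLinearMap) hUW
      (Or.inl fun i => (hgW i).sotSum) (Or.inl fun i => (hgW' i).sotSum)⟩
  · obtain rfl : Y = Y₀ := hY.unique hfT
    exact ⟨exists_minimal_isometric_dilation hY₀, fun K _ _ _ ι =>
      ⟨fun W hW => hW.isMinimalDilation hg hr hM hgY,
        fun V hV => hV.exists_isometric hg hr hM hY⟩⟩
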